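/- Let $\mathbb S=\mathbb R/2\pi\mathbb Z$ with the geodesic distance $d_{\mathbb S}$, $I=[0,1]$, and $G=\mathbb S\times\mathbb R\times I$ with points $P=(\theta,\omega,x)$, Lebesgue measure $dP=d\theta\,d\omega\,dx$ and distance $d_G(P,P')=\sqrt{d_{\mathbb S}(\theta,\theta')^2+(\omega-\omega')^2+(x-x')^2}$. For finite Borel measures $\mu,\nu$ on $G$ let $$d(\mu,\nu)=\sup\Big\{\Big|\int_G f\,d\mu-\int_G f\,d\nu\Big| : f:G\to[0,1],\ |f(P)-f(Q)|\le d_G(P,Q)\ \ \forall P,Q\in G\Big\}$$ be the bounded Lipschitz distance. Let $K\in\mathbb R$, let $W:I^2\to\mathbb R$ be Lipschitz continuous, let $g$ be a continuous probability density on $\mathbb R$, and let $\hat\rho^0_{\theta|\omega}(\theta,\omega,\xi)$ be a nonnegative continuous function on $G$ that is continuous in $\xi\in I$ uniformly in all its arguments (for every $\varepsilon>0$ there is $\delta>0$ such that $|\xi_1-\xi_2|<\delta$ implies $|\hat\rho^0_{\theta|\omega}(\theta,\omega,\xi_1)-\hat\rho^0_{\theta|\omega}(\theta,\omega,\xi_2)|<\varepsilon$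 for all $\theta,\omega$) and satisfies $\int_{\mathbb S}\hat\rho^0_{\theta|\omega}(\phi,\omega,\xi)\,d\phi=1$ for all $(\omega,\xi)$. Consider the initial value problem $$\partial_t\hat\rho+\partial_\theta\{\hat\rho\,V\}=0,\qquad V(t,\theta,\omega,x)=\omega+K\int_I\int_{\mathbb R}\int_{\mathbb S}W(x,y)\sin(\phi-\theta)\,\hat\rho(t,\phi,\lambda,y)\,d\phi\,d\lambda\,dy,$$ $$\hat\rho(0,\theta,\omega,x)=\hat\rho^0_{\theta|\omega}(\theta,\omega,x)\,g(\omega).$$ A weak solution on $[0,T]$ is a measurable function $\hat\rho:[0,T]\times G\to\mathbb R$ such that $\hat\rho(t,\cdot)$ is integrable on $G$ for every $t\in[0,T]$, $t\mapsto\int_G f(P)\hat\rho(t,P)\,dP$ is continuous on $[0,T]$ for every bounded continuous $f:G\to\mathbb R$, and $$\int_0^T\!\!\int_G\hat\rho\,(\partial_t w+V\,\partial_\theta w)\,dP\,dt+\int_G\hat\rho^0_{\theta|\omega}(\theta,\omega,x)\,g(\omega)\,w(0,P)\,dP=0$$ for every smooth $w$ with compact support in $[0,T)\times G$. Then for every $T>0$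 the following hold. 1. The initial value problem has a weak solution $\hat\rho$ on $[0,T]$, and it is unique: any other weak solution agrees with $\hat\rho(t,\cdot)$ almost everywhere on $G$ for every $t\in[0,T]$. 2. For every $t\in[0,T]$, $\hat\rho(t,\cdot)\ge0$ almost everywhere and $\int_G\hat\rho(t,P)\,dP=1$, so that $\mu_t(A)=\int_A\hat\rho(t,P)\,dP$ defines a Borel probability measure on $G$. 3. Let $\omega_1,\omega_2,\dots\in\mathbb R$ and, for each $n$, let $X_n=\{\xi_{n1},\dots,\xi_{nn}\}\subset I$ and let $\theta_{n1},\dots,\theta_{nn}:[0,T]\to\mathbb S$ solve the Kuramoto model on the weighted graph $G(W,X_n)$ (the graph on the nodes $1,\dots,n$ with the weights $W(\xi_{ni},\xi_{nj})$), $$\dot\theta_{ni}=\omega_i+\frac Kn\sum_{j=1}^nW(\xi_{ni},\xi_{nj})\sin(\theta_{nj}-\theta_{ni}),\qquad i=1,\dots,n.$$ Let $\mu^n_t=\frac1n\sum_{i=1}^n\delta_{(\theta_{ni}(t),\,\omega_i,\,\xi_{ni})}$. If $d(\mu^n_0,\mu_0)\to0$ as $n\to\infty$, then $\sup_{t\in[0,T]}d(\mu^n_t,\mu_t)\to0$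 as $n\to\infty$. -/

import Mathlib

open Real Set Filter Topology MeasureTheory
open scoped ENNReal

namespace KuramotoGraph

noncomputable section

/-- The circle `ℝ / 2πℤ`. Mathlib's distance on it is the geodesic one,
`min {|θ - θ'|, 2π - |θ - θ'|}` for representatives in `[0, 2π)`, and its volume is Lebesgue
measure of total mass `2π`. -/
abbrev Circ : Type := AddCircle (2 * π)

/-- The length of the circle is positive (this provides its measure). -/
instance fact_two_pi_pos : Fact (0 < 2 * π) := ⟨Real.two_pi_pos⟩

/-- The phase space `G = 𝕊 × ℝ × I` with points `(θ, ω, x)`; `dP` is the product of the Lebesgue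
measures (`volume`). -/
abbrev PhaseSpace : Type := Circ × ℝ × unitInterval

/-- The sine of a point of the circle. -/
def circSin (θ : Circ) : ℝ := Real.sin_periodic.lift θ

/-- The Euclidean product distance on `G`. -/
def dG (P Q : PhaseSpace) : ℝ :=
  √(dist P.1 Q.1 ^ 2 + (P.2.1 - Q.2.1) ^ 2 + ((P.2.2 : ℝ) - (Q.2.2 : ℝ)) ^ 2)

/-- The functions `f : G → [0, 1]` that are `1`-Lipschitz for `dG`. -/
def lipClass : Set (PhaseSpace → ℝ) :=
  {f | (∀ P, f P ∈ Icc (0 : ℝ) 1) ∧ ∀ P Q, |f P - f Q| ≤ dG P Q}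

/-- The bounded Lipschitz distance between measures on `G`. -/
def dBL (μ ν : Measure PhaseSpace) : ℝ :=
  sSup {r : ℝ | ∃ f ∈ lipClass, r = |(∫ P, f P ∂μ) - ∫ P, f P ∂ν|}

/-- `W` is Lipschitz continuous on `I²`. -/
def IsLipschitzGraphon (W : unitInterval → unitInterval → ℝ) : Prop :=
  ∃ L : ℝ, ∀ x₁ y₁ x₂ y₂ : unitInterval,
    |W x₁ y₁ - W x₂ y₂| ≤ L * √(((x₁ : ℝ) - x₂) ^ 2 + ((y₁ : ℝ) - y₂) ^ 2)

/-- The edge weights of the weighted graph `G(W, X_n)` on the nodes `[n]`, `X_n = {ξ i}`. -/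
def graphWeight (W : unitInterval → unitInterval → ℝ) {n : ℕ} (ξ : Fin n → unitInterval)
    (i j : Fin n) : ℝ :=
  W (ξ i) (ξ j)

/-- The circle-valued phases `θ` solve, on the time interval `[0, T]`, the Kuramoto model
`θ_i' = ω_i + K n⁻¹ ∑_j w_ij sin (θ_j - θ_i)`. The derivative of a circle-valued function is
that of a real-valued lift (one-sided at the two ends of the interval). -/
def IsKuramotoSolution (K T : ℝ) {n : ℕ} (w : Fin n → Fin n → ℝ) (ω : Fin n → ℝ)
    (θ : Fin n → ℝ → Circ) : Prop :=
  ∃ φ : Fin n → ℝ → ℝ,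
    (∀ i, ∀ t ∈ Icc 0 T, ((φ i t : ℝ) : Circ) = θ i t) ∧
    ∀ i, ∀ t ∈ Icc 0 T,
      HasDerivWithinAt (φ i)
        (ω i + K * (n : ℝ)⁻¹ * ∑ j, w i j * circSin (θ j t - θ i t)) (Icc 0 T) t

/-- The empirical measure `n⁻¹ ∑ δ_{P_i}`. -/
def empiricalMeasure {n : ℕ} (P : Fin n → PhaseSpace) : Measure PhaseSpace :=
  (n : ℝ≥0∞)⁻¹ • ∑ i, Measure.dirac (P i)

/-- `g` is a continuous probability density on `ℝ`. -/
structure IsFrequencyDensity (g : ℝ → ℝ) : Prop where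
  continuous : Continuous g
  nonneg : ∀ ω, 0 ≤ g ω
  integrable : Integrable g
  integral_eq_one : ∫ ω, g ω = 1

/-- The conditional densities `p (θ, ω, ξ)` of the initial phase given `(ω, ξ)`. -/
structure IsInitialConditionalDensity (p : PhaseSpace → ℝ) : Prop where
  continuous : Continuous p
  nonneg : ∀ P, 0 ≤ p P
  uniform_in_xi : ∀ ε > 0, ∃ δ > 0, ∀ ξ₁ ξ₂ : unitInterval, |(ξ₁ : ℝ) - ξ₂| < δ →
    ∀ (θ : Circ) (ω : ℝ), |p (θ, ω, ξ₁) - p (θ, ω, ξ₂)| < ε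
  integral_eq_one : ∀ (ω : ℝ) (ξ : unitInterval), ∫ θ : Circ, p (θ, ω, ξ) = 1

/-- The velocity field
`V(θ, ω, x) = ω + K ∫ W(x, y) sin (φ - θ) ρ(φ, λ, y) dφ dλ dy` of a density `ρ` on `G`. -/
def velocity (W : unitInterval → unitInterval → ℝ) (K : ℝ) (ρ : PhaseSpace → ℝ)
    (P : PhaseSpace) : ℝ :=
  P.2.1 + K * ∫ Q : PhaseSpace, W P.2.2 Q.2.2 * circSin (Q.1 - P.1) * ρ Q

/-- The derivative with respect to the angle. -/
def derivTheta (f : PhaseSpace → ℝ) (P : PhaseSpace) : ℝ :=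
  deriv (fun s : ℝ => f (P.1 + (s : Circ), P.2)) 0

/-- Test functions: smooth functions of `(t, θ, ω, x)` (up to the boundary of `I`) whose support
in `[0, T] × G` is a compact subset of `[0, T) × G`. -/
structure IsTestFunction (T : ℝ) (w : ℝ → PhaseSpace → ℝ) : Prop where
  smooth : ∃ F : ℝ × ℝ × ℝ × ℝ → ℝ, ContDiff ℝ (⊤ : ℕ∞) F ∧
    ∀ (t θ ω : ℝ) (x : unitInterval), w t ((θ : Circ), ω, x) = F (t, θ, ω, (x : ℝ))
  support : ∃ τ < T, ∃ R : ℝ, ∀ (t : ℝ) (θ : Circ) (ω : ℝ) (x : unitInterval),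
    (τ ≤ t ∨ R ≤ |ω|) → w t (θ, ω, x) = 0

/-- `ρ` is a weak solution on `[0, T]` of `∂_t ρ + ∂_θ (ρ V) = 0`, `ρ(0, ·) = ρ₀`, where `V` is
the velocity field of `ρ` itself: an integrable density (of no prescribed sign or mass) for every
time, weakly continuous in time, that satisfies the equation and the initial condition when
tested against smooth functions. -/
structure IsWeakSolution (W : unitInterval → unitInterval → ℝ) (K T : ℝ)
    (ρ₀ : PhaseSpace → ℝ) (ρ : ℝ → PhaseSpace → ℝ) : Prop where
  measurable : AEStronglyMeasurable (fun z : ℝ × PhaseSpace => ρ z.1 z.2)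
    (((volume : Measure ℝ).restrict (Icc 0 T)).prod (volume : Measure PhaseSpace))
  integrable : ∀ t ∈ Icc 0 T, Integrable (ρ t)
  weak_continuous : ∀ f : BoundedContinuousFunction PhaseSpace ℝ,
    ContinuousOn (fun t => ∫ P, f P * ρ t P) (Icc 0 T)
  weak_eq : ∀ w : ℝ → PhaseSpace → ℝ, IsTestFunction T w →
    (∫ t in (0 : ℝ)..T, ∫ P, ρ t P *
      (deriv (fun s => w s P) t + velocity W K (ρ t) P * derivTheta (w t) P))
    + ∫ P, ρ₀ P * w 0 P = 0

/-- The measure `A ↦ ∫_A ρ dP`. -/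
def densityMeasure (ρ : PhaseSpace → ℝ) : Measure PhaseSpace :=
  (volume : Measure PhaseSpace).withDensity (fun P => ENNReal.ofReal (ρ P))

end

end KuramotoGraph

/-!
The field that a measure `μ` exerts at the site `x` enters the speed of an oscillator only through
the two numbers `z = K ∫ W(x, y) (cos φ, sin φ) dμ`, so that `V = ω + z₂ cos θ - z₁ sin θ` for
measures and for densities alike. A field `Z t x` that is continuous in time moves the points of `G`
along characteristics, and `μ_t` must be the image of `μ_0` under the flow of the field it
generates. A contraction in a norm weighted by an exponential in time provides such a
self-consistent field. Comparing two self-consistent flows by Grönwall's inequality gives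
Dobrushin's estimate `d(μ_t, ν_t) ≤ C d(μ_0, ν_0)`. A solution of the Kuramoto model is a
self-consistent flow started at the empirical measure, whence the convergence.

The density transported by the flow, with its Jacobian, is a weak solution. Conversely, a weak
solution `ρ`, which may a priori change sign, has a continuous and Lipschitz field of its own;
testing with functions carried by the flow of that field, after mollification, identifies `ρ t`
with the transported density. That field is then self-consistent, hence unique, and so is `ρ`.
-/

open scoped BoundedContinuousFunction

namespace KuramotoGraph

noncomputable section

/-! ### Flows of bounded Lipschitz vector fields -/

section OrdinaryDifferentialEquation

variable {E : Type*} [NormedAddCommGroup E] [NormedSpace ℝ E]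

lemma norm_le_mul_exp_of_norm_deriv_le {D D' : ℝ → E} {T b c m : ℝ} (hc : ContinuousOn D (Icc 0 T))
    (hD : ∀ t ∈ Ico 0 T, HasDerivWithinAt D (D' t) (Ici t) t)
    (hbound : ∀ t ∈ Ico 0 T, ‖D' t‖ ≤ b * ‖D t‖ + m * exp (c * t)) (hbc : b < c) (hm : 0 ≤ m) :
    ∀ t ∈ Icc 0 T, ‖D t‖ ≤ (‖D 0‖ + m / (c - b)) * exp (c * t) := by
  intro t ht
  have hcb : 0 < c - b := sub_pos.2 hbc
  have hmul : m / (c - b) * (c - b) = m := div_mul_cancel₀ _ hcb.ne'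
  have barrier : ∀ ε > 0, ‖D t‖ ≤ (‖D 0‖ + m / (c - b) + ε) * exp (c * t) := by
    intro ε hε
    set C := ‖D 0‖ + m / (c - b) + ε
    have hexp : ∀ x : ℝ, HasDerivAt (fun t => C * exp (c * t)) (C * (exp (c * x) * c)) x :=
      fun x => by simpa using ((hasDerivAt_id x).const_mul c).exp.const_mul C
    refine image_norm_le_of_norm_deriv_right_lt_deriv_boundary' hc hD ?_
      (fun x _ => (hexp x).continuousAt.continuousWithinAt) (fun x _ => (hexp x).hasDerivWithinAt)
      (fun x hx hDx => ?_) ht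
    · have : 0 ≤ m / (c - b) := by positivity
      simp only [mul_zero, exp_zero, mul_one]
      linarith
    · have hlt : b * C + m < C * c := by
        nlinarith [mul_nonneg (norm_nonneg (D 0)) hcb.le, mul_pos hε hcb]
      calc ‖D' x‖ ≤ b * (C * exp (c * x)) + m * exp (c * x) := hDx ▸ hbound x hx
        _ = (b * C + m) * exp (c * x) := by ring
        _ < C * c * exp (c * x) := by gcongr
        _ = C * (exp (c * x) * c) := by ring
  refine le_of_forall_pos_le_add fun ε hε => ?_
  have := barrier (ε / exp (c * t)) (by positivity)
  rwa [add_mul, div_mul_cancel₀ _ (exp_pos _).ne'] at this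

/-- Time-dependent vector fields with a global flow: continuous in time, bounded, and uniformly
`L`-Lipschitz in space. -/
structure IsFlowField (L : ℝ) (v : ℝ → E → E) : Prop where
  continuous : ∀ x, Continuous fun t => v t x
  norm_sub_le : ∀ t x y, ‖v t x - v t y‖ ≤ L * ‖x - y‖
  bounded : ∃ M, ∀ t x, ‖v t x‖ ≤ M

omit [NormedSpace ℝ E] in
lemma IsFlowField.lipschitzWith {L : ℝ} {v : ℝ → E → E} (hv : IsFlowField L v) (t : ℝ) :
    LipschitzWith L.toNNReal (v t) :=
  LipschitzWith.of_dist_le' fun x y => by simpa only [dist_eq_norm] using hv.norm_sub_le t x y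

lemma norm_sub_le_of_isIntegralCurveOn {v v' : ℝ → E → E} {γ γ' : ℝ → E} {L T c m : ℝ}
    (hv : ∀ t ∈ Icc 0 T, ∀ x y, ‖v t x - v t y‖ ≤ L * ‖x - y‖)
    (hγ : IsIntegralCurveOn γ v (Icc 0 T)) (hγ' : IsIntegralCurveOn γ' v' (Icc 0 T))
    (hm : 0 ≤ m) (hvv' : ∀ t ∈ Icc 0 T, ∀ x, ‖v t x - v' t x‖ ≤ m * exp (c * t)) (hc : L < c) :
    ∀ t ∈ Icc 0 T, ‖γ t - γ' t‖ ≤ (‖γ 0 - γ' 0‖ + m / (c - L)) * exp (c * t) := by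
  refine norm_le_mul_exp_of_norm_deriv_le (D := fun t => γ t - γ' t)
    (D' := fun t => v t (γ t) - v' t (γ' t)) (hγ.continuousOn.sub hγ'.continuousOn)
    (fun t ht => ?_) (fun t ht => ?_) hc hm
  · have ht' := Ico_subset_Icc_self ht
    exact ((hγ t ht').sub (hγ' t ht')).mono_of_mem_nhdsWithin (Icc_mem_nhdsGE_of_mem ht)
  · have ht' := Ico_subset_Icc_self ht
    exact (norm_sub_le_norm_sub_add_norm_sub _ (v t (γ' t)) _).trans
      (add_le_add (hv t ht' _ _) (hvv' t ht' _))

lemma norm_sub_le_of_isIntegralCurve {v v' : ℝ → E → E} {γ γ' : ℝ → E} {L m : ℝ}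
    (hv : IsFlowField L v) (hL : 0 ≤ L) (hγ : IsIntegralCurve γ v) (hγ' : IsIntegralCurve γ' v')
    (hvv' : ∀ t x, ‖v t x - v' t x‖ ≤ m) (s t : ℝ) :
    ‖γ t - γ' t‖ ≤ (‖γ s - γ' s‖ + m) * exp ((L + 1) * |t - s|) := by
  have hm : 0 ≤ m := (norm_nonneg _).trans (hvv' 0 0)
  -- Both directions of time reduce to the forward one along the curves `τ ↦ γ (s + a τ)`, `a = ±1`.
  have forward : ∀ a : ℝ, |a| = 1 → ∀ τ, 0 ≤ τ → ‖γ (τ * a + s) - γ' (τ * a + s)‖ ≤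
      (‖γ s - γ' s‖ + m) * exp ((L + 1) * τ) := by
    intro a ha τ hτ
    have := norm_sub_le_of_isIntegralCurveOn (L := L) (T := τ) (c := L + 1) (m := m)
      (fun u _ x y => ?_) (((hγ.comp_add s).comp_mul a).isIntegralCurveOn _)
      (((hγ'.comp_add s).comp_mul a).isIntegralCurveOn _) hm (fun u hu x => ?_) (by linarith) τ
      ⟨hτ, le_rfl⟩
    · simpa using this
    · simp only [Pi.smul_apply, Function.comp_apply, ← smul_sub, norm_smul, Real.norm_eq_abs, ha,
        one_mul]
      exact hv.norm_sub_le _ x y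
    · simp only [Pi.smul_apply, Function.comp_apply, ← smul_sub, norm_smul, Real.norm_eq_abs, ha,
        one_mul]
      exact (hvv' _ x).trans (le_mul_of_one_le_right hm
        (one_le_exp (mul_nonneg (by linarith) hu.1)))
  rcases le_total s t with h | h
  · simpa [abs_of_nonneg (sub_nonneg.2 h)] using forward 1 (by simp) (t - s) (sub_nonneg.2 h)
  · simpa [abs_of_nonpos (sub_nonpos.2 h)] using forward (-1) (by simp) (s - t) (sub_nonneg.2 h)

variable [CompleteSpace E] {L : ℝ} {v : ℝ → E → E}

lemma IsFlowField.exists_isIntegralCurveOn (hv : IsFlowField L v) (s : ℝ) (x : E) (n : ℕ) :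
    ∃ γ, γ s = x ∧ IsIntegralCurveOn γ v (Icc (s - (n + 1)) (s + (n + 1))) := by
  obtain ⟨M, hM⟩ := hv.bounded
  have : (0 : ℝ) ≤ n := n.cast_nonneg
  have hM0 : 0 ≤ M := (norm_nonneg _).trans (hM 0 0)
  have hs : s ∈ Icc (s - ((n : ℝ) + 1)) (s + (n + 1)) := ⟨by linarith, by linarith⟩
  have : IsPicardLindelof v (⟨s, hs⟩ : Icc _ _) x (M * (n + 1)).toNNReal 0 M.toNNReal
      L.toNNReal := by
    refine ⟨fun t _ => (hv.lipschitzWith t).lipschitzOnWith,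
      fun y _ => (hv.continuous y).continuousOn, fun t _ y _ => ?_, ?_⟩
    · rw [Real.coe_toNNReal _ hM0]
      exact hM t y
    · rw [Real.coe_toNNReal _ hM0, Real.coe_toNNReal _ (by positivity)]
      simp
  exact this.exists_eq_forall_mem_Icc_hasDerivWithinAt₀

lemma IsFlowField.exists_isIntegralCurve (hv : IsFlowField L v) (s : ℝ) (x : E) :
    ∃ γ, γ s = x ∧ IsIntegralCurve γ v := by
  choose γ hγs hγ using hv.exists_isIntegralCurveOn s x
  have hγ' : ∀ (n : ℕ) {t : ℝ}, |t - s| < n + 1 → HasDerivAt (γ n) (v t (γ n t)) t := by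
    intro n t ht
    obtain ⟨h₁, h₂⟩ := abs_lt.1 ht
    exact (hγ n t ⟨by linarith, by linarith⟩).hasDerivAt
      (Icc_mem_nhds (by linarith) (by linarith))
  have heq : ∀ {m n : ℕ}, m ≤ n → ∀ {t : ℝ}, |t - s| < m + 1 → γ m t = γ n t := by
    intro m n hmn t ht
    have hmn' : (m : ℝ) ≤ n := by exact_mod_cast hmn
    have habs : ∀ u ∈ Ioo (s - ((m : ℝ) + 1)) (s + (m + 1)), |u - s| < m + 1 := fun u hu =>
      abs_lt.2 ⟨by linarith [hu.1], by linarith [hu.2]⟩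
    obtain ⟨h₁, h₂⟩ := abs_lt.1 ht
    have : (0 : ℝ) ≤ m := m.cast_nonneg
    exact ODE_solution_unique_of_mem_Ioo (s := fun _ => univ)
      (fun u _ => (hv.lipschitzWith u).lipschitzOnWith) (t₀ := s) ⟨by linarith, by linarith⟩
      (fun u hu => ⟨hγ' m (habs u hu), mem_univ _⟩)
      (fun u hu => ⟨hγ' n ((habs u hu).trans_le (by linarith)), mem_univ _⟩)
      ((hγs m).trans (hγs n).symm) ⟨by linarith, by linarith⟩
  refine ⟨fun t => γ ⌈|t - s|⌉₊ t, hγs _, fun t => ?_⟩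
  set n := ⌈|t - s|⌉₊ + 1 with hn
  have hlocal : (fun t => γ ⌈|t - s|⌉₊ t) =ᶠ[𝓝 t] γ n := by
    filter_upwards [Metric.ball_mem_nhds t one_pos] with u hu
    refine heq (Nat.ceil_le.2 ?_) ((Nat.le_ceil _).trans_lt (lt_add_one _))
    have h₁ : |u - t| < 1 := by simpa only [Metric.mem_ball, Real.dist_eq] using hu
    rw [hn]
    push_cast
    linarith [abs_sub_le u t s, Nat.le_ceil |t - s|]
  have hval : γ ⌈|t - s|⌉₊ t = γ n t := hlocal.self_of_nhds
  beta_reduce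
  rw [hval]
  refine (hγ' n ?_).congr_of_eventuallyEq hlocal
  rw [hn]
  push_cast
  linarith [Nat.le_ceil |t - s|]

open Classical in
/-- The position at the time `t` of the integral curve of `v` that starts from `x` at the time `s`
(and the junk value `x` when there is no such curve). -/
def odeFlow (v : ℝ → E → E) (s t : ℝ) (x : E) : E :=
  if h : ∃ γ : ℝ → E, γ s = x ∧ IsIntegralCurve γ v then h.choose t else x

omit [CompleteSpace E] in
lemma odeFlow_self (v : ℝ → E → E) (s : ℝ) (x : E) : odeFlow v s s x = x := by
  unfold odeFlow
  split_ifs with h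
  exacts [h.choose_spec.1, rfl]

lemma IsFlowField.isIntegralCurve_odeFlow (hv : IsFlowField L v) (s : ℝ) (x : E) :
    IsIntegralCurve (fun t => odeFlow v s t x) v := by
  have h := hv.exists_isIntegralCurve s x
  simpa only [odeFlow, dif_pos h] using h.choose_spec.2

lemma IsFlowField.eq_odeFlow (hv : IsFlowField L v) (hL : 0 ≤ L) {γ : ℝ → E}
    (hγ : IsIntegralCurve γ v) (s t : ℝ) : γ t = odeFlow v s t (γ s) := by
  have := norm_sub_le_of_isIntegralCurve (m := 0) hv hL hγ (hv.isIntegralCurve_odeFlow s (γ s))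
    (by simp) s t
  simpa [odeFlow_self, sub_eq_zero] using this

lemma IsFlowField.odeFlow_odeFlow (hv : IsFlowField L v) (hL : 0 ≤ L) (s u t : ℝ) (x : E) :
    odeFlow v u t (odeFlow v s u x) = odeFlow v s t x :=
  (hv.eq_odeFlow hL (hv.isIntegralCurve_odeFlow s x) u t).symm

lemma IsFlowField.norm_odeFlow_sub_le {v' : ℝ → E → E} {m : ℝ} (hv : IsFlowField L v) (hL : 0 ≤ L)
    (hv' : IsFlowField L v') (hvv' : ∀ t x, ‖v t x - v' t x‖ ≤ m) (s t : ℝ) (x x' : E) :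
    ‖odeFlow v s t x - odeFlow v' s t x'‖ ≤ (‖x - x'‖ + m) * exp ((L + 1) * |t - s|) := by
  simpa only [odeFlow_self] using norm_sub_le_of_isIntegralCurve hv hL
    (hv.isIntegralCurve_odeFlow s x) (hv'.isIntegralCurve_odeFlow s x') hvv' s t

lemma continuous_odeFlow {Y : Type*} [PseudoMetricSpace Y] {v : Y → ℝ → E → E} {C : ℝ} (hL : 0 ≤ L)
    (hv : ∀ y, IsFlowField L (v y)) (hvC : ∀ y y' t x, ‖v y t x - v y' t x‖ ≤ C * dist y y') :
    Continuous fun q : ℝ × ℝ × E × Y => odeFlow (v q.2.2.2) q.1 q.2.1 q.2.2.1 := by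
  refine continuous_iff_continuousAt.2 fun ⟨s₀, t₀, x₀, y₀⟩ => ?_
  set γ : ℝ → E := fun t => odeFlow (v y₀) s₀ t x₀
  have hγ : IsIntegralCurve γ (v y₀) := (hv y₀).isIntegralCurve_odeFlow s₀ x₀
  have hγc : Continuous γ := hγ.continuous
  set modulus : ℝ × ℝ × E × Y → ℝ := fun q =>
    (‖q.2.2.1 - γ q.1‖ + C * dist q.2.2.2 y₀) * exp ((L + 1) * |q.2.1 - q.1|)
      + ‖γ q.2.1 - γ t₀‖
  have hmodulus : Tendsto modulus (𝓝 (s₀, t₀, x₀, y₀)) (𝓝 0) := by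
    have hcont : Continuous modulus := by fun_prop
    simpa [modulus, γ, odeFlow_self] using hcont.tendsto (s₀, t₀, x₀, y₀)
  rw [ContinuousAt, tendsto_iff_norm_sub_tendsto_zero]
  refine squeeze_zero (fun _ => norm_nonneg _) (fun ⟨s, t, x, y⟩ => ?_) hmodulus
  refine (norm_sub_le_norm_sub_add_norm_sub _ (γ t) _).trans (add_le_add ?_ le_rfl)
  simpa only [odeFlow_self] using norm_sub_le_of_isIntegralCurve (hv y) hL
    ((hv y).isIntegralCurve_odeFlow s x) hγ (hvC y y₀) s t

end OrdinaryDifferentialEquation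

/-! ### The flow of a mean field on the line -/

/-- The angular speed `ω + Im (z e^{-iθ})` of an oscillator of phase `θ` and frequency `ω` in a mean
field `z = (Re z, Im z)`. -/
def phaseSpeed (z : ℝ × ℝ) (ω θ : ℝ) : ℝ := ω + z.2 * cos θ - z.1 * sin θ

lemma continuous_phaseSpeed : Continuous fun q : (ℝ × ℝ) × ℝ × ℝ => phaseSpeed q.1 q.2.1 q.2.2 := by
  unfold phaseSpeed
  fun_prop

lemma abs_phaseSpeed_sub_le (z : ℝ × ℝ) (ω θ θ' : ℝ) :
    |phaseSpeed z ω θ - phaseSpeed z ω θ'| ≤ 2 * ‖z‖ * |θ - θ'| := by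
  calc |phaseSpeed z ω θ - phaseSpeed z ω θ'|
      = |z.2 * (cos θ - cos θ') - z.1 * (sin θ - sin θ')| := by unfold phaseSpeed; ring_nf
    _ ≤ |z.2| * |cos θ - cos θ'| + |z.1| * |sin θ - sin θ'| := by
      simpa only [abs_mul] using abs_sub (z.2 * (cos θ - cos θ')) (z.1 * (sin θ - sin θ'))
    _ ≤ ‖z‖ * |θ - θ'| + ‖z‖ * |θ - θ'| := by
      gcongr ?_ * ?_ + ?_ * ?_
      exacts [norm_snd_le z, abs_cos_sub_cos_le _ _, norm_fst_le z, abs_sin_sub_sin_le _ _]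
    _ = 2 * ‖z‖ * |θ - θ'| := by ring

lemma abs_phaseSpeed_sub_le' (z z' : ℝ × ℝ) (ω ω' θ : ℝ) :
    |phaseSpeed z ω θ - phaseSpeed z' ω' θ| ≤ |ω - ω'| + 2 * ‖z - z'‖ := by
  calc |phaseSpeed z ω θ - phaseSpeed z' ω' θ|
      = |(ω - ω') + ((z - z').2 * cos θ - (z - z').1 * sin θ)| := by
        simp only [phaseSpeed, Prod.fst_sub, Prod.snd_sub]; ring_nf
    _ ≤ |ω - ω'| + (|(z - z').2| * |cos θ| + |(z - z').1| * |sin θ|) := by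
      simp only [← abs_mul]
      exact (abs_add_le _ _).trans (by gcongr; exact abs_sub _ _)
    _ ≤ |ω - ω'| + (‖z - z'‖ * 1 + ‖z - z'‖ * 1) := by
      gcongr
      exacts [norm_snd_le (z - z'), abs_cos_le_one _, norm_fst_le (z - z'), abs_sin_le_one _]
    _ = |ω - ω'| + 2 * ‖z - z'‖ := by ring

/-- The mean fields of size `B`: at each time `t` and each site `x ∈ I` the field `Z t x ∈ ℝ²` (the
real and the imaginary part of the complex order parameter seen from `x`) has norm at most `B`, is
continuous in `t` and `B`-Lipschitz in `x`. -/
structure IsMeanField (B : ℝ) (Z : ℝ → unitInterval → ℝ × ℝ) : Prop where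
  continuous : ∀ x, Continuous fun t => Z t x
  norm_le : ∀ t x, ‖Z t x‖ ≤ B
  lipschitz : ∀ t x y, ‖Z t x - Z t y‖ ≤ B * |(x : ℝ) - y|

variable {B : ℝ} {Z : ℝ → unitInterval → ℝ × ℝ}

lemma IsMeanField.nonneg (hZ : IsMeanField B Z) : 0 ≤ B :=
  (norm_nonneg _).trans (hZ.norm_le 0 0)

lemma IsMeanField.continuous_uncurry (hZ : IsMeanField B Z) :
    Continuous fun q : ℝ × unitInterval => Z q.1 q.2 :=
  continuous_prod_of_continuous_lipschitzWith' _ B.toNNReal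
    (fun t => LipschitzWith.of_dist_le' fun x y => by
      simpa only [dist_eq_norm, Subtype.dist_eq, Real.norm_eq_abs] using hZ.lipschitz t x y)
    hZ.continuous

lemma IsMeanField.isFlowField (hZ : IsMeanField B Z) (y : ℝ × unitInterval) :
    IsFlowField (2 * B) fun t θ => phaseSpeed (Z t y.2) y.1 θ where
  continuous θ := continuous_phaseSpeed.comp
    ((hZ.continuous y.2).prodMk (g := fun _ => (y.1, θ)) continuous_const)
  norm_sub_le t θ θ' := (abs_phaseSpeed_sub_le _ _ _ _).trans
    (mul_le_mul_of_nonneg_right (by linarith [hZ.norm_le t y.2]) (abs_nonneg _))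
  bounded := by
    refine ⟨|y.1| + 2 * B, fun t θ => ?_⟩
    have := abs_phaseSpeed_sub_le' (Z t y.2) 0 y.1 0 θ
    have hB := hZ.norm_le t y.2
    simp only [phaseSpeed, Prod.fst_zero, Prod.snd_zero, zero_mul, sub_zero, add_zero] at this
    rw [Real.norm_eq_abs]
    exact this.trans (by gcongr)

/-- The phase at the time `t` of an oscillator of frequency and site `y = (ω, x)` that has the phase
`θ` at the time `s` and moves in the mean field `Z`, lifted to the line. -/
def phaseFlow (Z : ℝ → unitInterval → ℝ × ℝ) (s t θ : ℝ) (y : ℝ × unitInterval) : ℝ :=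
  odeFlow (fun t θ => phaseSpeed (Z t y.2) y.1 θ) s t θ

@[simp] lemma phaseFlow_self (Z : ℝ → unitInterval → ℝ × ℝ) (s θ : ℝ) (y : ℝ × unitInterval) :
    phaseFlow Z s s θ y = θ :=
  odeFlow_self _ _ _

section PhaseFlow

variable (hZ : IsMeanField B Z)
include hZ

lemma isIntegralCurve_phaseFlow (s θ : ℝ) (y : ℝ × unitInterval) :
    IsIntegralCurve (fun t => phaseFlow Z s t θ y) fun t θ => phaseSpeed (Z t y.2) y.1 θ :=
  (hZ.isFlowField y).isIntegralCurve_odeFlow s θ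

lemma eq_phaseFlow {y : ℝ × unitInterval} {γ : ℝ → ℝ}
    (hγ : IsIntegralCurve γ fun t θ => phaseSpeed (Z t y.2) y.1 θ) (s t : ℝ) :
    γ t = phaseFlow Z s t (γ s) y :=
  (hZ.isFlowField y).eq_odeFlow (mul_nonneg zero_le_two hZ.nonneg) hγ s t

lemma phaseFlow_phaseFlow (s u t θ : ℝ) (y : ℝ × unitInterval) :
    phaseFlow Z u t (phaseFlow Z s u θ y) y = phaseFlow Z s t θ y :=
  (hZ.isFlowField y).odeFlow_odeFlow (mul_nonneg zero_le_two hZ.nonneg) s u t θ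

lemma abs_phaseSpeed_meanField_sub_le (t θ : ℝ) (y y' : ℝ × unitInterval) :
    |phaseSpeed (Z t y.2) y.1 θ - phaseSpeed (Z t y'.2) y'.1 θ| ≤
      |y.1 - y'.1| + 2 * (B * |(y.2 : ℝ) - y'.2|) :=
  (abs_phaseSpeed_sub_le' _ _ _ _ _).trans (by gcongr; exact hZ.lipschitz t y.2 y'.2)

lemma abs_phaseFlow_sub_le (s t θ θ' : ℝ) (y y' : ℝ × unitInterval) :
    |phaseFlow Z s t θ y - phaseFlow Z s t θ' y'| ≤
      (|θ - θ'| + (|y.1 - y'.1| + 2 * (B * |(y.2 : ℝ) - y'.2|))) * exp ((2 * B + 1) * |t - s|) :=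
  (hZ.isFlowField y).norm_odeFlow_sub_le (mul_nonneg zero_le_two hZ.nonneg) (hZ.isFlowField y')
    (fun t θ => abs_phaseSpeed_meanField_sub_le hZ t θ y y') s t θ θ'

lemma continuous_phaseFlow : Continuous fun q : ℝ × ℝ × ℝ × ℝ × unitInterval =>
    phaseFlow Z q.1 q.2.1 q.2.2.1 q.2.2.2 := by
  refine continuous_odeFlow (v := fun (y : ℝ × unitInterval) t θ => phaseSpeed (Z t y.2) y.1 θ)
    (C := 1 + 2 * B) (mul_nonneg zero_le_two hZ.nonneg) hZ.isFlowField fun y y' t θ => ?_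
  have := hZ.nonneg
  have hω : |y.1 - y'.1| ≤ dist y y' := le_max_left _ _
  have hx : |(y.2 : ℝ) - y'.2| ≤ dist y y' := le_max_right _ _
  calc ‖phaseSpeed (Z t y.2) y.1 θ - phaseSpeed (Z t y'.2) y'.1 θ‖
      ≤ |y.1 - y'.1| + 2 * (B * |(y.2 : ℝ) - y'.2|) := abs_phaseSpeed_meanField_sub_le hZ t θ y y'
    _ ≤ dist y y' + 2 * (B * dist y y') := by gcongr
    _ = (1 + 2 * B) * dist y y' := by ring

lemma phaseFlow_add_two_pi (s t θ : ℝ) (y : ℝ × unitInterval) :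
    phaseFlow Z s t (θ + 2 * π) y = phaseFlow Z s t θ y + 2 * π := by
  have h : IsIntegralCurve (fun t => phaseFlow Z s t θ y + 2 * π)
      fun t θ => phaseSpeed (Z t y.2) y.1 θ := fun t =>
    ((isIntegralCurve_phaseFlow hZ s θ y t).add_const (2 * π)).congr_deriv (by simp [phaseSpeed])
  simpa only [phaseFlow_self] using (eq_phaseFlow hZ h s t).symm

end PhaseFlow

/-- The difference quotient in the phase of the speed; the sum-to-product formulas and `sinc` extend
it to the diagonal. -/
def speedSlope (z : ℝ × ℝ) (a b : ℝ) : ℝ :=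
  (-z.2 * sin ((a + b) / 2) - z.1 * cos ((a + b) / 2)) * sinc ((a - b) / 2)

lemma phaseSpeed_sub (z : ℝ × ℝ) (ω a b : ℝ) :
    phaseSpeed z ω a - phaseSpeed z ω b = speedSlope z a b * (a - b) := by
  have hsinc : sinc ((a - b) / 2) * (a - b) = 2 * sin ((a - b) / 2) := by
    rcases eq_or_ne a b with rfl | h
    · simp
    · have : a - b ≠ 0 := sub_ne_zero.2 h
      rw [sinc_of_ne_zero (by positivity)]
      field_simp
  have hsub : phaseSpeed z ω a - phaseSpeed z ω b
      = z.2 * (cos a - cos b) - z.1 * (sin a - sin b) := by unfold phaseSpeed; ring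
  rw [hsub, cos_sub_cos, sin_sub_sin, speedSlope]
  linear_combination (z.2 * sin ((a + b) / 2) + z.1 * cos ((a + b) / 2)) * hsinc

lemma continuous_speedSlope :
    Continuous fun q : (ℝ × ℝ) × ℝ × ℝ => speedSlope q.1 q.2.1 q.2.2 := by
  unfold speedSlope
  have := continuous_sinc
  fun_prop

lemma speedSlope_add_two_pi (z : ℝ × ℝ) (a b : ℝ) :
    speedSlope z (a + 2 * π) (b + 2 * π) = speedSlope z a b := by
  have hmid : (a + 2 * π + (b + 2 * π)) / 2 = (a + b) / 2 + 2 * π := by ring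
  have hdiff : (a + 2 * π - (b + 2 * π)) / 2 = (a - b) / 2 := by ring
  rw [speedSlope, hmid, hdiff, sin_add_two_pi, cos_add_two_pi, speedSlope]

/-- The difference quotient in the phase of the flow. -/
def flowSlope (Z : ℝ → unitInterval → ℝ × ℝ) (s t θ₁ θ₂ : ℝ) (y : ℝ × unitInterval) : ℝ :=
  exp (∫ τ in s..t, speedSlope (Z τ y.2) (phaseFlow Z s τ θ₁ y) (phaseFlow Z s τ θ₂ y))

/-- The derivative of the flow with respect to the phase. -/
def phaseJac (Z : ℝ → unitInterval → ℝ × ℝ) (s t θ : ℝ) (y : ℝ × unitInterval) : ℝ :=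
  flowSlope Z s t θ θ y

lemma phaseJac_pos (Z : ℝ → unitInterval → ℝ × ℝ) (s t θ : ℝ) (y : ℝ × unitInterval) :
    0 < phaseJac Z s t θ y := exp_pos _

lemma phaseJac_self (Z : ℝ → unitInterval → ℝ × ℝ) (s θ : ℝ) (y : ℝ × unitInterval) :
    phaseJac Z s s θ y = 1 := by
  simp [phaseJac, flowSlope]

lemma hasDerivAt_mul_of_eq_zero {f E : ℝ → ℝ} {f' a : ℝ} (hf : HasDerivAt f f' a) (hfa : f a = 0)
    (hE : ContinuousAt E a) : HasDerivAt (fun x => f x * E x) (f' * E a) a := by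
  rw [hasDerivAt_iff_tendsto_slope] at hf ⊢
  refine (hf.mul (hE.tendsto.mono_left nhdsWithin_le_nhds)).congr fun x => ?_
  simp only [slope_def_field, hfa]
  ring

section FlowSlope

variable (hZ : IsMeanField B Z)
include hZ

lemma continuous_speedSlope_phaseFlow :
    Continuous fun q : (ℝ × ℝ × ℝ × ℝ × unitInterval) × ℝ => speedSlope (Z q.2 q.1.2.2.2.2)
      (phaseFlow Z q.1.1 q.2 q.1.2.1 q.1.2.2.2) (phaseFlow Z q.1.1 q.2 q.1.2.2.1 q.1.2.2.2) := by
  have hfield : Continuous fun q : (ℝ × ℝ × ℝ × ℝ × unitInterval) × ℝ => Z q.2 q.1.2.2.2.2 :=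
    hZ.continuous_uncurry.comp (f := fun q : (ℝ × ℝ × ℝ × ℝ × unitInterval) × ℝ =>
      (q.2, q.1.2.2.2.2)) (by fun_prop)
  have hθ : Continuous fun q : (ℝ × ℝ × ℝ × ℝ × unitInterval) × ℝ =>
      phaseFlow Z q.1.1 q.2 q.1.2.1 q.1.2.2.2 :=
    (continuous_phaseFlow hZ).comp (f := fun q : (ℝ × ℝ × ℝ × ℝ × unitInterval) × ℝ =>
      (q.1.1, q.2, q.1.2.1, q.1.2.2.2)) (by fun_prop)
  have hθ' : Continuous fun q : (ℝ × ℝ × ℝ × ℝ × unitInterval) × ℝ =>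
      phaseFlow Z q.1.1 q.2 q.1.2.2.1 q.1.2.2.2 :=
    (continuous_phaseFlow hZ).comp (f := fun q : (ℝ × ℝ × ℝ × ℝ × unitInterval) × ℝ =>
      (q.1.1, q.2, q.1.2.2.1, q.1.2.2.2)) (by fun_prop)
  exact continuous_speedSlope.comp (hfield.prodMk (hθ.prodMk hθ'))

lemma continuous_flowSlope : Continuous fun q : ℝ × ℝ × ℝ × ℝ × ℝ × unitInterval =>
    flowSlope Z q.1 q.2.1 q.2.2.1 q.2.2.2.1 q.2.2.2.2 := by
  set f : ℝ × ℝ × ℝ × ℝ × ℝ × unitInterval → ℝ → ℝ := fun q τ => speedSlope (Z τ q.2.2.2.2.2)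
    (phaseFlow Z q.1 τ q.2.2.1 q.2.2.2.2) (phaseFlow Z q.1 τ q.2.2.2.1 q.2.2.2.2)
  have hf : Continuous f.uncurry := (continuous_speedSlope_phaseFlow hZ).comp
    (f := fun q : (ℝ × ℝ × ℝ × ℝ × ℝ × unitInterval) × ℝ => ((q.1.1, q.1.2.2), q.2))
    (by fun_prop)
  have hto : Continuous fun q : ℝ × ℝ × ℝ × ℝ × ℝ × unitInterval => ∫ τ in (0 : ℝ)..q.2.1, f q τ :=
    intervalIntegral.continuous_parametric_intervalIntegral_of_continuous hf (by fun_prop)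
  have hfrom : Continuous fun q : ℝ × ℝ × ℝ × ℝ × ℝ × unitInterval => ∫ τ in (0 : ℝ)..q.1, f q τ :=
    intervalIntegral.continuous_parametric_intervalIntegral_of_continuous hf (by fun_prop)
  have hint : ∀ q a b, IntervalIntegrable (f q) volume a b := fun q a b =>
    (hf.comp (Continuous.prodMk_right q)).intervalIntegrable a b
  exact continuous_exp.comp ((hto.sub hfrom).congr fun q =>
    intervalIntegral.integral_interval_sub_left (hint q _ _) (hint q _ _))

lemma phaseFlow_sub (s t θ θ' : ℝ) (y : ℝ × unitInterval) :
    phaseFlow Z s t θ y - phaseFlow Z s t θ' y = (θ - θ') * flowSlope Z s t θ θ' y := by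
  set q : ℝ → ℝ := fun τ => speedSlope (Z τ y.2) (phaseFlow Z s τ θ y) (phaseFlow Z s τ θ' y)
  have hq : Continuous q := (continuous_speedSlope_phaseFlow hZ).comp
    (f := fun τ : ℝ => ((s, θ, θ', y), τ)) (by fun_prop)
  -- The difference solves the linear equation `D' = q D`.
  have hderiv : ∀ t, HasDerivAt (fun t => (phaseFlow Z s t θ y - phaseFlow Z s t θ' y)
      * exp (-∫ τ in s..t, q τ)) 0 t := fun t => by
    have hD := (isIntegralCurve_phaseFlow hZ s θ y t).sub (isIntegralCurve_phaseFlow hZ s θ' y t)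
    refine (hD.mul (hq.integral_hasStrictDerivAt s t).hasDerivAt.neg.exp).congr_deriv ?_
    simp only [Pi.sub_apply, phaseSpeed_sub]
    ring
  have hconst := is_const_of_deriv_eq_zero (fun t => (hderiv t).differentiableAt)
    (fun t => (hderiv t).deriv) t s
  simp only [intervalIntegral.integral_same, neg_zero, exp_zero, mul_one, phaseFlow_self] at hconst
  rwa [exp_neg, ← div_eq_mul_inv, div_eq_iff (exp_pos _).ne'] at hconst

lemma hasDerivAt_phaseFlow (s t θ : ℝ) (y : ℝ × unitInterval) :
    HasDerivAt (fun θ => phaseFlow Z s t θ y) (phaseJac Z s t θ y) θ := by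
  have hslope : Continuous fun θ' => flowSlope Z s t θ' θ y := (continuous_flowSlope hZ).comp
    (f := fun θ' : ℝ => (s, t, θ', θ, y)) (by fun_prop)
  have := (hasDerivAt_mul_of_eq_zero ((hasDerivAt_id θ).sub_const θ) (sub_self θ)
    hslope.continuousAt).const_add (phaseFlow Z s t θ y)
  simp only [one_mul, id, ← phaseFlow_sub hZ, add_sub_cancel] at this
  exact this

lemma hasDerivAt_phaseFlow_initial (s t θ : ℝ) (y : ℝ × unitInterval) :
    HasDerivAt (fun s => phaseFlow Z s t θ y)
      (-phaseSpeed (Z s y.2) y.1 θ * phaseJac Z s t θ y) s := by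
  -- Compare with the curve `γ` through `(s, θ)`, whose own flow does not depend on `s`.
  set γ : ℝ → ℝ := fun τ => phaseFlow Z s τ θ y
  have hγ : HasDerivAt γ (phaseSpeed (Z s y.2) y.1 θ) s := by
    simpa only [phaseFlow_self] using isIntegralCurve_phaseFlow hZ s θ y s
  have hslope : Continuous fun s' => flowSlope Z s' t θ (γ s') y := by
    have : Continuous γ := (isIntegralCurve_phaseFlow hZ s θ y).continuous
    exact (continuous_flowSlope hZ).comp (f := fun s' : ℝ => (s', t, θ, γ s', y)) (by fun_prop)
  have := (hasDerivAt_mul_of_eq_zero (hγ.const_sub θ) (by simp [γ])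
    hslope.continuousAt).const_add (γ t)
  simpa only [← phaseFlow_sub hZ, γ, phaseFlow_phaseFlow hZ, add_sub_cancel, phaseFlow_self,
    phaseJac] using this

lemma continuous_phaseJac : Continuous fun q : ℝ × ℝ × ℝ × ℝ × unitInterval =>
    phaseJac Z q.1 q.2.1 q.2.2.1 q.2.2.2 :=
  (continuous_flowSlope hZ).comp (f := fun q : ℝ × ℝ × ℝ × ℝ × unitInterval =>
    (q.1, q.2.1, q.2.2.1, q.2.2.1, q.2.2.2)) (by fun_prop)

lemma phaseJac_add_two_pi (s t θ : ℝ) (y : ℝ × unitInterval) :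
    phaseJac Z s t (θ + 2 * π) y = phaseJac Z s t θ y := by
  simp only [phaseJac, flowSlope, phaseFlow_add_two_pi hZ, speedSlope_add_two_pi]

end FlowSlope

/-! ### The flow of a mean field on the phase space -/

/-- A representative in `ℝ` of a point of the circle. -/
def circRep (θ : Circ) : ℝ := Quotient.out θ

@[simp] lemma coe_circRep (θ : Circ) : ((circRep θ : ℝ) : Circ) = θ := Quotient.out_eq θ

lemma apply_circRep_of_periodic {β : Type*} {f : ℝ → β} (hf : Function.Periodic f (2 * π)) (a : ℝ) :
    f (circRep (a : Circ)) = f a := by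
  rw [← hf.lift_coe, coe_circRep, hf.lift_coe]

lemma exists_coe_eq_abs_sub_eq_dist (a : ℝ) (θ : Circ) :
    ∃ b : ℝ, (b : Circ) = θ ∧ |a - b| = dist (a : Circ) θ := by
  set c := circRep θ
  refine ⟨c + round ((2 * π)⁻¹ * (a - c)) * (2 * π), ?_, ?_⟩
  · rw [← zsmul_eq_mul, AddCircle.coe_add, AddCircle.coe_zsmul, AddCircle.coe_period, smul_zero,
      add_zero, coe_circRep]
  · rw [dist_eq_norm, ← coe_circRep θ, ← AddCircle.coe_sub, AddCircle.norm_eq, sub_add_eq_sub_sub]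

lemma dist_coe_circ_le (a b : ℝ) : dist (a : Circ) (b : Circ) ≤ |a - b| := by
  rw [dist_eq_norm, ← AddCircle.coe_sub]
  exact QuotientAddGroup.norm_mk_le_norm

lemma continuous_of_continuous_lift {X Y : Type*} [TopologicalSpace X] [TopologicalSpace Y]
    {f : X × PhaseSpace → Y}
    (h : Continuous fun q : X × ℝ × ℝ × unitInterval => f (q.1, ((q.2.1 : Circ), q.2.2))) :
    Continuous f :=
  (IsOpenQuotientMap.id.prodMap ((QuotientAddGroup.isOpenQuotientMap_mk
    (N := AddSubgroup.zmultiples (2 * π))).prodMap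
      IsOpenQuotientMap.id)).isQuotientMap.continuous_iff.2 h

/-- The flow of the mean field `Z` from the time `s` to the time `t` on the phase space. -/
def flowMap (Z : ℝ → unitInterval → ℝ × ℝ) (s t : ℝ) (P : PhaseSpace) : PhaseSpace :=
  ((phaseFlow Z s t (circRep P.1) P.2 : ℝ), P.2)

/-- The Jacobian of `flowMap Z s t`. -/
def flowJac (Z : ℝ → unitInterval → ℝ × ℝ) (s t : ℝ) (P : PhaseSpace) : ℝ :=
  phaseJac Z s t (circRep P.1) P.2

/-- The density at the time `t` of a mass that has the density `r` at the time `0` and is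
transported by the mean field `Z`. -/
def flowDensity (Z : ℝ → unitInterval → ℝ × ℝ) (r : PhaseSpace → ℝ) (t : ℝ) (P : PhaseSpace) : ℝ :=
  r (flowMap Z t 0 P) * flowJac Z t 0 P

lemma flowJac_nonneg (Z : ℝ → unitInterval → ℝ × ℝ) (s t : ℝ) (P : PhaseSpace) :
    0 ≤ flowJac Z s t P :=
  (phaseJac_pos _ _ _ _ _).le

lemma flowDensity_nonneg (Z : ℝ → unitInterval → ℝ × ℝ) {r : PhaseSpace → ℝ} (hr : ∀ P, 0 ≤ r P)
    (t : ℝ) (P : PhaseSpace) : 0 ≤ flowDensity Z r t P :=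
  mul_nonneg (hr _) (flowJac_nonneg _ _ _ _)

@[simp] lemma flowMap_self (Z : ℝ → unitInterval → ℝ × ℝ) (s : ℝ) (P : PhaseSpace) :
    flowMap Z s s P = P := by
  simp [flowMap]

@[simp] lemma flowDensity_zero (Z : ℝ → unitInterval → ℝ × ℝ) (r : PhaseSpace → ℝ) :
    flowDensity Z r 0 = r := by
  funext P
  simp [flowDensity, flowJac, phaseJac_self]

section FlowMap

variable (hZ : IsMeanField B Z)
include hZ

lemma flowMap_coe (s t θ : ℝ) (y : ℝ × unitInterval) :
    flowMap Z s t ((θ : Circ), y) = (((phaseFlow Z s t θ y : ℝ) : Circ), y) := by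
  have hperiodic : Function.Periodic (fun θ => ((phaseFlow Z s t θ y : ℝ) : Circ)) (2 * π) :=
    fun θ => by simp only [phaseFlow_add_two_pi hZ, AddCircle.coe_add_period]
  exact Prod.ext (apply_circRep_of_periodic hperiodic θ) rfl

lemma flowJac_coe (s t θ : ℝ) (y : ℝ × unitInterval) :
    flowJac Z s t ((θ : Circ), y) = phaseJac Z s t θ y :=
  apply_circRep_of_periodic (f := fun θ => phaseJac Z s t θ y)
    (fun θ => phaseJac_add_two_pi hZ s t θ y) θ

lemma flowMap_flowMap (s u t : ℝ) (P : PhaseSpace) :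
    flowMap Z u t (flowMap Z s u P) = flowMap Z s t P := by
  rw [flowMap.eq_1 Z s u, flowMap_coe hZ, phaseFlow_phaseFlow hZ, flowMap]

lemma continuous_flowMap_uncurry :
    Continuous fun q : (ℝ × ℝ) × PhaseSpace => flowMap Z q.1.1 q.1.2 q.2 := by
  apply continuous_of_continuous_lift
  simp only [flowMap_coe hZ]
  have : Continuous fun q : (ℝ × ℝ) × ℝ × ℝ × unitInterval =>
      phaseFlow Z q.1.1 q.1.2 q.2.1 q.2.2 :=
    (continuous_phaseFlow hZ).comp (f := fun q : (ℝ × ℝ) × ℝ × ℝ × unitInterval =>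
      (q.1.1, q.1.2, q.2.1, q.2.2)) (by fun_prop)
  exact ((AddCircle.continuous_mk' (2 * π)).comp this).prodMk (by fun_prop)

lemma continuous_flowJac_uncurry :
    Continuous fun q : (ℝ × ℝ) × PhaseSpace => flowJac Z q.1.1 q.1.2 q.2 := by
  apply continuous_of_continuous_lift
  simp only [flowJac_coe hZ]
  exact (continuous_phaseJac hZ).comp (f := fun q : (ℝ × ℝ) × ℝ × ℝ × unitInterval =>
    (q.1.1, q.1.2, q.2.1, q.2.2)) (by fun_prop)

lemma continuous_flowMap (s t : ℝ) : Continuous (flowMap Z s t) :=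
  (continuous_flowMap_uncurry hZ).comp (Continuous.prodMk_right (s, t))

lemma continuous_flowJac (s t : ℝ) : Continuous (flowJac Z s t) :=
  (continuous_flowJac_uncurry hZ).comp (Continuous.prodMk_right (s, t))

lemma measurable_flowDensity_uncurry {r : PhaseSpace → ℝ} (hr : Measurable r) :
    Measurable fun q : ℝ × PhaseSpace => flowDensity Z r q.1 q.2 := by
  have hpair : Continuous fun q : ℝ × PhaseSpace => (((q.1, 0), q.2) : (ℝ × ℝ) × PhaseSpace) := by
    fun_prop
  exact (hr.comp ((continuous_flowMap_uncurry hZ).comp hpair).measurable).mul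
    ((continuous_flowJac_uncurry hZ).comp hpair).measurable

lemma measurable_flowDensity {r : PhaseSpace → ℝ} (hr : Measurable r) (t : ℝ) :
    Measurable (flowDensity Z r t) :=
  (measurable_flowDensity_uncurry hZ hr).comp measurable_prodMk_left

lemma image_phaseFlow_Ioc (s t : ℝ) (y : ℝ × unitInterval) (a b : ℝ) :
    (fun θ => phaseFlow Z s t θ y) '' Ioc a b =
      Ioc (phaseFlow Z s t a y) (phaseFlow Z s t b y) := by
  have hmono : StrictMono fun θ => phaseFlow Z s t θ y :=
    strictMono_of_hasDerivAt_pos (hasDerivAt_phaseFlow hZ s t · y) fun θ => phaseJac_pos Z s t θ y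
  have hsurj : Function.Surjective fun θ => phaseFlow Z s t θ y := fun θ =>
    ⟨phaseFlow Z t s θ y, by simp only [phaseFlow_phaseFlow hZ, phaseFlow_self]⟩
  exact (hmono.orderIsoOfSurjective _ hsurj).image_Ioc a b

lemma lintegral_comp_flowMap_mul_flowJac_circle (s t : ℝ) (y : ℝ × unitInterval)
    (F : PhaseSpace → ℝ≥0∞) :
    ∫⁻ θ : Circ, F (flowMap Z s t (θ, y)) * ENNReal.ofReal (flowJac Z s t (θ, y))
      = ∫⁻ θ : Circ, F (θ, y) := by
  have hinj : InjOn (fun θ => phaseFlow Z s t θ y) (Ioc 0 (0 + 2 * π)) := by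
    refine (Function.LeftInverse.injective (g := fun θ => phaseFlow Z t s θ y) fun θ => ?_).injOn
    simp only [phaseFlow_phaseFlow hZ, phaseFlow_self]
  rw [← AddCircle.lintegral_preimage (2 * π) 0,
    ← AddCircle.lintegral_preimage (2 * π) (phaseFlow Z s t 0 y),
    ← phaseFlow_add_two_pi hZ, ← image_phaseFlow_Ioc hZ,
    lintegral_image_eq_lintegral_abs_deriv_mul measurableSet_Ioc
      (fun θ _ => (hasDerivAt_phaseFlow hZ s t θ y).hasDerivWithinAt) hinj]
  refine setLIntegral_congr_fun measurableSet_Ioc fun θ _ => ?_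
  simp only [flowMap_coe hZ, flowJac_coe hZ, abs_of_pos (phaseJac_pos Z s t θ y), mul_comm]

lemma lintegral_comp_flowMap_mul_flowJac (s t : ℝ) {F : PhaseSpace → ℝ≥0∞} (hF : Measurable F) :
    ∫⁻ P, F (flowMap Z s t P) * ENNReal.ofReal (flowJac Z s t P) = ∫⁻ P, F P := by
  have hmeas : Measurable fun P => F (flowMap Z s t P) * ENNReal.ofReal (flowJac Z s t P) :=
    (hF.comp (continuous_flowMap hZ s t).measurable).mul
      (continuous_flowJac hZ s t).measurable.ennreal_ofReal
  rw [Measure.volume_eq_prod, lintegral_prod_symm _ hmeas.aemeasurable,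
    lintegral_prod_symm _ hF.aemeasurable]
  simp only [lintegral_comp_flowMap_mul_flowJac_circle hZ]

lemma densityMeasure_flowDensity {r : PhaseSpace → ℝ} (hr : Measurable r) (hr0 : ∀ P, 0 ≤ r P)
    (t : ℝ) : densityMeasure (flowDensity Z r t) = (densityMeasure r).map (flowMap Z 0 t) := by
  ext A hA
  have hflow := (continuous_flowMap hZ 0 t).measurable
  rw [Measure.map_apply hflow hA, densityMeasure, densityMeasure, withDensity_apply _ hA,
    withDensity_apply _ (hflow hA), ← lintegral_indicator hA, ← lintegral_indicator (hflow hA),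
    ← lintegral_comp_flowMap_mul_flowJac hZ t 0 (hr.ennreal_ofReal.indicator (hflow hA))]
  refine lintegral_congr fun P => ?_
  by_cases hP : P ∈ A <;>
    simp [hP, flowMap_flowMap hZ, flowDensity, ENNReal.ofReal_mul (hr0 _)]

end FlowMap

lemma integral_densityMeasure {ρ : PhaseSpace → ℝ} (hρ : Measurable ρ) (hρ0 : ∀ P, 0 ≤ ρ P)
    (f : PhaseSpace → ℝ) : ∫ P, f P ∂(densityMeasure ρ) = ∫ P, ρ P * f P := by
  rw [densityMeasure, integral_withDensity_eq_integral_toReal_smul hρ.ennreal_ofReal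
    (Eventually.of_forall fun _ => ENNReal.ofReal_lt_top)]
  simp only [ENNReal.toReal_ofReal (hρ0 _), smul_eq_mul]

lemma integrable_of_isFiniteMeasure_densityMeasure {ρ : PhaseSpace → ℝ} (hρ : Measurable ρ)
    (hρ0 : ∀ P, 0 ≤ ρ P) [IsFiniteMeasure (densityMeasure ρ)] : Integrable ρ := by
  refine ⟨hρ.aestronglyMeasurable, ?_⟩
  rw [hasFiniteIntegral_iff_ofReal (Eventually.of_forall hρ0), ← setLIntegral_univ,
    ← withDensity_apply _ MeasurableSet.univ]
  exact measure_lt_top (densityMeasure ρ) univ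

/-! ### Bounded Lipschitz observables -/

/-- The cosine of a point of the circle. -/
def circCos (θ : Circ) : ℝ := Real.cos_periodic.lift θ

@[simp] lemma circSin_coe (θ : ℝ) : circSin (θ : Circ) = sin θ := Real.sin_periodic.lift_coe θ

@[simp] lemma circCos_coe (θ : ℝ) : circCos (θ : Circ) = cos θ := Real.cos_periodic.lift_coe θ

lemma abs_circSin_le_one (θ : Circ) : |circSin θ| ≤ 1 := by
  rw [← coe_circRep θ, circSin_coe]
  exact abs_sin_le_one _

lemma abs_circCos_le_one (θ : Circ) : |circCos θ| ≤ 1 := by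
  rw [← coe_circRep θ, circCos_coe]
  exact abs_cos_le_one _

lemma abs_circSin_sub_le (θ θ' : Circ) : |circSin θ - circSin θ'| ≤ dist θ θ' := by
  obtain ⟨b, rfl, h⟩ := exists_coe_eq_abs_sub_eq_dist (circRep θ) θ'
  rw [← coe_circRep θ, ← h, circSin_coe, circSin_coe]
  exact abs_sin_sub_sin_le _ _

lemma abs_circCos_sub_le (θ θ' : Circ) : |circCos θ - circCos θ'| ≤ dist θ θ' := by
  obtain ⟨b, rfl, h⟩ := exists_coe_eq_abs_sub_eq_dist (circRep θ) θ'
  rw [← coe_circRep θ, ← h, circCos_coe, circCos_coe]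
  exact abs_cos_sub_cos_le _ _

lemma circSin_sub (θ θ' : Circ) :
    circSin (θ - θ') = circSin θ * circCos θ' - circCos θ * circSin θ' := by
  rw [← coe_circRep θ, ← coe_circRep θ', ← AddCircle.coe_sub]
  simp only [circSin_coe, circCos_coe, sin_sub]

lemma dist_fst_le (P Q : PhaseSpace) : dist P.1 Q.1 ≤ dist P Q := le_max_left _ _

lemma abs_frequency_sub_le (P Q : PhaseSpace) : |P.2.1 - Q.2.1| ≤ dist P Q :=
  (le_max_left _ _).trans (le_max_right _ _)

lemma abs_site_sub_le (P Q : PhaseSpace) : |(P.2.2 : ℝ) - Q.2.2| ≤ dist P Q :=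
  (le_max_right _ _).trans (le_max_right _ _)

lemma dist_le_dG (P Q : PhaseSpace) : dist P Q ≤ dG P Q := by
  have h₁ := sq_nonneg (dist P.1 Q.1)
  have h₂ := sq_nonneg (P.2.1 - Q.2.1)
  have h₃ := sq_nonneg ((P.2.2 : ℝ) - Q.2.2)
  refine max_le (le_sqrt_of_sq_le (by linarith)) (max_le ?_ ?_) <;>
    exact abs_le_sqrt (by linarith)

lemma dG_le_two_mul_dist (P Q : PhaseSpace) : dG P Q ≤ 2 * dist P Q := by
  rw [dG, sqrt_le_left (by positivity)]
  have h₁ := pow_le_pow_left₀ dist_nonneg (dist_fst_le P Q) 2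
  have h₂ := sq_le_sq.2 ((abs_frequency_sub_le P Q).trans (le_abs_self _))
  have h₃ := sq_le_sq.2 ((abs_site_sub_le P Q).trans (le_abs_self _))
  linarith [sq_nonneg (dist P Q)]

/-- The observables of size `a`: bounded by `a`, and `a`-Lipschitz for the sup distance of the
product `𝕊 × ℝ × I`. -/
structure IsObservable (a : ℝ) (f : PhaseSpace → ℝ) : Prop where
  abs_le : ∀ P, |f P| ≤ a
  lipschitz : ∀ P Q, |f P - f Q| ≤ a * dist P Q

namespace IsObservable

variable {a : ℝ} {f : PhaseSpace → ℝ}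

lemma nonneg (hf : IsObservable a f) : 0 ≤ a := (abs_nonneg _).trans (hf.abs_le (0, 0, 0))

lemma continuous (hf : IsObservable a f) : Continuous f :=
  (LipschitzWith.of_dist_le' hf.lipschitz).continuous

lemma integrable (hf : IsObservable a f) (μ : Measure PhaseSpace) [IsFiniteMeasure μ] :
    Integrable f μ :=
  .of_bound hf.continuous.aestronglyMeasurable a (Eventually.of_forall hf.abs_le)

lemma of_mem_lipClass (hf : f ∈ lipClass) : IsObservable 2 f :=
  ⟨fun P => _root_.abs_le.2 ⟨by linarith [(hf.1 P).1], by linarith [(hf.1 P).2]⟩,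
    fun P Q => (hf.2 P Q).trans (dG_le_two_mul_dist P Q)⟩

end IsObservable

lemma abs_integral_le_of_abs_le {X : Type*} [MeasurableSpace X] {μ : Measure X}
    [IsProbabilityMeasure μ] {f : X → ℝ} {a : ℝ} (ha : ∀ P, |f P| ≤ a) : |∫ P, f P ∂μ| ≤ a := by
  simpa using norm_integral_le_of_norm_le_const (μ := μ) (f := f) (C := a) (Eventually.of_forall ha)

lemma abs_integral_sub_le_dBL {μ ν : Measure PhaseSpace} [IsProbabilityMeasure μ]
    [IsProbabilityMeasure ν] {f : PhaseSpace → ℝ} (hf : f ∈ lipClass) :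
    |∫ P, f P ∂μ - ∫ P, f P ∂ν| ≤ dBL μ ν := by
  refine le_csSup ⟨2 + 2, ?_⟩ ⟨f, hf, rfl⟩
  rintro _ ⟨f, hf, rfl⟩
  have hb := (IsObservable.of_mem_lipClass hf).abs_le
  exact (abs_sub _ _).trans (add_le_add (abs_integral_le_of_abs_le hb)
    (abs_integral_le_of_abs_le hb))

lemma dBL_nonneg (μ ν : Measure PhaseSpace) : 0 ≤ dBL μ ν := by
  refine Real.sSup_nonneg ?_
  rintro _ ⟨f, -, rfl⟩
  exact abs_nonneg _

lemma dBL_le {μ ν : Measure PhaseSpace} {C : ℝ} (hC : 0 ≤ C)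
    (h : ∀ f ∈ lipClass, |∫ P, f P ∂μ - ∫ P, f P ∂ν| ≤ C) : dBL μ ν ≤ C := by
  refine Real.sSup_le ?_ hC
  rintro _ ⟨f, hf, rfl⟩
  exact h f hf

lemma dBL_self (μ : Measure PhaseSpace) : dBL μ μ = 0 :=
  le_antisymm (dBL_le le_rfl fun f _ => by simp) (dBL_nonneg _ _)

lemma IsObservable.abs_integral_sub_le {μ ν : Measure PhaseSpace} [IsProbabilityMeasure μ]
    [IsProbabilityMeasure ν] {f : PhaseSpace → ℝ} {a : ℝ} (hf : IsObservable a f) :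
    |∫ P, f P ∂μ - ∫ P, f P ∂ν| ≤ 2 * a * dBL μ ν := by
  rcases hf.nonneg.eq_or_lt with rfl | ha
  · have hf0 : ∀ P, f P = 0 := fun P => abs_nonpos_iff.1 (hf.abs_le P)
    simp [hf0]
  have ha2 : 0 < 2 * a := by positivity
  have hmem : (fun P => (f P + a) / (2 * a)) ∈ lipClass := by
    refine ⟨fun P => ?_, fun P Q => ?_⟩
    · obtain ⟨h₁, h₂⟩ := _root_.abs_le.1 (hf.abs_le P)
      exact ⟨div_nonneg (by linarith) ha2.le, (div_le_one ha2).2 (by linarith)⟩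
    · rw [← sub_div, add_sub_add_right_eq_sub, abs_div, abs_of_pos ha2, div_le_iff₀ ha2]
      nlinarith [hf.lipschitz P Q, dist_le_dG P Q, dist_nonneg (x := P) (y := Q)]
  have h_integral (μ : Measure PhaseSpace) [IsProbabilityMeasure μ] :
      ∫ P, (f P + a) / (2 * a) ∂μ = (∫ P, f P ∂μ + a) / (2 * a) := by
    rw [integral_div, integral_add (hf.integrable μ) (integrable_const a)]
    simp
  have h := abs_integral_sub_le_dBL (μ := μ) (ν := ν) hmem
  rw [h_integral, h_integral, ← sub_div, add_sub_add_right_eq_sub, abs_div, abs_of_pos ha2,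
    div_le_iff₀' ha2] at h
  exact h

/-! ### Transport of observables by the flow of a mean field -/

/-- A Lipschitz constant, on the time interval `[0, T]`, of the flow of a mean field of size `B`. -/
def flowConst (B T : ℝ) : ℝ := 2 * (B + 1) * exp ((2 * B + 1) * T)

lemma one_le_flowConst {T : ℝ} (hB : 0 ≤ B) (hT : 0 ≤ T) : 1 ≤ flowConst B T :=
  one_le_mul_of_one_le_of_one_le (by linarith) (one_le_exp (by positivity))

lemma flowConst_nonneg {T : ℝ} (hB : 0 ≤ B) : 0 ≤ flowConst B T := by
  unfold flowConst
  positivity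

lemma dist_flowMap_le (hZ : IsMeanField B Z) {T t : ℝ} (ht : t ∈ Icc 0 T) (P Q : PhaseSpace) :
    dist (flowMap Z 0 t P) (flowMap Z 0 t Q) ≤ flowConst B T * dist P Q := by
  have hB := hZ.nonneg
  have h_snd : dist P.2 Q.2 ≤ flowConst B T * dist P Q :=
    (le_max_right _ _).trans (le_mul_of_one_le_left (dist_nonneg (x := P) (y := Q))
      (one_le_flowConst hB (ht.1.trans ht.2)))
  refine max_le ?_ h_snd
  obtain ⟨b, hb, h⟩ := exists_coe_eq_abs_sub_eq_dist (circRep P.1) Q.1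
  have hQ : flowMap Z 0 t Q = (((phaseFlow Z 0 t b Q.2 : ℝ) : Circ), Q.2) := by
    rw [← flowMap_coe hZ, hb]
  rw [hQ]
  refine (dist_coe_circ_le _ _).trans ((abs_phaseFlow_sub_le hZ 0 t _ b P.2 Q.2).trans ?_)
  rw [h, coe_circRep, sub_zero, abs_of_nonneg ht.1]
  calc (dist P.1 Q.1 + (|P.2.1 - Q.2.1| + 2 * (B * |(P.2.2 : ℝ) - Q.2.2|)))
        * exp ((2 * B + 1) * t)
      ≤ (dist P Q + (dist P Q + 2 * (B * dist P Q))) * exp ((2 * B + 1) * T) := by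
        gcongr
        exacts [dist_fst_le P Q, abs_frequency_sub_le P Q, abs_site_sub_le P Q, ht.2]
    _ = flowConst B T * dist P Q := by
        unfold flowConst
        ring

lemma IsObservable.comp_flowMap (hZ : IsMeanField B Z) {f : PhaseSpace → ℝ} {a T t : ℝ}
    (hf : IsObservable a f) (ht : t ∈ Icc 0 T) :
    IsObservable (a * flowConst B T) fun P => f (flowMap Z 0 t P) where
  abs_le P := (hf.abs_le _).trans (le_mul_of_one_le_right hf.nonneg
    (one_le_flowConst hZ.nonneg (ht.1.trans ht.2)))
  lipschitz P Q := (hf.lipschitz _ _).trans (by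
    rw [mul_assoc]
    exact mul_le_mul_of_nonneg_left (dist_flowMap_le hZ ht P Q) hf.nonneg)

section TwoFields

variable {B' T c m : ℝ} {Z' : ℝ → unitInterval → ℝ × ℝ}

lemma dist_flowMap_flowMap_le (hZ : IsMeanField B Z) (hZ' : IsMeanField B' Z') (hm : 0 ≤ m)
    (hc : 2 * B < c) (h : ∀ t ∈ Icc 0 T, ∀ x, ‖Z t x - Z' t x‖ ≤ m * exp (c * t)) {t : ℝ}
    (ht : t ∈ Icc 0 T) (P : PhaseSpace) :
    dist (flowMap Z 0 t P) (flowMap Z' 0 t P) ≤ 2 * m / (c - 2 * B) * exp (c * t) := by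
  have hspeed : ∀ t ∈ Icc 0 T, ∀ θ : ℝ,
      ‖phaseSpeed (Z t P.2.2) P.2.1 θ - phaseSpeed (Z' t P.2.2) P.2.1 θ‖
        ≤ 2 * m * exp (c * t) := fun t ht θ => by
    refine (abs_phaseSpeed_sub_le' _ _ _ _ _).trans ?_
    rw [sub_self, abs_zero, zero_add]
    linarith [h t ht P.2.2]
  have hflow := norm_sub_le_of_isIntegralCurveOn
    (fun t _ => (hZ.isFlowField P.2).norm_sub_le t)
    ((isIntegralCurve_phaseFlow hZ 0 (circRep P.1) P.2).isIntegralCurveOn _)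
    ((isIntegralCurve_phaseFlow hZ' 0 (circRep P.1) P.2).isIntegralCurveOn _)
    (by positivity) hspeed hc t ht
  rw [phaseFlow_self, phaseFlow_self, sub_self, norm_zero, zero_add] at hflow
  have hsnd : dist (flowMap Z 0 t P).2 (flowMap Z' 0 t P).2 = 0 := dist_self P.2
  exact max_le ((dist_coe_circ_le _ _).trans hflow)
    (hsnd.le.trans ((norm_nonneg _).trans hflow))

lemma IsObservable.abs_integral_map_sub_le (hZ : IsMeanField B Z) (hZ' : IsMeanField B' Z')
    (hm : 0 ≤ m) (hc : 2 * B < c) (h : ∀ t ∈ Icc 0 T, ∀ x, ‖Z t x - Z' t x‖ ≤ m * exp (c * t))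
    {t : ℝ} (ht : t ∈ Icc 0 T) (μ ν : Measure PhaseSpace) [IsProbabilityMeasure μ]
    [IsProbabilityMeasure ν] {f : PhaseSpace → ℝ} {a : ℝ} (hf : IsObservable a f) :
    |∫ P, f P ∂(μ.map (flowMap Z 0 t)) - ∫ P, f P ∂(ν.map (flowMap Z' 0 t))| ≤
      2 * (a * flowConst B T) * dBL μ ν + a * (2 * m / (c - 2 * B) * exp (c * t)) := by
  have hΦ := continuous_flowMap hZ 0 t
  have hΦ' := continuous_flowMap hZ' 0 t
  have hi : Integrable (fun P => f (flowMap Z 0 t P)) ν :=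
    (hf.comp_flowMap hZ ht).integrable ν
  have hi' : Integrable (fun P => f (flowMap Z' 0 t P)) ν :=
    (hf.comp_flowMap hZ' ht).integrable ν
  rw [integral_map hΦ.aemeasurable hf.continuous.aestronglyMeasurable,
    integral_map hΦ'.aemeasurable hf.continuous.aestronglyMeasurable]
  refine (abs_sub_le _ (∫ P, f (flowMap Z 0 t P) ∂ν) _).trans (add_le_add
    (hf.comp_flowMap hZ ht).abs_integral_sub_le ?_)
  rw [← integral_sub hi hi']
  exact abs_integral_le_of_abs_le fun P => (hf.lipschitz _ _).trans
    (mul_le_mul_of_nonneg_left (dist_flowMap_flowMap_le hZ hZ' hm hc h ht P) hf.nonneg)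

end TwoFields

lemma isProbabilityMeasure_map_flowMap (hZ : IsMeanField B Z) (μ : Measure PhaseSpace)
    [IsProbabilityMeasure μ] (s t : ℝ) : IsProbabilityMeasure (μ.map (flowMap Z s t)) :=
  Measure.isProbabilityMeasure_map (continuous_flowMap hZ s t).aemeasurable

lemma continuous_integral_map_flowMap (hZ : IsMeanField B Z) (μ : Measure PhaseSpace)
    [IsFiniteMeasure μ] {f : PhaseSpace → ℝ} (hf : Continuous f) {a : ℝ} (ha : ∀ P, |f P| ≤ a) :
    Continuous fun t => ∫ P, f P ∂(μ.map (flowMap Z 0 t)) := by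
  have h_map (t : ℝ) : ∫ P, f P ∂(μ.map (flowMap Z 0 t)) = ∫ P, f (flowMap Z 0 t P) ∂μ :=
    integral_map (continuous_flowMap hZ 0 t).aemeasurable hf.aestronglyMeasurable
  simp only [h_map]
  exact continuous_of_dominated (bound := fun _ => a)
    (fun t => (hf.comp (continuous_flowMap hZ 0 t)).aestronglyMeasurable)
    (fun t => Eventually.of_forall fun P => ha _) (integrable_const a)
    (Eventually.of_forall fun P => hf.comp ((continuous_flowMap_uncurry hZ).comp
      (f := fun t : ℝ => ((0, t), P)) (by fun_prop)))

/-! ### Self-consistent mean fields and Dobrushin's estimate -/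

/-- The graphons of size `A`: `W` is bounded by `A` and `A`-Lipschitz. -/
structure IsGraphonBound (A : ℝ) (W : unitInterval → unitInterval → ℝ) : Prop where
  abs_le : ∀ x y, |W x y| ≤ A
  lipschitz : ∀ x₁ y₁ x₂ y₂, |W x₁ y₁ - W x₂ y₂| ≤ A * (|(x₁ : ℝ) - x₂| + |(y₁ : ℝ) - y₂|)

/-- The mean field of the measure `μ` at the site `x`: the real and the imaginary part of
`K ∫ W(x, y) e^{iφ} dμ(φ, λ, y)`. -/
def meanField (W : unitInterval → unitInterval → ℝ) (K : ℝ) (μ : Measure PhaseSpace)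
    (x : unitInterval) : ℝ × ℝ :=
  (K * ∫ Q, W x Q.2.2 * circCos Q.1 ∂μ, K * ∫ Q, W x Q.2.2 * circSin Q.1 ∂μ)

/-- The mean field `Z` is generated, on the time interval `[0, T]`, by the image of the measure `μ`
under the flow of `Z` itself. -/
def IsSelfConsistent (W : unitInterval → unitInterval → ℝ) (K T : ℝ) (μ : Measure PhaseSpace)
    (Z : ℝ → unitInterval → ℝ × ℝ) : Prop :=
  ∀ t ∈ Icc 0 T, ∀ x, Z t x = meanField W K (μ.map (flowMap Z 0 t)) x

variable {W : unitInterval → unitInterval → ℝ} {A K T : ℝ}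

lemma IsLipschitzGraphon.exists_isGraphonBound (hW : IsLipschitzGraphon W) :
    ∃ A, IsGraphonBound A W := by
  obtain ⟨L, hL⟩ := hW
  have hlip (x y x' y' : unitInterval) :
      |W x y - W x' y'| ≤ |L| * (|(x : ℝ) - x'| + |(y : ℝ) - y'|) := by
    refine (hL x y x' y').trans (mul_le_mul (le_abs_self L) ?_ (sqrt_nonneg _) (abs_nonneg L))
    rw [sqrt_le_left (by positivity), ← sq_abs ((x : ℝ) - x'), ← sq_abs ((y : ℝ) - y')]
    nlinarith [abs_nonneg ((x : ℝ) - x'), abs_nonneg ((y : ℝ) - y')]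
  have hdist (x : unitInterval) : |(x : ℝ) - (0 : unitInterval)| ≤ 1 := by
    rw [Set.Icc.coe_zero, sub_zero, abs_of_nonneg x.2.1]
    exact x.2.2
  refine ⟨|W 0 0| + |L| * 2, fun x y => ?_, fun x y x' y' => (hlip x y x' y').trans ?_⟩
  · calc |W x y| = |W 0 0 + (W x y - W 0 0)| := by rw [add_sub_cancel]
      _ ≤ |W 0 0| + |W x y - W 0 0| := abs_add_le _ _
      _ ≤ |W 0 0| + |L| * 2 := by
        grw [hlip x y 0 0, hdist x, hdist y]
        norm_num
  · gcongr
    linarith [abs_nonneg (W 0 0), abs_nonneg L]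

lemma IsGraphonBound.nonneg (hW : IsGraphonBound A W) : 0 ≤ A :=
  (abs_nonneg _).trans (hW.abs_le 0 0)

lemma IsGraphonBound.isObservable_mul (hW : IsGraphonBound A W) {c : Circ → ℝ}
    (hc : ∀ θ, |c θ| ≤ 1) (hc' : ∀ θ θ', |c θ - c θ'| ≤ dist θ θ') (x : unitInterval) :
    IsObservable (2 * A) fun Q : PhaseSpace => W x Q.2.2 * c Q.1 := by
  have hA := hW.nonneg
  refine ⟨fun Q => ?_, fun P Q => ?_⟩
  · rw [abs_mul]
    nlinarith [hW.abs_le x Q.2.2, hc Q.1, abs_nonneg (c Q.1)]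
  · have hWPQ := hW.lipschitz x P.2.2 x Q.2.2
    rw [sub_self, abs_zero, zero_add] at hWPQ
    calc |W x P.2.2 * c P.1 - W x Q.2.2 * c Q.1|
        = |(W x P.2.2 - W x Q.2.2) * c P.1 + W x Q.2.2 * (c P.1 - c Q.1)| := by ring_nf
      _ ≤ |W x P.2.2 - W x Q.2.2| * |c P.1| + |W x Q.2.2| * |c P.1 - c Q.1| := by
        simpa only [abs_mul] using abs_add_le ((W x P.2.2 - W x Q.2.2) * c P.1)
          (W x Q.2.2 * (c P.1 - c Q.1))
      _ ≤ A * dist P Q * 1 + A * dist P Q := by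
        gcongr
        · exact hWPQ.trans (mul_le_mul_of_nonneg_left (abs_site_sub_le P Q) hA)
        · exact hc _
        · exact hW.abs_le _ _
        · exact (hc' _ _).trans (dist_fst_le P Q)
      _ = 2 * A * dist P Q := by ring

lemma IsGraphonBound.isObservable_cos (hW : IsGraphonBound A W) (x : unitInterval) :
    IsObservable (2 * A) fun Q : PhaseSpace => W x Q.2.2 * circCos Q.1 :=
  hW.isObservable_mul abs_circCos_le_one abs_circCos_sub_le x

lemma IsGraphonBound.isObservable_sin (hW : IsGraphonBound A W) (x : unitInterval) :
    IsObservable (2 * A) fun Q : PhaseSpace => W x Q.2.2 * circSin Q.1 :=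
  hW.isObservable_mul abs_circSin_le_one abs_circSin_sub_le x

lemma norm_meanField_sub_le {μ ν : Measure PhaseSpace} {x y : unitInterval} {C : ℝ}
    (hcos : |∫ Q, W x Q.2.2 * circCos Q.1 ∂μ - ∫ Q, W y Q.2.2 * circCos Q.1 ∂ν| ≤ C)
    (hsin : |∫ Q, W x Q.2.2 * circSin Q.1 ∂μ - ∫ Q, W y Q.2.2 * circSin Q.1 ∂ν| ≤ C) :
    ‖meanField W K μ x - meanField W K ν y‖ ≤ |K| * C := by
  rw [meanField, meanField, Prod.mk_sub_mk, ← mul_sub, ← mul_sub]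
  refine norm_prod_le_iff.2 ⟨?_, ?_⟩ <;> rw [norm_eq_abs, abs_mul] <;> gcongr

/-- The size of the mean fields generated by probability measures and a graphon of size `A`. -/
def fieldBound (K A : ℝ) : ℝ := |K| * (2 * A)

lemma norm_meanField_le (hW : IsGraphonBound A W) (K : ℝ) (μ : Measure PhaseSpace)
    [IsProbabilityMeasure μ] (x : unitInterval) : ‖meanField W K μ x‖ ≤ fieldBound K A := by
  refine norm_prod_le_iff.2 ⟨?_, ?_⟩ <;> rw [meanField, norm_eq_abs, abs_mul, fieldBound] <;> gcongr
  exacts [abs_integral_le_of_abs_le (hW.isObservable_cos x).abs_le,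
    abs_integral_le_of_abs_le (hW.isObservable_sin x).abs_le]

lemma norm_meanField_site_sub_le (hW : IsGraphonBound A W) (K : ℝ) (μ : Measure PhaseSpace)
    [IsProbabilityMeasure μ] (x y : unitInterval) :
    ‖meanField W K μ x - meanField W K μ y‖ ≤ fieldBound K A * |(x : ℝ) - y| := by
  have h_integral {c : Circ → ℝ} (hc : ∀ θ, |c θ| ≤ 1) (hc' : ∀ θ θ', |c θ - c θ'| ≤ dist θ θ') :
      |∫ Q, W x Q.2.2 * c Q.1 ∂μ - ∫ Q, W y Q.2.2 * c Q.1 ∂μ| ≤ 2 * A * |(x : ℝ) - y| := by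
    rw [← integral_sub ((hW.isObservable_mul hc hc' x).integrable μ)
      ((hW.isObservable_mul hc hc' y).integrable μ)]
    refine abs_integral_le_of_abs_le fun Q => ?_
    have h := hW.lipschitz x Q.2.2 y Q.2.2
    rw [sub_self, abs_zero, add_zero] at h
    rw [← sub_mul, abs_mul]
    nlinarith [hc Q.1, abs_nonneg (c Q.1), abs_nonneg (W x Q.2.2 - W y Q.2.2)]
  rw [fieldBound, mul_assoc]
  exact norm_meanField_sub_le (h_integral abs_circCos_le_one abs_circCos_sub_le)
    (h_integral abs_circSin_le_one abs_circSin_sub_le)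

lemma continuous_meanField_map (hW : IsGraphonBound A W) (K : ℝ) (hZ : IsMeanField B Z)
    (μ : Measure PhaseSpace) [IsProbabilityMeasure μ] (x : unitInterval) :
    Continuous fun t => meanField W K (μ.map (flowMap Z 0 t)) x := by
  have h_integral {f : PhaseSpace → ℝ} (hf : IsObservable (2 * A) f) :=
    continuous_integral_map_flowMap hZ μ hf.continuous hf.abs_le
  exact ((h_integral (hW.isObservable_cos x)).const_mul K).prodMk
    ((h_integral (hW.isObservable_sin x)).const_mul K)

/-- The rate `c` of the weight `exp (c * t)` for which the map from mean fields to the mean fields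
they generate is a contraction by the factor `1 / 2`. -/
def fieldRate (B : ℝ) : ℝ := 6 * B + 1

section Dobrushin

variable {B' m : ℝ} {Z' : ℝ → unitInterval → ℝ × ℝ} {μ ν : Measure PhaseSpace}
  [IsProbabilityMeasure μ] [IsProbabilityMeasure ν]

lemma norm_meanField_map_sub_le (hW : IsGraphonBound A W)
    (hZ : IsMeanField (fieldBound K A) Z) (hZ' : IsMeanField B' Z') (hm : 0 ≤ m)
    (h : ∀ t ∈ Icc 0 T, ∀ x, ‖Z t x - Z' t x‖ ≤ m * exp (fieldRate (fieldBound K A) * t)) :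
    ∀ t ∈ Icc 0 T, ∀ x,
      ‖meanField W K (μ.map (flowMap Z 0 t)) x - meanField W K (ν.map (flowMap Z' 0 t)) x‖ ≤
        (2 * fieldBound K A * flowConst (fieldBound K A) T * dBL μ ν + m / 2)
          * exp (fieldRate (fieldBound K A) * t) := by
  intro t ht x
  set B := fieldBound K A with hB
  have hB0 : 0 ≤ B := hZ.nonneg
  have hrate : 2 * B < fieldRate B := by unfold fieldRate; linarith
  have h_integral {f : PhaseSpace → ℝ} (hf : IsObservable (2 * A) f) :=
    hf.abs_integral_map_sub_le hZ hZ' hm hrate h ht μ ν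
  have hcontract : B * (2 * m / (fieldRate B - 2 * B)) ≤ m / 2 := by
    rw [← mul_div_assoc, div_le_iff₀ (by linarith), fieldRate]
    nlinarith
  have hexp : 1 ≤ exp (fieldRate B * t) := one_le_exp (mul_nonneg (by linarith) ht.1)
  have hinit : 0 ≤ 2 * B * flowConst B T * dBL μ ν := by
    have := dBL_nonneg μ ν
    have := flowConst_nonneg (T := T) hB0
    positivity
  refine (norm_meanField_sub_le (h_integral (hW.isObservable_cos x))
    (h_integral (hW.isObservable_sin x))).trans ?_
  calc |K| * (2 * (2 * A * flowConst B T) * dBL μ ν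
        + 2 * A * (2 * m / (fieldRate B - 2 * B) * exp (fieldRate B * t)))
      = 2 * B * flowConst B T * dBL μ ν
        + B * (2 * m / (fieldRate B - 2 * B)) * exp (fieldRate B * t) := by
        rw [hB, fieldBound]
        ring
    _ ≤ 2 * B * flowConst B T * dBL μ ν * exp (fieldRate B * t)
        + m / 2 * exp (fieldRate B * t) :=
      add_le_add (le_mul_of_one_le_right hinit hexp) (by gcongr)
    _ = _ := by ring

lemma IsSelfConsistent.norm_sub_le (hW : IsGraphonBound A W)
    (hZ : IsMeanField (fieldBound K A) Z) (hZ' : IsMeanField B' Z')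
    (h : IsSelfConsistent W K T μ Z) (h' : IsSelfConsistent W K T ν Z') :
    ∀ t ∈ Icc 0 T, ∀ x, ‖Z t x - Z' t x‖ ≤
      4 * fieldBound K A * flowConst (fieldBound K A) T * dBL μ ν
        * exp (fieldRate (fieldBound K A) * t) := by
  set B := fieldBound K A
  have hB0 : 0 ≤ B := hZ.nonneg
  have hB0' : 0 ≤ B' := hZ'.nonneg
  set D := 4 * B * flowConst B T * dBL μ ν with hD
  have hD0 : 0 ≤ D := by
    have := flowConst_nonneg (T := T) hB0
    have := dBL_nonneg μ ν
    positivity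
  have hiterate (n : ℕ) : ∀ t ∈ Icc 0 T, ∀ x,
      ‖Z t x - Z' t x‖ ≤ (D + (B + B') / 2 ^ n) * exp (fieldRate B * t) := by
    induction n with
    | zero =>
      intro t ht x
      have hrate : 0 ≤ fieldRate B := by unfold fieldRate; positivity
      calc ‖Z t x - Z' t x‖ ≤ ‖Z t x‖ + ‖Z' t x‖ := _root_.norm_sub_le _ _
        _ ≤ B + B' := add_le_add (hZ.norm_le t x) (hZ'.norm_le t x)
        _ ≤ D + (B + B') / 2 ^ 0 := by linarith
        _ ≤ _ := le_mul_of_one_le_right (by positivity) (one_le_exp (mul_nonneg hrate ht.1))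
    | succ n ih =>
      intro t ht x
      rw [h t ht x, h' t ht x]
      refine (norm_meanField_map_sub_le hW hZ hZ' (by positivity) ih t ht x).trans_eq ?_
      rw [hD, pow_succ]
      ring
  intro t ht x
  have hlim : Tendsto (fun n : ℕ => (D + (B + B') / 2 ^ n) * exp (fieldRate B * t)) atTop
      (𝓝 ((D + 0) * exp (fieldRate B * t))) :=
    (tendsto_const_nhds.add (tendsto_const_nhds.div_atTop
      (tendsto_pow_atTop_atTop_of_one_lt one_lt_two))).mul_const _
  rw [add_zero] at hlim
  exact ge_of_tendsto' hlim fun n => hiterate n t ht x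

lemma IsSelfConsistent.eq (hW : IsGraphonBound A W) (hZ : IsMeanField (fieldBound K A) Z)
    (hZ' : IsMeanField B' Z') (h : IsSelfConsistent W K T μ Z) (h' : IsSelfConsistent W K T μ Z') :
    ∀ t ∈ Icc 0 T, Z t = Z' t := by
  refine fun t ht => funext fun x => ?_
  have := h.norm_sub_le hW hZ hZ' h' t ht x
  rw [dBL_self, mul_zero, zero_mul] at this
  exact sub_eq_zero.1 (norm_le_zero_iff.1 this)

/-- The constant of Dobrushin's stability estimate on the time interval `[0, T]`. -/
def stabilityConst (B T : ℝ) : ℝ :=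
  4 * flowConst B T * (1 + 4 * B / (fieldRate B - 2 * B) * exp (fieldRate B * T))

lemma IsSelfConsistent.dBL_map_le (hW : IsGraphonBound A W)
    (hZ : IsMeanField (fieldBound K A) Z) (hZ' : IsMeanField B' Z')
    (h : IsSelfConsistent W K T μ Z) (h' : IsSelfConsistent W K T ν Z') {t : ℝ}
    (ht : t ∈ Icc 0 T) :
    dBL (μ.map (flowMap Z 0 t)) (ν.map (flowMap Z' 0 t)) ≤
      stabilityConst (fieldBound K A) T * dBL μ ν := by
  set B := fieldBound K A
  have hB0 : 0 ≤ B := hZ.nonneg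
  have hrate : 2 * B < fieldRate B := by unfold fieldRate; linarith
  have : 0 < fieldRate B - 2 * B := sub_pos.2 hrate
  have hd := dBL_nonneg μ ν
  have hF := flowConst_nonneg (T := T) hB0
  have hexp : exp (fieldRate B * t) ≤ exp (fieldRate B * T) :=
    exp_le_exp.2 (mul_le_mul_of_nonneg_left ht.2 (by linarith))
  refine dBL_le (by unfold stabilityConst; positivity) fun f hf => ?_
  calc |∫ P, f P ∂(μ.map (flowMap Z 0 t)) - ∫ P, f P ∂(ν.map (flowMap Z' 0 t))|
      ≤ 2 * (2 * flowConst B T) * dBL μ ν + 2 * (2 * (4 * B * flowConst B T * dBL μ ν)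
          / (fieldRate B - 2 * B) * exp (fieldRate B * t)) :=
        (IsObservable.of_mem_lipClass hf).abs_integral_map_sub_le hZ hZ' (by positivity) hrate
          (h.norm_sub_le hW hZ hZ' h') ht μ ν
    _ ≤ 2 * (2 * flowConst B T) * dBL μ ν + 2 * (2 * (4 * B * flowConst B T * dBL μ ν)
          / (fieldRate B - 2 * B) * exp (fieldRate B * T)) := by gcongr
    _ = stabilityConst B T * dBL μ ν := by unfold stabilityConst; ring

end Dobrushin

/-! ### Existence of a self-consistent mean field -/

/-- The time `t`, stopped outside of the interval `[0, T]`. -/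
def stoppedTime (T t : ℝ) : ℝ := max 0 (min t T)

lemma stoppedTime_mem_Icc (hT : 0 ≤ T) (t : ℝ) : stoppedTime T t ∈ Icc 0 T :=
  ⟨le_max_left _ _, max_le hT (min_le_right _ _)⟩

lemma stoppedTime_of_mem_Icc {t : ℝ} (ht : t ∈ Icc 0 T) : stoppedTime T t = t := by
  rw [stoppedTime, min_eq_left ht.2, max_eq_right ht.1]

lemma continuous_stoppedTime (T : ℝ) : Continuous (stoppedTime T) := by
  unfold stoppedTime
  fun_prop

/-- The mean field generated by the image of the measure `μ` under the flow of the mean field `Z`,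
with the time stopped outside of `[0, T]`. -/
def inducedField (W : unitInterval → unitInterval → ℝ) (K T : ℝ) (μ : Measure PhaseSpace)
    (Z : ℝ → unitInterval → ℝ × ℝ) (t : ℝ) (x : unitInterval) : ℝ × ℝ :=
  meanField W K (μ.map (flowMap Z 0 (stoppedTime T t))) x

/-- The Picard iterates of `inducedField`, starting from the zero field. -/
def picardField (W : unitInterval → unitInterval → ℝ) (K T : ℝ) (μ : Measure PhaseSpace) (n : ℕ) :
    ℝ → unitInterval → ℝ × ℝ :=
  (inducedField W K T μ)^[n] 0

lemma picardField_succ (W : unitInterval → unitInterval → ℝ) (K T : ℝ) (μ : Measure PhaseSpace)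
    (n : ℕ) : picardField W K T μ (n + 1) = inducedField W K T μ (picardField W K T μ n) :=
  Function.iterate_succ_apply' _ _ _

lemma IsMeanField.of_tendstoUniformly {Zs : ℕ → ℝ → unitInterval → ℝ × ℝ}
    (hZs : ∀ n, IsMeanField B (Zs n))
    (hZ : ∀ x, TendstoUniformly (fun n t => Zs n t x) (fun t => Z t x) atTop) :
    IsMeanField B Z where
  continuous x := (hZ x).continuous (Frequently.of_forall fun n => (hZs n).continuous x)
  norm_le t x := le_of_tendsto' ((hZ x).tendsto_at t).norm fun n => (hZs n).norm_le t x
  lipschitz t x y := le_of_tendsto' (((hZ x).tendsto_at t).sub ((hZ y).tendsto_at t)).norm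
    fun n => (hZs n).lipschitz t x y

section Picard

variable (hW : IsGraphonBound A W) (μ : Measure PhaseSpace) [IsProbabilityMeasure μ]
include hW

lemma IsGraphonBound.fieldBound_nonneg (K : ℝ) : 0 ≤ fieldBound K A :=
  mul_nonneg (abs_nonneg K) (mul_nonneg zero_le_two hW.nonneg)

lemma IsGraphonBound.fieldRate_nonneg (K : ℝ) : 0 ≤ fieldRate (fieldBound K A) := by
  have := hW.fieldBound_nonneg K
  unfold fieldRate
  positivity

lemma isMeanField_inducedField (K T : ℝ) (hZ : IsMeanField B Z) :
    IsMeanField (fieldBound K A) (inducedField W K T μ Z) := by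
  have := isProbabilityMeasure_map_flowMap hZ μ 0
  exact ⟨fun x => (continuous_meanField_map hW K hZ μ x).comp (continuous_stoppedTime T),
    fun t x => norm_meanField_le hW K _ x, fun t x y => norm_meanField_site_sub_le hW K _ x y⟩

lemma isMeanField_picardField (K T : ℝ) (n : ℕ) :
    IsMeanField (fieldBound K A) (picardField W K T μ n) := by
  induction n with
  | zero =>
    have hB := hW.fieldBound_nonneg K
    exact ⟨fun _ => continuous_const, fun t x => by simpa [picardField] using hB,
      fun t x y => by simpa [picardField] using mul_nonneg hB (abs_nonneg _)⟩
  | succ n ih =>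
    rw [picardField_succ]
    exact isMeanField_inducedField hW μ K T ih

lemma norm_inducedField_sub_le (hT : 0 ≤ T) {m : ℝ} {Z' : ℝ → unitInterval → ℝ × ℝ}
    (hZ : IsMeanField (fieldBound K A) Z) (hZ' : IsMeanField (fieldBound K A) Z') (hm : 0 ≤ m)
    (h : ∀ t ∈ Icc 0 T, ∀ x, ‖Z t x - Z' t x‖ ≤ m * exp (fieldRate (fieldBound K A) * t))
    (t : ℝ) (x : unitInterval) :
    ‖inducedField W K T μ Z t x - inducedField W K T μ Z' t x‖ ≤
      m / 2 * exp (fieldRate (fieldBound K A) * stoppedTime T t) := by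
  have := norm_meanField_map_sub_le (μ := μ) (ν := μ) hW hZ hZ' hm h _ (stoppedTime_mem_Icc hT t) x
  rwa [dBL_self, mul_zero, zero_add] at this

lemma norm_picardField_succ_sub_le (K : ℝ) (hT : 0 ≤ T) (n : ℕ) (t : ℝ) (x : unitInterval) :
    ‖picardField W K T μ (n + 1) t x - picardField W K T μ n t x‖ ≤
      2 * fieldBound K A / 2 ^ n * exp (fieldRate (fieldBound K A) * stoppedTime T t) := by
  have hB := hW.fieldBound_nonneg K
  have hmf := isMeanField_picardField hW μ K T
  induction n generalizing t x with
  | zero =>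
    have hexp : 1 ≤ exp (fieldRate (fieldBound K A) * stoppedTime T t) :=
      one_le_exp (mul_nonneg (hW.fieldRate_nonneg K) (le_max_left _ _))
    calc _ ≤ fieldBound K A + fieldBound K A :=
          (norm_sub_le _ _).trans (add_le_add ((hmf _).norm_le t x) ((hmf _).norm_le t x))
      _ = 2 * fieldBound K A / 2 ^ 0 := by ring
      _ ≤ _ := le_mul_of_one_le_right (by positivity) hexp
  | succ n ih =>
    rw [picardField_succ, congrFun₂ (picardField_succ W K T μ n)]
    refine (norm_inducedField_sub_le hW μ hT (hmf (n + 1)) (hmf n)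
      (m := 2 * fieldBound K A / 2 ^ n) (by positivity) (fun t ht x => ?_) t x).trans_eq ?_
    · simpa only [stoppedTime_of_mem_Icc ht] using ih t x
    · rw [pow_succ]
      ring

lemma exists_norm_picardField_sub_le (K : ℝ) (hT : 0 ≤ T) :
    ∃ (C : ℝ) (Z : ℝ → unitInterval → ℝ × ℝ), 0 ≤ C ∧
      ∀ n t x, ‖picardField W K T μ n t x - Z t x‖ ≤ C / 2 ^ n := by
  have hR := hW.fieldRate_nonneg K
  have hB := hW.fieldBound_nonneg K
  set B := fieldBound K A
  set C := 2 * (2 * B * exp (fieldRate B * T)) with hC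
  have hdist (t : ℝ) (x : unitInterval) (n : ℕ) :
      dist (picardField W K T μ n t x) (picardField W K T μ (n + 1) t x) ≤ C / 2 / 2 ^ n := by
    rw [dist_comm, dist_eq_norm]
    calc ‖picardField W K T μ (n + 1) t x - picardField W K T μ n t x‖
        ≤ 2 * B / 2 ^ n * exp (fieldRate B * stoppedTime T t) :=
          norm_picardField_succ_sub_le hW μ K hT n t x
      _ ≤ 2 * B / 2 ^ n * exp (fieldRate B * T) := by
          gcongr
          exact (stoppedTime_mem_Icc hT t).2
      _ = C / 2 / 2 ^ n := by rw [hC]; ring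
  choose Z hZ using fun t x =>
    cauchySeq_tendsto_of_complete (cauchySeq_of_le_geometric_two (hdist t x))
  refine ⟨C, Z, by positivity, fun n t x => ?_⟩
  rw [← dist_eq_norm]
  exact dist_le_of_le_geometric_two_of_tendsto (hdist t x) (hZ t x) n

lemma exists_isSelfConsistent (K : ℝ) (hT : 0 ≤ T) :
    ∃ Z, IsMeanField (fieldBound K A) Z ∧ IsSelfConsistent W K T μ Z := by
  obtain ⟨C, Z, hC, hclose⟩ := exists_norm_picardField_sub_le (T := T) hW μ K hT
  have hmf := isMeanField_picardField hW μ K T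
  have hpow : Tendsto (fun n : ℕ => C / 2 ^ n) atTop (𝓝 0) :=
    tendsto_const_nhds.div_atTop (tendsto_pow_atTop_atTop_of_one_lt one_lt_two)
  have hunif (x : unitInterval) :
      TendstoUniformly (fun n t => picardField W K T μ n t x) (fun t => Z t x) atTop := by
    rw [Metric.tendstoUniformly_iff]
    intro ε hε
    filter_upwards [hpow.eventually_lt_const hε] with n hn t
    rw [dist_comm, dist_eq_norm]
    exact (hclose n t x).trans_lt hn
  have hZ : IsMeanField (fieldBound K A) Z := .of_tendstoUniformly hmf hunif
  refine ⟨Z, hZ, fun t ht x => ?_⟩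
  have hinduced : Tendsto (fun n => picardField W K T μ (n + 1) t x) atTop
      (𝓝 (inducedField W K T μ Z t x)) := by
    rw [tendsto_iff_norm_sub_tendsto_zero]
    refine squeeze_zero (fun _ => norm_nonneg _) (fun n => ?_) (by
      simpa using (hpow.div_const 2).mul_const
        (exp (fieldRate (fieldBound K A) * stoppedTime T t)))
    rw [picardField_succ]
    refine norm_inducedField_sub_le hW μ hT (hmf n) hZ (by positivity)
      (fun t ht x => (hclose n t x).trans ?_) t x
    exact le_mul_of_one_le_right (by positivity)
      (one_le_exp (mul_nonneg (hW.fieldRate_nonneg K) ht.1))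
  rw [tendsto_nhds_unique (((hunif x).tendsto_at t).comp (tendsto_add_atTop_nat 1)) hinduced,
    inducedField, stoppedTime_of_mem_Icc ht]

end Picard

/-! ### Existence of a weak solution -/

/-- A test function `w` of class `C¹` in the time and the angle, with the time derivative `w_t` and
the angular derivative `w_θ`. -/
structure IsC1TestFunction (T : ℝ) (w w_t w_θ : ℝ → PhaseSpace → ℝ) : Prop where
  continuous : Continuous fun q : ℝ × PhaseSpace => w q.1 q.2
  continuous_time : Continuous fun q : ℝ × PhaseSpace => w_t q.1 q.2
  continuous_angle : Continuous fun q : ℝ × PhaseSpace => w_θ q.1 q.2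
  hasDerivAt_time : ∀ t P, HasDerivAt (fun t => w t P) (w_t t P) t
  hasDerivAt_angle : ∀ t (θ : ℝ) y,
    HasDerivAt (fun θ : ℝ => w t ((θ : Circ), y)) (w_θ t ((θ : Circ), y)) θ
  support : ∃ τ < T, ∃ R, ∀ t (P : PhaseSpace), τ ≤ t ∨ R ≤ |P.2.1| → w t P = 0

lemma derivTheta_coe (f : PhaseSpace → ℝ) (θ : ℝ) (y : ℝ × unitInterval) :
    derivTheta f ((θ : Circ), y) = deriv (fun θ : ℝ => f ((θ : Circ), y)) θ := by
  simp only [derivTheta, ← AddCircle.coe_add]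
  rw [deriv_comp_const_add (f := fun θ : ℝ => f ((θ : Circ), y)) θ, add_zero]

section C1TestFunction

variable {w w_t w_θ : ℝ → PhaseSpace → ℝ}

lemma IsTestFunction.isC1TestFunction (hw : IsTestFunction T w) :
    IsC1TestFunction T w (fun t P => deriv (fun s => w s P) t) (fun t => derivTheta (w t)) := by
  obtain ⟨F, hF, hwF⟩ := hw.smooth
  obtain ⟨τ, hτ, R, hsupport⟩ := hw.support
  have hpoint : Continuous fun q : ℝ × ℝ × ℝ × unitInterval =>
      ((q.1, q.2.1, q.2.2.1, (q.2.2.2 : ℝ)) : ℝ × ℝ × ℝ × ℝ) := by fun_prop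
  have hdiff (q : ℝ × ℝ × ℝ × ℝ) : HasFDerivAt F (fderiv ℝ F q) q :=
    (hF.differentiable (by simp) q).hasFDerivAt
  have hcont (v : ℝ × ℝ × ℝ × ℝ) : Continuous fun q : ℝ × ℝ × ℝ × unitInterval =>
      fderiv ℝ F (q.1, q.2.1, q.2.2.1, q.2.2.2) v :=
    ((hF.continuous_fderiv (by simp)).comp hpoint).clm_apply continuous_const
  have htime (t θ : ℝ) (y : ℝ × unitInterval) : HasDerivAt (fun t => w t ((θ : Circ), y))
      (fderiv ℝ F (t, θ, y.1, y.2) (1, 0, 0, 0)) t := by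
    simp only [hwF]
    exact (hdiff _).comp_hasDerivAt t ((hasDerivAt_id t).prodMk (hasDerivAt_const t _))
  have hangle (t θ : ℝ) (y : ℝ × unitInterval) : HasDerivAt (fun θ : ℝ => w t ((θ : Circ), y))
      (fderiv ℝ F (t, θ, y.1, y.2) (0, 1, 0, 0)) θ := by
    simp only [hwF]
    exact (hdiff _).comp_hasDerivAt θ
      ((hasDerivAt_const θ t).prodMk ((hasDerivAt_id θ).prodMk (hasDerivAt_const θ _)))
  refine ⟨?_, ?_, ?_, ?_, fun t θ y => ?_, τ, hτ, R, fun t P => hsupport t P.1 P.2.1 P.2.2⟩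
  · apply continuous_of_continuous_lift
    simp only [hwF]
    exact hF.continuous.comp hpoint
  · apply continuous_of_continuous_lift
    simpa only [(htime _ _ _).deriv] using hcont (1, 0, 0, 0)
  · apply continuous_of_continuous_lift
    simpa only [derivTheta_coe, (hangle _ _ _).deriv] using hcont (0, 1, 0, 0)
  · rintro t ⟨θ, y⟩
    obtain ⟨θ, rfl⟩ := QuotientAddGroup.mk_surjective θ
    exact (htime t θ y).differentiableAt.hasDerivAt
  · rw [derivTheta_coe]
    exact (hangle t θ y).differentiableAt.hasDerivAt

variable (hw : IsC1TestFunction T w w_t w_θ)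
include hw

lemma IsC1TestFunction.derivTheta_eq (t : ℝ) (P : PhaseSpace) :
    derivTheta (w t) P = w_θ t P := by
  obtain ⟨θ, y⟩ := P
  obtain ⟨θ, rfl⟩ := QuotientAddGroup.mk_surjective θ
  exact (derivTheta_coe _ _ _).trans (hw.hasDerivAt_angle t θ y).deriv

lemma IsC1TestFunction.derivatives_eq_zero {R : ℝ}
    (hR : ∀ t (P : PhaseSpace), R ≤ |P.2.1| → w t P = 0) {t : ℝ} {P : PhaseSpace}
    (hP : R ≤ |P.2.1|) : w_t t P = 0 ∧ w_θ t P = 0 := by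
  constructor
  · rw [← (hw.hasDerivAt_time t P).deriv]
    simp only [hR _ P hP, deriv_const]
  · have hzero : (fun s : ℝ => w t (P.1 + (s : Circ), P.2)) = fun _ => 0 :=
      funext fun s => hR t _ hP
    rw [← hw.derivTheta_eq, derivTheta, hzero, deriv_const]

lemma IsC1TestFunction.hasDerivAt_comp {γ : ℝ → ℝ} {γ' t : ℝ} (hγ : HasDerivAt γ γ' t)
    (y : ℝ × unitInterval) :
    HasDerivAt (fun t => w t ((γ t : Circ), y))
      (w_t t ((γ t : Circ), y) + γ' * w_θ t ((γ t : Circ), y)) t := by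
  have hlift : Continuous fun q : ℝ × ℝ => (q.1, ((q.2 : Circ), y)) := by
    have := AddCircle.continuous_mk' (2 * π)
    exact continuous_fst.prodMk ((this.comp continuous_snd).prodMk continuous_const)
  have hpartial (g : ℝ × PhaseSpace → ℝ) (hg : Continuous g) : Continuous fun q : ℝ × ℝ =>
      ContinuousLinearMap.toSpanSingleton ℝ (g (q.1, ((q.2 : Circ), y))) :=
    (ContinuousLinearMap.toSpanSingletonCLE (𝕜 := ℝ) (E := ℝ)).continuous.comp (hg.comp hlift)
  have hstrict := hasStrictFDerivAt_uncurry_coprod (𝕜 := ℝ) (u := (t, γ t))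
    (f := fun t θ => w t ((θ : Circ), y))
    (f₁ := fun t θ => ContinuousLinearMap.toSpanSingleton ℝ (w_t t ((θ : Circ), y)))
    (f₂ := fun t θ => ContinuousLinearMap.toSpanSingleton ℝ (w_θ t ((θ : Circ), y)))
    (Eventually.of_forall fun v => (hw.hasDerivAt_time v.1 (_, y)).hasFDerivAt)
    (Eventually.of_forall fun v => (hw.hasDerivAt_angle v.1 v.2 y).hasFDerivAt)
    (hpartial _ hw.continuous_time).continuousAt (hpartial _ hw.continuous_angle).continuousAt
  refine (hstrict.hasFDerivAt.comp_hasDerivAt t ((hasDerivAt_id t).prodMk hγ)).congr_deriv ?_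
  simp [Function.HasUncurry.uncurry]

end C1TestFunction

lemma exists_forall_abs_le_of_eq_zero {g : ℝ → PhaseSpace → ℝ}
    (hg : Continuous fun q : ℝ × PhaseSpace => g q.1 q.2) {R : ℝ}
    (hR : ∀ t (P : PhaseSpace), R ≤ |P.2.1| → g t P = 0) (T : ℝ) :
    ∃ C, ∀ t ∈ Icc 0 T, ∀ P, |g t P| ≤ C := by
  have hcompact : IsCompact (Icc 0 T ×ˢ (univ : Set Circ) ×ˢ Icc (-R) R ×ˢ
      (univ : Set unitInterval)) :=
    isCompact_Icc.prod (isCompact_univ.prod (isCompact_Icc.prod isCompact_univ))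
  obtain ⟨C, hC⟩ := hcompact.exists_bound_of_continuousOn hg.continuousOn
  refine ⟨max C 0, fun t ht P => ?_⟩
  rcases le_total R |P.2.1| with hP | hP
  · rw [hR t P hP, abs_zero]
    exact le_max_right _ _
  · exact (hC (t, P) ⟨ht, mem_univ _, abs_le.1 hP, mem_univ _⟩).trans (le_max_left _ _)

lemma continuous_circSin : Continuous circSin :=
  (QuotientAddGroup.isOpenQuotientMap_mk
    (N := AddSubgroup.zmultiples (2 * π))).isQuotientMap.continuous_iff.2 continuous_sin

lemma continuous_circCos : Continuous circCos :=
  (QuotientAddGroup.isOpenQuotientMap_mk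
    (N := AddSubgroup.zmultiples (2 * π))).isQuotientMap.continuous_iff.2 continuous_cos

/-- The speed of the oscillators in the state `P` in the mean field `z`. -/
def fieldSpeed (z : ℝ × ℝ) (P : PhaseSpace) : ℝ :=
  P.2.1 + z.2 * circCos P.1 - z.1 * circSin P.1

lemma fieldSpeed_coe (z : ℝ × ℝ) (θ : ℝ) (y : ℝ × unitInterval) :
    fieldSpeed z ((θ : Circ), y) = phaseSpeed z y.1 θ := by
  simp [fieldSpeed, phaseSpeed]

lemma continuous_fieldSpeed (hZ : IsMeanField B Z) :
    Continuous fun q : ℝ × PhaseSpace => fieldSpeed (Z q.1 q.2.2.2) q.2 := by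
  have hfield : Continuous fun q : ℝ × PhaseSpace => Z q.1 q.2.2.2 :=
    hZ.continuous_uncurry.comp (f := fun q : ℝ × PhaseSpace => (q.1, q.2.2.2)) (by fun_prop)
  have hsin := continuous_circSin.comp (f := fun q : ℝ × PhaseSpace => q.2.1) (by fun_prop)
  have hcos := continuous_circCos.comp (f := fun q : ℝ × PhaseSpace => q.2.1) (by fun_prop)
  exact (Continuous.add (by fun_prop) (hfield.snd.mul hcos)).sub (hfield.fst.mul hsin)

lemma integral_sub_integral_eq {X : Type*} [TopologicalSpace X] [MeasurableSpace X]
    [OpensMeasurableSpace (ℝ × X)] {μ : Measure X} [IsFiniteMeasure μ] {u h : ℝ → X → ℝ}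
    (hu : ∀ t P, HasDerivAt (fun t => u t P) (h t P) t)
    (hh : Continuous fun q : ℝ × X => h q.1 q.2) {T C : ℝ} (hT : 0 ≤ T)
    (hC : ∀ t ∈ Icc 0 T, ∀ P, |h t P| ≤ C) (h0 : Integrable (u 0) μ) (h1 : Integrable (u T) μ) :
    (∫ P, u T P ∂μ) - ∫ P, u 0 P ∂μ = ∫ t in (0 : ℝ)..T, ∫ P, h t P ∂μ := by
  have hint : Integrable (fun q : ℝ × X => h q.1 q.2)
      (((volume : Measure ℝ).restrict (Ioc 0 T)).prod μ) := by
    refine Integrable.of_bound hh.aestronglyMeasurable C ?_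
    have : ∀ᵐ q : ℝ × X ∂(((volume : Measure ℝ).restrict (Ioc 0 T)).prod μ), q.1 ∈ Ioc 0 T :=
      Measure.quasiMeasurePreserving_fst.ae (ae_restrict_mem measurableSet_Ioc)
    filter_upwards [this] with q hq using hC _ (Ioc_subset_Icc_self hq) _
  rw [← integral_sub h1 h0, intervalIntegral.integral_of_le hT, integral_integral_swap hint]
  refine integral_congr_ae (Eventually.of_forall fun P => ?_)
  simp only
  rw [← intervalIntegral.integral_of_le hT]
  exact (intervalIntegral.integral_eq_sub_of_hasDerivAt (fun t _ => hu t P)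
    ((hh.comp (Continuous.prodMk_left P)).intervalIntegrable 0 T)).symm

/-- The derivative of a test function with the partial derivatives `w_t` and `w_θ` along the flow of
the mean field `Z`. -/
def transportDeriv (Z : ℝ → unitInterval → ℝ × ℝ) (w_t w_θ : ℝ → PhaseSpace → ℝ) (t : ℝ)
    (P : PhaseSpace) : ℝ :=
  w_t t P + fieldSpeed (Z t P.2.2) P * w_θ t P

section TransportDeriv

variable {w w_t w_θ : ℝ → PhaseSpace → ℝ} (hw : IsC1TestFunction T w w_t w_θ)
include hw

lemma IsC1TestFunction.continuous_transportDeriv (hZ : IsMeanField B Z) :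
    Continuous fun q : ℝ × PhaseSpace => transportDeriv Z w_t w_θ q.1 q.2 :=
  hw.continuous_time.add ((continuous_fieldSpeed hZ).mul hw.continuous_angle)

lemma IsC1TestFunction.transportDeriv_eq_zero {R : ℝ}
    (hR : ∀ t (P : PhaseSpace), R ≤ |P.2.1| → w t P = 0) (Z : ℝ → unitInterval → ℝ × ℝ) (t : ℝ)
    (P : PhaseSpace) (hP : R ≤ |P.2.1|) : transportDeriv Z w_t w_θ t P = 0 := by
  simp only [transportDeriv, hw.derivatives_eq_zero hR hP, mul_zero, add_zero]

lemma IsC1TestFunction.hasDerivAt_comp_flowMap (hZ : IsMeanField B Z) (t : ℝ) (P : PhaseSpace) :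
    HasDerivAt (fun t => w t (flowMap Z 0 t P))
      (transportDeriv Z w_t w_θ t (flowMap Z 0 t P)) t := by
  obtain ⟨θ, y⟩ := P
  obtain ⟨θ, rfl⟩ := QuotientAddGroup.mk_surjective θ
  simpa only [transportDeriv, flowMap_coe hZ, fieldSpeed_coe] using
    hw.hasDerivAt_comp (isIntegralCurve_phaseFlow hZ 0 θ y t) y

lemma IsC1TestFunction.integral_map_flowMap (hT : 0 ≤ T) (hZ : IsMeanField B Z)
    (μ : Measure PhaseSpace) [IsProbabilityMeasure μ] :
    (∫ t in (0 : ℝ)..T, ∫ P, transportDeriv Z w_t w_θ t P ∂(μ.map (flowMap Z 0 t)))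
      + ∫ P, w 0 P ∂μ = 0 := by
  obtain ⟨τ, hτ, R, hsupport⟩ := hw.support
  have hR t (P : PhaseSpace) (hP : R ≤ |P.2.1|) : w t P = 0 := hsupport t P (Or.inr hP)
  have hcont := hw.continuous_transportDeriv hZ
  obtain ⟨C, hC⟩ := exists_forall_abs_le_of_eq_zero hcont (hw.transportDeriv_eq_zero hR Z) T
  obtain ⟨C₀, hC₀⟩ := exists_forall_abs_le_of_eq_zero hw.continuous hR T
  have hwT P : w T P = 0 := hsupport T P (Or.inl hτ.le)
  have hflow : Continuous fun q : ℝ × PhaseSpace => (q.1, flowMap Z 0 q.1 q.2) :=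
    continuous_fst.prodMk ((continuous_flowMap_uncurry hZ).comp
      (f := fun q : ℝ × PhaseSpace => ((0, q.1), q.2)) (by fun_prop))
  have hFTC := integral_sub_integral_eq (μ := μ) (hw.hasDerivAt_comp_flowMap hZ)
    (hcont.comp hflow) hT (fun t ht P => hC t ht _)
    (by
      simp only [flowMap_self]
      exact .of_bound (hw.continuous.comp (Continuous.prodMk_right 0)).aestronglyMeasurable C₀
        (Eventually.of_forall (hC₀ 0 (left_mem_Icc.2 hT))))
    (by
      simp only [hwT]
      exact integrable_zero _ _ _)
  simp only [hwT, integral_zero, flowMap_self, zero_sub] at hFTC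
  have hmap t : ∫ P, transportDeriv Z w_t w_θ t P ∂(μ.map (flowMap Z 0 t))
      = ∫ P, transportDeriv Z w_t w_θ t (flowMap Z 0 t P) ∂μ :=
    integral_map (continuous_flowMap hZ 0 t).aemeasurable
      (hcont.comp (Continuous.prodMk_right t)).aestronglyMeasurable
  rw [intervalIntegral.integral_congr fun t _ => hmap t, ← hFTC, neg_add_cancel]

end TransportDeriv

/-- The mean field of a density of no prescribed sign. -/
def densityField (W : unitInterval → unitInterval → ℝ) (K : ℝ) (ρ : PhaseSpace → ℝ)
    (x : unitInterval) : ℝ × ℝ :=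
  (K * ∫ Q : PhaseSpace, W x Q.2.2 * circCos Q.1 * ρ Q,
    K * ∫ Q : PhaseSpace, W x Q.2.2 * circSin Q.1 * ρ Q)

lemma velocity_eq_fieldSpeed (hW : IsGraphonBound A W) (K : ℝ) {ρ : PhaseSpace → ℝ}
    (hρ : Integrable ρ) (P : PhaseSpace) :
    velocity W K ρ P = fieldSpeed (densityField W K ρ P.2.2) P := by
  have hsin := hW.isObservable_sin P.2.2
  have hcos := hW.isObservable_cos P.2.2
  have hsin_int := hρ.bdd_mul hsin.continuous.aestronglyMeasurable
    (Eventually.of_forall hsin.abs_le)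
  have hcos_int := hρ.bdd_mul hcos.continuous.aestronglyMeasurable
    (Eventually.of_forall hcos.abs_le)
  have hsplit (Q : PhaseSpace) : W P.2.2 Q.2.2 * circSin (Q.1 - P.1) * ρ Q
      = circCos P.1 * (W P.2.2 Q.2.2 * circSin Q.1 * ρ Q)
        - circSin P.1 * (W P.2.2 Q.2.2 * circCos Q.1 * ρ Q) := by
    rw [circSin_sub]
    ring
  simp only [velocity, hsplit, fieldSpeed, densityField]
  rw [integral_sub (hsin_int.const_mul _) (hcos_int.const_mul _), integral_const_mul,
    integral_const_mul]
  ring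

lemma densityField_eq_meanField (W : unitInterval → unitInterval → ℝ) (K : ℝ) {ρ : PhaseSpace → ℝ}
    (hρ : Measurable ρ) (hρ0 : ∀ P, 0 ≤ ρ P) (x : unitInterval) :
    densityField W K ρ x = meanField W K (densityMeasure ρ) x := by
  simp only [densityField, meanField, integral_densityMeasure hρ hρ0, mul_comm (ρ _)]

section FlowDensity

variable {r : PhaseSpace → ℝ} (hr : Measurable r) (hr0 : ∀ P, 0 ≤ r P) (hZ : IsMeanField B Z)
include hr hr0 hZ

lemma integral_flowDensity_mul (t : ℝ) (f : PhaseSpace → ℝ) :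
    ∫ P, flowDensity Z r t P * f P = ∫ P, f P ∂((densityMeasure r).map (flowMap Z 0 t)) := by
  rw [← densityMeasure_flowDensity hZ hr hr0,
    integral_densityMeasure (measurable_flowDensity hZ hr t) (flowDensity_nonneg Z hr0 t)]

lemma densityField_flowDensity (W : unitInterval → unitInterval → ℝ) (K t : ℝ) (x : unitInterval) :
    densityField W K (flowDensity Z r t) x =
      meanField W K ((densityMeasure r).map (flowMap Z 0 t)) x := by
  rw [densityField_eq_meanField W K (measurable_flowDensity hZ hr t) (flowDensity_nonneg Z hr0 t),
    densityMeasure_flowDensity hZ hr hr0]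

variable [IsProbabilityMeasure (densityMeasure r)]

lemma isProbabilityMeasure_flowDensity (t : ℝ) :
    IsProbabilityMeasure (densityMeasure (flowDensity Z r t)) := by
  rw [densityMeasure_flowDensity hZ hr hr0]
  exact isProbabilityMeasure_map_flowMap hZ _ _ _

lemma integrable_flowDensity (t : ℝ) : Integrable (flowDensity Z r t) :=
  have := isProbabilityMeasure_flowDensity hr hr0 hZ t
  integrable_of_isFiniteMeasure_densityMeasure (measurable_flowDensity hZ hr t)
    (flowDensity_nonneg Z hr0 t)

lemma isWeakSolution_flowDensity (hW : IsGraphonBound A W) (hT : 0 ≤ T)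
    (hself : IsSelfConsistent W K T (densityMeasure r) Z) :
    IsWeakSolution W K T r (flowDensity Z r) where
  measurable := (measurable_flowDensity_uncurry hZ hr).aestronglyMeasurable
  integrable t _ := integrable_flowDensity hr hr0 hZ t
  weak_continuous f := by
    simp only [mul_comm (f _), integral_flowDensity_mul hr hr0 hZ]
    exact (continuous_integral_map_flowMap hZ _ f.continuous
      fun P => f.norm_coe_le_norm P).continuousOn
  weak_eq w hw := by
    refine Eq.trans ?_ (hw.isC1TestFunction.integral_map_flowMap hT hZ (densityMeasure r))
    rw [← integral_densityMeasure hr hr0, add_left_inj]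
    refine intervalIntegral.integral_congr fun t ht => ?_
    rw [uIcc_of_le hT] at ht
    simp only [transportDeriv, integral_flowDensity_mul hr hr0 hZ,
      velocity_eq_fieldSpeed hW K (integrable_flowDensity hr hr0 hZ t),
      densityField_flowDensity hr hr0 hZ, ← hself t ht]

end FlowDensity

/-! ### The mean field of a weak solution -/

lemma exists_forall_abs_integral_mul_le {ι X : Type*} [TopologicalSpace X] [MeasurableSpace X]
    [OpensMeasurableSpace X] {μ : Measure X} {ρ : ι → X → ℝ} (hρ : ∀ i, Integrable (ρ i) μ)
    (h : ∀ f : X →ᵇ ℝ, ∃ C, ∀ i, |∫ x, f x * ρ i x ∂μ| ≤ C) :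
    ∃ M, ∀ i (f : X →ᵇ ℝ), |∫ x, f x * ρ i x ∂μ| ≤ M * ‖f‖ := by
  have hint i (f : X →ᵇ ℝ) : Integrable (fun x => f x * ρ i x) μ :=
    (hρ i).bdd_mul f.continuous.aestronglyMeasurable (Eventually.of_forall f.norm_coe_le_norm)
  let Λ i : (X →ᵇ ℝ) →L[ℝ] ℝ := LinearMap.mkContinuous
    { toFun := fun f => ∫ x, f x * ρ i x ∂μ
      map_add' := fun f g => by
        simp only [BoundedContinuousFunction.add_apply, add_mul]
        exact integral_add (hint i f) (hint i g)
      map_smul' := fun a f => by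
        simp only [BoundedContinuousFunction.smul_apply, smul_eq_mul, mul_assoc,
          integral_const_mul, RingHom.id_apply] }
    (∫ x, |ρ i x| ∂μ) fun f => by
      rw [mul_comm, ← integral_const_mul]
      refine norm_integral_le_of_norm_le ((hρ i).abs.const_mul _) (Eventually.of_forall fun x => ?_)
      rw [norm_mul]
      exact mul_le_mul_of_nonneg_right (f.norm_coe_le_norm x) (norm_nonneg _)
  obtain ⟨M, hM⟩ := banach_steinhaus (g := Λ) h
  exact ⟨M, fun i f => (Λ i).le_of_opNorm_le (hM i) f⟩

/-- The densities `ρ t`, `t ∈ [0, T]`, are integrable, and `M` bounds the norms of the functionals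
`f ↦ ∫ f ρ t` on bounded continuous functions. -/
structure IsDensityBound (M T : ℝ) (ρ : ℝ → PhaseSpace → ℝ) : Prop where
  nonneg : 0 ≤ M
  integrable : ∀ t ∈ Icc 0 T, Integrable (ρ t)
  abs_integral_le : ∀ t ∈ Icc 0 T, ∀ f : PhaseSpace →ᵇ ℝ, |∫ P, f P * ρ t P| ≤ M * ‖f‖

section DensityBound

variable {M : ℝ} {r : PhaseSpace → ℝ} {ρ : ℝ → PhaseSpace → ℝ}

lemma IsWeakSolution.exists_isDensityBound (hρ : IsWeakSolution W K T r ρ) :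
    ∃ M, IsDensityBound M T ρ := by
  obtain ⟨M, hM⟩ := exists_forall_abs_integral_mul_le (ρ := fun t : Icc 0 T => ρ t)
    (fun t => hρ.integrable t t.2) fun f => by
      obtain ⟨C, hC⟩ := isCompact_Icc.exists_bound_of_continuousOn (hρ.weak_continuous f)
      exact ⟨C, fun t => hC t t.2⟩
  exact ⟨max M 0, le_max_right _ _, hρ.integrable, fun t ht f =>
    (hM ⟨t, ht⟩ f).trans (mul_le_mul_of_nonneg_right (le_max_left _ _) (norm_nonneg _))⟩

lemma IsDensityBound.abs_integral_mul_le (hM : IsDensityBound M T ρ) {t : ℝ}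
    (ht : t ∈ Icc 0 T) {f : PhaseSpace → ℝ} (hf : Continuous f) {a : ℝ} (ha : ∀ P, |f P| ≤ a) :
    |∫ P, f P * ρ t P| ≤ M * a := by
  have ha0 : 0 ≤ a := (abs_nonneg _).trans (ha (0, 0, 0))
  exact (hM.abs_integral_le t ht (.ofNormedAddCommGroup f hf a ha)).trans
    (mul_le_mul_of_nonneg_left
      (BoundedContinuousFunction.norm_ofNormedAddCommGroup_le hf ha0 ha) hM.nonneg)

lemma IsDensityBound.integrable_mul (hM : IsDensityBound M T ρ) {t : ℝ} (ht : t ∈ Icc 0 T)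
    {f : PhaseSpace → ℝ} (hf : Continuous f) {a : ℝ} (ha : ∀ P, |f P| ≤ a) :
    Integrable fun P => f P * ρ t P :=
  (hM.integrable t ht).bdd_mul hf.aestronglyMeasurable (Eventually.of_forall ha)

lemma IsWeakSolution.continuousOn_integral_mul (hρ : IsWeakSolution W K T r ρ) {f : PhaseSpace → ℝ}
    (hf : Continuous f) {a : ℝ} (ha : ∀ P, |f P| ≤ a) :
    ContinuousOn (fun t => ∫ P, f P * ρ t P) (Icc 0 T) :=
  hρ.weak_continuous (.ofNormedAddCommGroup f hf a ha)

/-- The mean field of the densities `ρ`, with the time stopped outside of `[0, T]`. -/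
def solutionField (W : unitInterval → unitInterval → ℝ) (K T : ℝ) (ρ : ℝ → PhaseSpace → ℝ) (t : ℝ)
    (x : unitInterval) : ℝ × ℝ :=
  densityField W K (ρ (stoppedTime T t)) x

lemma solutionField_of_mem_Icc (W : unitInterval → unitInterval → ℝ) (K : ℝ)
    (ρ : ℝ → PhaseSpace → ℝ) {t : ℝ} (ht : t ∈ Icc 0 T) (x : unitInterval) :
    solutionField W K T ρ t x = densityField W K (ρ t) x := by
  rw [solutionField, stoppedTime_of_mem_Icc ht]

lemma IsDensityBound.norm_densityField_sub_le (hM : IsDensityBound M T ρ)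
    (hW : IsGraphonBound A W) (K : ℝ) {t : ℝ} (ht : t ∈ Icc 0 T) (x y : unitInterval) :
    ‖densityField W K (ρ t) x - densityField W K (ρ t) y‖
      ≤ |K| * (M * (2 * A)) * |(x : ℝ) - y| := by
  have h_integral {c : Circ → ℝ} (hc : ∀ θ, |c θ| ≤ 1) (hc' : ∀ θ θ', |c θ - c θ'| ≤ dist θ θ') :
      |K * (∫ Q : PhaseSpace, W x Q.2.2 * c Q.1 * ρ t Q)
        - K * ∫ Q : PhaseSpace, W y Q.2.2 * c Q.1 * ρ t Q|
        ≤ |K| * (M * (2 * A)) * |(x : ℝ) - y| := by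
    have hx := hW.isObservable_mul hc hc' x
    have hy := hW.isObservable_mul hc hc' y
    rw [← mul_sub, ← integral_sub (hM.integrable_mul ht hx.continuous hx.abs_le)
      (hM.integrable_mul ht hy.continuous hy.abs_le), abs_mul, mul_assoc, mul_assoc M]
    simp only [← sub_mul]
    refine mul_le_mul_of_nonneg_left (hM.abs_integral_mul_le ht
      (by simpa only [sub_mul] using! hx.continuous.sub hy.continuous) fun Q => ?_) (abs_nonneg K)
    have h := hW.lipschitz x Q.2.2 y Q.2.2
    rw [sub_self, abs_zero, add_zero] at h
    rw [abs_mul]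
    nlinarith [hc Q.1, abs_nonneg (c Q.1), abs_nonneg (W x Q.2.2 - W y Q.2.2)]
  exact norm_prod_le_iff.2 ⟨h_integral abs_circCos_le_one abs_circCos_sub_le,
    h_integral abs_circSin_le_one abs_circSin_sub_le⟩

lemma IsWeakSolution.isMeanField_solutionField (hρ : IsWeakSolution W K T r ρ)
    (hM : IsDensityBound M T ρ) (hT : 0 ≤ T) (hW : IsGraphonBound A W) :
    IsMeanField (|K| * (M * (2 * A))) (solutionField W K T ρ) where
  continuous x := by
    have hcont {f : PhaseSpace → ℝ} (hf : IsObservable (2 * A) f) :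
        Continuous fun t => K * ∫ Q, f Q * ρ (stoppedTime T t) Q :=
      ((hρ.continuousOn_integral_mul hf.continuous hf.abs_le).comp_continuous
        (continuous_stoppedTime T) (stoppedTime_mem_Icc hT)).const_mul K
    exact (hcont (hW.isObservable_cos x)).prodMk (hcont (hW.isObservable_sin x))
  norm_le t x := by
    have hle {f : PhaseSpace → ℝ} (hf : IsObservable (2 * A) f) :
        |K * ∫ Q, f Q * ρ (stoppedTime T t) Q| ≤ |K| * (M * (2 * A)) := by
      rw [abs_mul]
      exact mul_le_mul_of_nonneg_left (hM.abs_integral_mul_le (stoppedTime_mem_Icc hT t)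
        hf.continuous hf.abs_le) (abs_nonneg K)
    exact norm_prod_le_iff.2 ⟨hle (hW.isObservable_cos x), hle (hW.isObservable_sin x)⟩
  lipschitz t x y := hM.norm_densityField_sub_le hW K (stoppedTime_mem_Icc hT t) x y

lemma eventually_forall_abs_sub_le_of_eq_zero {g : ℝ → PhaseSpace → ℝ}
    (hg : Continuous fun q : ℝ × PhaseSpace => g q.1 q.2) {R : ℝ}
    (hR : ∀ t (P : PhaseSpace), R ≤ |P.2.1| → g t P = 0) (s : ℝ) {ε : ℝ} (hε : 0 < ε) :
    ∀ᶠ t in 𝓝 s, ∀ P, |g t P - g s P| ≤ ε := by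
  have hcompact : IsCompact ((univ : Set Circ) ×ˢ Icc (-R) R ×ˢ (univ : Set unitInterval)) :=
    isCompact_univ.prod (isCompact_Icc.prod isCompact_univ)
  obtain ⟨v, hv, h⟩ := hcompact.mem_uniformity_of_prod (f := g) (s := univ) (q := s)
    hg.continuousOn (mem_univ s) (Metric.dist_mem_uniformity hε)
  rw [nhdsWithin_univ] at hv
  filter_upwards [hv] with t ht P
  rcases le_total R |P.2.1| with hP | hP
  · rw [hR t P hP, hR s P hP, sub_self, abs_zero]
    exact hε.le
  · exact (h t ht P ⟨mem_univ _, abs_le.1 hP, mem_univ _⟩).le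

lemma IsWeakSolution.continuousOn_integral_mul_of_eq_zero (hρ : IsWeakSolution W K T r ρ)
    (hM : IsDensityBound M T ρ) {g : ℝ → PhaseSpace → ℝ}
    (hg : Continuous fun q : ℝ × PhaseSpace => g q.1 q.2) {R : ℝ}
    (hR : ∀ t (P : PhaseSpace), R ≤ |P.2.1| → g t P = 0) :
    ContinuousOn (fun t => ∫ P, g t P * ρ t P) (Icc 0 T) := by
  intro s hs
  obtain ⟨C, hC⟩ := exists_forall_abs_le_of_eq_zero hg hR T
  have hgt t : Continuous (g t) := hg.comp (Continuous.prodMk_right t)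
  have hsplit : (fun t => (∫ P, (g t P - g s P) * ρ t P) + ∫ P, g s P * ρ t P)
      =ᶠ[𝓝[Icc 0 T] s] fun t => ∫ P, g t P * ρ t P := by
    filter_upwards [self_mem_nhdsWithin] with t ht
    simp only [sub_mul]
    rw [integral_sub (hM.integrable_mul ht (hgt t) (hC t ht))
      (hM.integrable_mul ht (hgt s) (hC s hs)), sub_add_cancel]
  have hdiff : Tendsto (fun t => ∫ P, (g t P - g s P) * ρ t P) (𝓝[Icc 0 T] s) (𝓝 0) := by
    have := hM.nonneg
    rw [Metric.tendsto_nhds]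
    intro ε hε
    filter_upwards [self_mem_nhdsWithin, mem_nhdsWithin_of_mem_nhds
      (eventually_forall_abs_sub_le_of_eq_zero hg hR s (ε := ε / (M + 1)) (by positivity))]
      with t ht hle
    rw [dist_zero_right]
    refine (hM.abs_integral_mul_le ht ((hgt t).sub (hgt s)) hle).trans_lt ?_
    rw [mul_div_assoc', div_lt_iff₀ (by positivity)]
    linarith
  simpa [ContinuousWithinAt] using
    (hdiff.add (hρ.continuousOn_integral_mul (hgt s) (hC s hs) s hs)).congr' hsplit

end DensityBound

/-! ### Mollification of test functions -/

lemma hasDerivAt_integral_mul_of_hasCompactSupport {E : Type*} [NormedAddCommGroup E]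
    [MeasurableSpace E] [BorelSpace E] {μ : Measure E} [IsFiniteMeasureOnCompacts μ] {φ : E → ℝ}
    (hφ : Continuous φ) (hφ_supp : HasCompactSupport φ) {G G' : ℝ → E → ℝ}
    (hG : Continuous fun q : ℝ × E => G q.1 q.2) (hG' : Continuous fun q : ℝ × E => G' q.1 q.2)
    (hderiv : ∀ s v, HasDerivAt (fun s => G s v) (G' s v) s) (s : ℝ) :
    HasDerivAt (fun s => ∫ v, φ v * G s v ∂μ) (∫ v, φ v * G' s v ∂μ) s := by
  have hint {g : ℝ → E → ℝ} (hg : Continuous fun q : ℝ × E => g q.1 q.2) (s : ℝ) :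
      Integrable (fun v => φ v * g s v) μ :=
    (hφ.mul (hg.comp (Continuous.prodMk_right s))).integrable_of_hasCompactSupport hφ_supp.mul_right
  obtain ⟨C, hC⟩ := ((isCompact_closedBall s 1).prod hφ_supp.isCompact).exists_bound_of_continuousOn
    hG'.continuousOn
  refine (hasDerivAt_integral_of_dominated_loc_of_deriv_le (bound := fun v => |φ v| * C)
    (Metric.closedBall_mem_nhds s one_pos)
    (Eventually.of_forall fun s => (hint hG s).aestronglyMeasurable) (hint hG s)
    (hint hG' s).aestronglyMeasurable (Eventually.of_forall fun v u hu => ?_)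
    ((hφ.integrable_of_hasCompactSupport hφ_supp).abs.mul_const C)
    (Eventually.of_forall fun v u _ => (hderiv u v).const_mul _)).2
  rw [norm_mul, norm_eq_abs]
  by_cases hv : v ∈ tsupport φ
  · exact mul_le_mul_of_nonneg_left (hC (u, v) ⟨hu, hv⟩) (abs_nonneg _)
  · simp [image_eq_zero_of_notMem_tsupport hv]

lemma abs_integral_normed_mul_sub_le {E : Type*} [NormedAddCommGroup E] [NormedSpace ℝ E]
    [FiniteDimensional ℝ E] [MeasurableSpace E] [BorelSpace E] {μ : Measure E}
    [IsLocallyFiniteMeasure μ] [μ.IsOpenPosMeasure] (φ : ContDiffBump (0 : E)) {G : E → ℝ}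
    (hG : Continuous G) {c ε : ℝ} (h : ∀ v, ‖v‖ < φ.rOut → |G v - c| ≤ ε) :
    |(∫ v, φ.normed μ v * G v ∂μ) - c| ≤ ε := by
  have hint : Integrable (fun v => φ.normed μ v * G v) μ :=
    (φ.continuous_normed.mul hG).integrable_of_hasCompactSupport
      φ.hasCompactSupport_normed.mul_right
  have hsub : (∫ v, φ.normed μ v * G v ∂μ) - c = ∫ v, φ.normed μ v * (G v - c) ∂μ := by
    simp only [mul_sub]
    rw [integral_sub hint (φ.integrable_normed.mul_const c), integral_mul_const, φ.integral_normed,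
      one_mul]
  have hle : ∀ v, ‖φ.normed μ v * (G v - c)‖ ≤ φ.normed μ v * ε := fun v => by
    rw [norm_mul, norm_of_nonneg (φ.nonneg_normed v)]
    by_cases hv : v ∈ Function.support (φ.normed μ)
    · rw [φ.support_normed_eq, mem_ball_zero_iff] at hv
      exact mul_le_mul_of_nonneg_left (h v hv) (φ.nonneg_normed v)
    · simp [Function.notMem_support.1 hv]
  rw [hsub]
  refine (norm_integral_le_of_norm_le (φ.integrable_normed.mul_const ε)
    (Eventually.of_forall hle)).trans_eq ?_
  rw [integral_mul_const, φ.integral_normed, one_mul]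

/-- The state `P`, moved by `-v` in the angle, the frequency and the site; the site is kept in
`[0, 1]` by projection. -/
def translate (v : ℝ × ℝ × ℝ) (P : PhaseSpace) : PhaseSpace :=
  (P.1 - v.1, P.2.1 - v.2.1, projIcc 0 1 zero_le_one (P.2.2 - v.2.2))

lemma continuous_translate : Continuous fun q : (ℝ × ℝ × ℝ) × PhaseSpace => translate q.1 q.2 := by
  have := AddCircle.continuous_mk' (2 * π)
  have : Continuous fun q : (ℝ × ℝ × ℝ) × PhaseSpace =>
      projIcc 0 1 zero_le_one ((q.2.2.2 : ℝ) - q.1.2.2) :=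
    continuous_projIcc.comp (by fun_prop)
  unfold translate
  fun_prop

lemma dist_translate_le (v : ℝ × ℝ × ℝ) (P : PhaseSpace) : dist (translate v P) P ≤ ‖v‖ := by
  have hangle : dist (P.1 - (v.1 : Circ)) P.1 ≤ |v.1| := by
    simpa using dist_coe_circ_le v.1 0
  have hsite : dist (projIcc (0 : ℝ) 1 zero_le_one (P.2.2 - v.2.2)) P.2.2 ≤ |v.2.2| := by
    have h := abs_projIcc_sub_projIcc (a := (0 : ℝ)) (b := 1) (c := P.2.2 - v.2.2) (d := P.2.2)
      zero_le_one
    rwa [projIcc_val, sub_sub_cancel_left, abs_neg] at h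
  have hfreq : dist (P.2.1 - v.2.1) P.2.1 ≤ |v.2.1| := by simp
  exact max_le_max hangle (max_le_max hfreq hsite)

/-- The convolution of the test function `g` with the bump `φ` in all its variables. -/
def mollify (φ : ContDiffBump (0 : ℝ × ℝ × ℝ × ℝ)) (g : ℝ → PhaseSpace → ℝ) (t : ℝ)
    (P : PhaseSpace) : ℝ :=
  ∫ v : ℝ × ℝ × ℝ × ℝ, φ.normed volume v * g (t - v.1) (translate v.2 P)

section Mollify

variable {g : ℝ → PhaseSpace → ℝ}

lemma exists_contDiff_eq_mollify (φ : ContDiffBump (0 : ℝ × ℝ × ℝ × ℝ))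
    (hg : Continuous fun q : ℝ × PhaseSpace => g q.1 q.2) :
    ∃ F : ℝ × ℝ × ℝ × ℝ → ℝ, ContDiff ℝ (⊤ : ℕ∞) F ∧ ∀ (t θ ω : ℝ) (x : unitInterval),
      mollify φ g t ((θ : Circ), ω, x) = F (t, θ, ω, (x : ℝ)) := by
  have hlift : Continuous fun q : ℝ × ℝ × ℝ × ℝ =>
      g q.1 ((q.2.1 : Circ), q.2.2.1, projIcc 0 1 zero_le_one q.2.2.2) := by
    have := AddCircle.continuous_mk' (2 * π)
    have : Continuous fun q : ℝ × ℝ × ℝ × ℝ => projIcc (0 : ℝ) 1 zero_le_one q.2.2.2 :=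
      continuous_projIcc.comp (by fun_prop)
    exact hg.comp (f := fun q : ℝ × ℝ × ℝ × ℝ => (q.1, ((q.2.1 : Circ), q.2.2.1,
      projIcc (0 : ℝ) 1 zero_le_one q.2.2.2))) (by fun_prop)
  have : (volume : Measure (ℝ × ℝ × ℝ)).IsAddHaarMeasure := Measure.prod.instIsAddHaarMeasure _ _
  have : (volume : Measure (ℝ × ℝ × ℝ × ℝ)).IsAddHaarMeasure :=
    Measure.prod.instIsAddHaarMeasure _ _
  exact ⟨_, φ.hasCompactSupport_normed.contDiff_convolution_left (ContinuousLinearMap.lsmul ℝ ℝ)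
    (φ.contDiff_normed (μ := volume)) hlift.locallyIntegrable, fun _ _ _ _ => rfl⟩

lemma mollify_eq_zero {φ : ContDiffBump (0 : ℝ × ℝ × ℝ × ℝ)} {t : ℝ} {P : PhaseSpace}
    (h : ∀ s Q, |s - t| < φ.rOut → |Q.2.1 - P.2.1| < φ.rOut → g s Q = 0) : mollify φ g t P = 0 := by
  refine integral_eq_zero_of_ae (Eventually.of_forall fun v => ?_)
  change φ.normed volume v * g (t - v.1) (translate v.2 P) = 0
  by_cases hv : v ∈ Function.support (φ.normed volume)
  · rw [φ.support_normed_eq, mem_ball_zero_iff] at hv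
    have htime : |v.1| < φ.rOut := (norm_fst_le v).trans_lt hv
    have hfreq : |v.2.2.1| < φ.rOut :=
      (norm_fst_le v.2.2).trans ((norm_snd_le v.2).trans (norm_snd_le v)) |>.trans_lt hv
    rw [h _ _ (by simpa using htime) (by simpa [translate] using hfreq), mul_zero]
  · rw [Function.notMem_support.1 hv, zero_mul]

lemma exists_forall_abs_mollify_sub_le
    (hg : Continuous fun q : ℝ × PhaseSpace => g q.1 q.2) {R : ℝ}
    (hR : ∀ t (P : PhaseSpace), R ≤ |P.2.1| → g t P = 0) (T : ℝ) {ε : ℝ} (hε : 0 < ε) :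
    ∃ δ > 0, ∀ φ : ContDiffBump (0 : ℝ × ℝ × ℝ × ℝ), φ.rOut ≤ δ →
      ∀ t ∈ Icc 0 T, ∀ P, |mollify φ g t P - g t P| ≤ ε := by
  have hcompact : IsCompact (Icc 0 T ×ˢ (univ : Set Circ) ×ˢ Icc (-(R + 1)) (R + 1) ×ˢ
      (univ : Set unitInterval)) :=
    isCompact_Icc.prod (isCompact_univ.prod (isCompact_Icc.prod isCompact_univ))
  obtain ⟨δ, hδ, hclose⟩ := Metric.mem_uniformity_dist.1
    (hcompact.uniformContinuousAt_of_continuousAt (fun q : ℝ × PhaseSpace => g q.1 q.2)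
      (fun q _ => hg.continuousAt) (Metric.dist_mem_uniformity hε))
  refine ⟨min δ 1, by positivity, fun φ hφ t ht P => ?_⟩
  rcases le_total (|P.2.1|) (R + 1) with hP | hP
  · refine abs_integral_normed_mul_sub_le φ (hg.comp (f := fun v : ℝ × ℝ × ℝ × ℝ =>
      (t - v.1, translate v.2 P)) ((continuous_const.sub continuous_fst).prodMk
        (continuous_translate.comp (continuous_snd.prodMk continuous_const)))) fun v hv => ?_
    have hdist : dist (t, P) (t - v.1, translate v.2 P) < δ := by
      rw [dist_comm]
      refine (max_le ?_ ?_).trans_lt (hv.trans_le (hφ.trans (min_le_left _ _)))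
      · simpa [dist_eq] using norm_fst_le v
      · exact (dist_translate_le v.2 P).trans (norm_snd_le v)
    have := hclose hdist ⟨ht, mem_univ _, abs_le.1 hP, mem_univ _⟩
    rw [abs_sub_comm]
    exact this.le
  · rw [hR t P (by linarith), mollify_eq_zero fun s Q _ hQ => hR s Q ?_, sub_self, abs_zero]
    · exact hε.le
    · have := abs_sub_abs_le_abs_sub P.2.1 Q.2.1
      rw [abs_sub_comm] at this
      linarith [hφ.trans (min_le_right _ _)]

lemma isTestFunction_mollify (hg : Continuous fun q : ℝ × PhaseSpace => g q.1 q.2)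
    (φ : ContDiffBump (0 : ℝ × ℝ × ℝ × ℝ)) {τ R : ℝ}
    (hsupport : ∀ t (P : PhaseSpace), τ ≤ t ∨ R ≤ |P.2.1| → g t P = 0) (hφ : φ.rOut < T - τ) :
    IsTestFunction T (mollify φ g) where
  smooth := exists_contDiff_eq_mollify φ hg
  support := by
    refine ⟨τ + φ.rOut, by linarith, R + φ.rOut, fun t θ ω x h => mollify_eq_zero
      fun s Q hs hQ => hsupport s Q ?_⟩
    refine h.imp (fun h => ?_) fun h => ?_
    · linarith [(abs_lt.1 hs).1]
    · have := abs_sub_abs_le_abs_sub ω Q.2.1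
      rw [abs_sub_comm] at this
      linarith

lemma exists_isTestFunction_abs_sub_le (hT : 0 < T) {f : PhaseSpace → ℝ} (hf : Continuous f)
    {R : ℝ} (hR : ∀ P : PhaseSpace, R ≤ |P.2.1| → f P = 0) {ε : ℝ} (hε : 0 < ε) :
    ∃ w, IsTestFunction T w ∧ ∀ P, |w 0 P - f P| ≤ ε := by
  let g : ℝ → PhaseSpace → ℝ := fun t P => max (1 - 2 * t / T) 0 * f P
  have hg : Continuous fun q : ℝ × PhaseSpace => g q.1 q.2 := by fun_prop
  have hsupport t (P : PhaseSpace) (h : T / 2 ≤ t ∨ R ≤ |P.2.1|) : g t P = 0 := by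
    rcases h with h | h
    · have : 1 - 2 * t / T ≤ 0 := by
        rw [sub_nonpos, le_div_iff₀ hT]
        linarith
      simp only [g, max_eq_right this, zero_mul]
    · simp only [g, hR P h, mul_zero]
  obtain ⟨δ, hδ, hclose⟩ :=
    exists_forall_abs_mollify_sub_le hg (fun t P hP => hsupport t P (Or.inr hP)) T hε
  obtain ⟨η, hη, hη_lt⟩ : ∃ η > 0, η < min δ (T / 2) := exists_between (by positivity)
  let φ : ContDiffBump (0 : ℝ × ℝ × ℝ × ℝ) := ⟨η / 2, η, half_pos hη, half_lt_self hη⟩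
  refine ⟨mollify φ g, isTestFunction_mollify hg φ hsupport ?_, fun P => ?_⟩
  · linarith [hη_lt.trans_le (min_le_right δ (T / 2)), show φ.rOut = η from rfl]
  · simpa [g] using hclose φ (hη_lt.le.trans (min_le_left _ _)) 0 ⟨le_rfl, hT.le⟩ P

end Mollify

section MollifyTestFunction

variable {w w_t w_θ : ℝ → PhaseSpace → ℝ} (hw : IsC1TestFunction T w w_t w_θ)
  (φ : ContDiffBump (0 : ℝ × ℝ × ℝ × ℝ))
include hw

lemma IsC1TestFunction.deriv_mollify (t : ℝ) (P : PhaseSpace) :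
    deriv (fun t => mollify φ w t P) t = mollify φ w_t t P := by
  have hcont {g : ℝ → PhaseSpace → ℝ} (hg : Continuous fun q : ℝ × PhaseSpace => g q.1 q.2) :
      Continuous fun q : ℝ × ℝ × ℝ × ℝ × ℝ => g (q.1 - q.2.1) (translate q.2.2 P) :=
    hg.comp (f := fun q : ℝ × ℝ × ℝ × ℝ × ℝ => (q.1 - q.2.1, translate q.2.2 P))
      ((by fun_prop : Continuous fun q : ℝ × ℝ × ℝ × ℝ × ℝ => q.1 - q.2.1).prodMk
        (continuous_translate.comp (f := fun q : ℝ × ℝ × ℝ × ℝ × ℝ => (q.2.2, P)) (by fun_prop)))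
  exact (hasDerivAt_integral_mul_of_hasCompactSupport φ.continuous_normed
    φ.hasCompactSupport_normed (hcont hw.continuous) (hcont hw.continuous_time)
    (fun s v => (hw.hasDerivAt_time (s - v.1) _).comp_sub_const s v.1) t).deriv

lemma IsC1TestFunction.derivTheta_mollify (t : ℝ) (P : PhaseSpace) :
    derivTheta (mollify φ w t) P = mollify φ w_θ t P := by
  obtain ⟨θ, y⟩ := P
  obtain ⟨θ, rfl⟩ := QuotientAddGroup.mk_surjective θ
  have hcont {g : ℝ → PhaseSpace → ℝ} (hg : Continuous fun q : ℝ × PhaseSpace => g q.1 q.2) :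
      Continuous fun q : ℝ × ℝ × ℝ × ℝ × ℝ =>
        g (t - q.2.1) (translate q.2.2 ((q.1 : Circ), y)) := by
    have := AddCircle.continuous_mk' (2 * π)
    exact hg.comp
      (f := fun q : ℝ × ℝ × ℝ × ℝ × ℝ => (t - q.2.1, translate q.2.2 ((q.1 : Circ), y)))
      ((by fun_prop : Continuous fun q : ℝ × ℝ × ℝ × ℝ × ℝ => t - q.2.1).prodMk
        (continuous_translate.comp (f := fun q : ℝ × ℝ × ℝ × ℝ × ℝ => (q.2.2, ((q.1 : Circ), y)))
          (by fun_prop)))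
  have hderiv (s : ℝ) (v : ℝ × ℝ × ℝ × ℝ) :
      HasDerivAt (fun s : ℝ => w (t - v.1) (translate v.2 ((s : Circ), y)))
        (w_θ (t - v.1) (translate v.2 ((s : Circ), y))) s :=
    (hw.hasDerivAt_angle (t - v.1) (s - v.2.1) (translate v.2 ((s : Circ), y)).2).comp_sub_const s
      v.2.1
  exact (derivTheta_coe _ _ _).trans (hasDerivAt_integral_mul_of_hasCompactSupport
    φ.continuous_normed φ.hasCompactSupport_normed (hcont hw.continuous) (hcont hw.continuous_angle)
    hderiv θ).deriv

lemma IsC1TestFunction.exists_isTestFunction {τ R : ℝ} (hτ : τ < T)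
    (hsupport : ∀ t (P : PhaseSpace), τ ≤ t ∨ R ≤ |P.2.1| → w t P = 0) {ε : ℝ} (hε : 0 < ε) :
    ∃ w', IsTestFunction T w' ∧ (∀ t (P : PhaseSpace), R + 1 ≤ |P.2.1| → w' t P = 0) ∧
      ∀ t ∈ Icc 0 T, ∀ P, |w' t P - w t P| ≤ ε ∧ |deriv (fun t => w' t P) t - w_t t P| ≤ ε ∧
        |derivTheta (w' t) P - w_θ t P| ≤ ε := by
  have hR t (P : PhaseSpace) (hP : R ≤ |P.2.1|) : w t P = 0 := hsupport t P (Or.inr hP)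
  obtain ⟨δ, hδ, h⟩ := exists_forall_abs_mollify_sub_le hw.continuous hR T hε
  obtain ⟨δ_t, hδ_t, h_t⟩ := exists_forall_abs_mollify_sub_le hw.continuous_time
    (fun _ _ hP => (hw.derivatives_eq_zero hR hP).1) T hε
  obtain ⟨δ_θ, hδ_θ, h_θ⟩ := exists_forall_abs_mollify_sub_le hw.continuous_angle
    (fun _ _ hP => (hw.derivatives_eq_zero hR hP).2) T hε
  obtain ⟨η, hη, hη_lt⟩ : ∃ η > 0, η < min (min δ (min δ_t δ_θ)) (min (T - τ) 1) := by
    have := sub_pos.2 hτ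
    exact exists_between (by positivity)
  simp only [lt_min_iff] at hη_lt
  obtain ⟨⟨hδη, hδ_tη, hδ_θη⟩, hτη, hη1⟩ := hη_lt
  let φ : ContDiffBump (0 : ℝ × ℝ × ℝ × ℝ) := ⟨η / 2, η, half_pos hη, half_lt_self hη⟩
  refine ⟨mollify φ w, isTestFunction_mollify hw.continuous φ hsupport hτη, fun t P hP =>
    mollify_eq_zero fun s Q _ hQ => hR s Q ?_, fun t ht P => ⟨h φ hδη.le t ht P, ?_, ?_⟩⟩
  · have := abs_sub_abs_le_abs_sub P.2.1 Q.2.1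
    rw [abs_sub_comm] at this
    linarith [hQ.trans (show φ.rOut < 1 from hη1)]
  · rw [hw.deriv_mollify]
    exact h_t φ hδ_tη.le t ht P
  · rw [hw.derivTheta_mollify]
    exact h_θ φ hδ_θη.le t ht P

end MollifyTestFunction

/-! ### Uniqueness of the weak solution by duality -/

lemma abs_fieldSpeed_le {z : ℝ × ℝ} (hz : ‖z‖ ≤ B) (P : PhaseSpace) :
    |fieldSpeed z P| ≤ |P.2.1| + 2 * B := by
  have hmul {a b : ℝ} (ha : |a| ≤ B) (hb : |b| ≤ 1) : |a * b| ≤ B := by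
    rw [abs_mul]
    exact (mul_le_of_le_one_right (abs_nonneg a) hb).trans ha
  have hcos := hmul ((norm_snd_le z).trans hz) (abs_circCos_le_one P.1)
  have hsin := hmul ((norm_fst_le z).trans hz) (abs_circSin_le_one P.1)
  have hsub := abs_sub (P.2.1 + z.2 * circCos P.1) (z.1 * circSin P.1)
  have hadd := abs_add_le P.2.1 (z.2 * circCos P.1)
  unfold fieldSpeed
  linarith

lemma abs_transportDeriv_sub_le (hZ : IsMeanField B Z) {w_t w_θ w_t' w_θ' : ℝ → PhaseSpace → ℝ}
    {t R ε : ℝ} {P : PhaseSpace} (hP : |P.2.1| ≤ R) (htime : |w_t t P - w_t' t P| ≤ ε)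
    (hangle : |w_θ t P - w_θ' t P| ≤ ε) :
    |transportDeriv Z w_t w_θ t P - transportDeriv Z w_t' w_θ' t P| ≤ ε * (1 + (R + 2 * B)) := by
  have hspeed : |fieldSpeed (Z t P.2.2) P| ≤ R + 2 * B :=
    (abs_fieldSpeed_le (hZ.norm_le t P.2.2) P).trans (by linarith)
  have hmul := mul_le_mul hspeed hangle (abs_nonneg _) ((abs_nonneg _).trans hspeed)
  rw [← abs_mul] at hmul
  calc |transportDeriv Z w_t w_θ t P - transportDeriv Z w_t' w_θ' t P|
      = |(w_t t P - w_t' t P) + fieldSpeed (Z t P.2.2) P * (w_θ t P - w_θ' t P)| := by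
        unfold transportDeriv
        ring_nf
    _ ≤ ε + (R + 2 * B) * ε := (abs_add_le _ _).trans (add_le_add htime hmul)
    _ = ε * (1 + (R + 2 * B)) := by ring

/-- The left-hand side of the weak formulation of the transport equation in the mean field `Z`,
for the densities `ρ` with the initial density `r`, at the test function `w` with the partial
derivatives `w_t` and `w_θ`. -/
def weakForm (T : ℝ) (Z : ℝ → unitInterval → ℝ × ℝ) (r : PhaseSpace → ℝ) (ρ : ℝ → PhaseSpace → ℝ)
    (w w_t w_θ : ℝ → PhaseSpace → ℝ) : ℝ :=
  (∫ t in (0 : ℝ)..T, ∫ P, transportDeriv Z w_t w_θ t P * ρ t P) + ∫ P, w 0 P * r P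

lemma IsWeakSolution.weakForm_eq_zero_of_isTestFunction {r : PhaseSpace → ℝ}
    {ρ w : ℝ → PhaseSpace → ℝ} (hρ : IsWeakSolution W K T r ρ) (hT : 0 ≤ T)
    (hW : IsGraphonBound A W) (hw : IsTestFunction T w) :
    weakForm T (solutionField W K T ρ) r ρ w (fun t P => deriv (fun s => w s P) t)
      (fun t => derivTheta (w t)) = 0 := by
  refine Eq.trans ?_ (hρ.weak_eq w hw)
  simp only [weakForm, mul_comm (r _), add_left_inj]
  refine intervalIntegral.integral_congr fun t ht => ?_
  rw [uIcc_of_le hT] at ht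
  simp only [transportDeriv, mul_comm (ρ t _), solutionField_of_mem_Icc W K ρ ht,
    velocity_eq_fieldSpeed hW K (hρ.integrable t ht)]

section WeakForm

variable {M : ℝ} {r : PhaseSpace → ℝ} {ρ : ℝ → PhaseSpace → ℝ}
  {w w_t w_θ w' w_t' w_θ' : ℝ → PhaseSpace → ℝ}

lemma IsC1TestFunction.integrable_initial_mul (hw : IsC1TestFunction T w w_t w_θ) (hT : 0 ≤ T)
    {h : PhaseSpace → ℝ} (hh : Integrable h) : Integrable fun P => w 0 P * h P := by
  obtain ⟨τ, -, R, hsupport⟩ := hw.support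
  obtain ⟨C, hC⟩ :=
    exists_forall_abs_le_of_eq_zero hw.continuous (fun t P hP => hsupport t P (Or.inr hP)) T
  exact hh.bdd_mul (hw.continuous.comp (Continuous.prodMk_right 0)).aestronglyMeasurable
    (Eventually.of_forall (hC 0 ⟨le_rfl, hT⟩))

lemma IsWeakSolution.integrable_weakForm (hρ : IsWeakSolution W K T r ρ)
    (hM : IsDensityBound M T ρ) (hr : Integrable r) (hT : 0 ≤ T) (hZ : IsMeanField B Z)
    (hw : IsC1TestFunction T w w_t w_θ) :
    IntervalIntegrable (fun t => ∫ P, transportDeriv Z w_t w_θ t P * ρ t P) volume 0 T ∧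
      (∀ t ∈ Icc 0 T, Integrable fun P => transportDeriv Z w_t w_θ t P * ρ t P) ∧
      Integrable fun P => w 0 P * r P := by
  obtain ⟨τ, -, R, hsupport⟩ := hw.support
  have hcont := hw.continuous_transportDeriv hZ
  have hzero := hw.transportDeriv_eq_zero (fun t P hP => hsupport t P (Or.inr hP)) Z
  obtain ⟨C, hC⟩ := exists_forall_abs_le_of_eq_zero hcont hzero T
  exact ⟨(hρ.continuousOn_integral_mul_of_eq_zero hM hcont hzero).intervalIntegrable_of_Icc hT,
    fun t ht => hM.integrable_mul ht (hcont.comp (Continuous.prodMk_right t)) (hC t ht),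
    hw.integrable_initial_mul hT hr⟩

lemma IsWeakSolution.abs_weakForm_sub_le (hρ : IsWeakSolution W K T r ρ)
    (hM : IsDensityBound M T ρ) (hr : Integrable r) (hT : 0 ≤ T) (hZ : IsMeanField B Z)
    (hw : IsC1TestFunction T w w_t w_θ) (hw' : IsC1TestFunction T w' w_t' w_θ') {R ε : ℝ}
    (hR : ∀ t (P : PhaseSpace), R ≤ |P.2.1| → w t P = 0)
    (hR' : ∀ t (P : PhaseSpace), R ≤ |P.2.1| → w' t P = 0)
    (hε : ∀ t ∈ Icc 0 T, ∀ P, |w t P - w' t P| ≤ ε ∧ |w_t t P - w_t' t P| ≤ ε ∧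
      |w_θ t P - w_θ' t P| ≤ ε) :
    |weakForm T Z r ρ w w_t w_θ - weakForm T Z r ρ w' w_t' w_θ'|
      ≤ ε * (M * (1 + (|R| + 2 * B)) * T + ∫ P, |r P|) := by
  have hB := hZ.nonneg
  have h0 : (0 : ℝ) ∈ Icc 0 T := ⟨le_rfl, hT⟩
  have hε0 : 0 ≤ ε := (abs_nonneg _).trans (hε 0 h0 (0, 0, 0)).1
  obtain ⟨htime, hspace, hinit⟩ := hρ.integrable_weakForm hM hr hT hZ hw
  obtain ⟨htime', hspace', hinit'⟩ := hρ.integrable_weakForm hM hr hT hZ hw'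
  rw [weakForm, weakForm, add_sub_add_comm, ← intervalIntegral.integral_sub htime htime',
    ← integral_sub hinit hinit', mul_add]
  refine (abs_add_le _ _).trans (add_le_add ?_ ?_)
  · rw [← norm_eq_abs]
    refine (intervalIntegral.norm_integral_le_of_norm_le_const
      (C := M * (ε * (1 + (|R| + 2 * B)))) fun t ht => ?_).trans_eq ?_
    · rw [uIoc_of_le hT] at ht
      have ht := Ioc_subset_Icc_self ht
      rw [← integral_sub (hspace t ht) (hspace' t ht)]
      have hcont : Continuous fun P =>
          transportDeriv Z w_t w_θ t P - transportDeriv Z w_t' w_θ' t P :=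
        ((hw.continuous_transportDeriv hZ).comp (Continuous.prodMk_right t)).sub
          ((hw'.continuous_transportDeriv hZ).comp (Continuous.prodMk_right t))
      simp only [← sub_mul]
      refine hM.abs_integral_mul_le ht hcont fun P => ?_
      rcases le_total R |P.2.1| with hP | hP
      · rw [hw.transportDeriv_eq_zero hR Z t P hP, hw'.transportDeriv_eq_zero hR' Z t P hP,
          sub_self, abs_zero]
        positivity
      · exact abs_transportDeriv_sub_le hZ (hP.trans (le_abs_self R)) (hε t ht P).2.1
          (hε t ht P).2.2
    · rw [sub_zero, abs_of_nonneg hT]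
      ring
  · rw [← integral_const_mul, ← norm_eq_abs]
    refine norm_integral_le_of_norm_le (hr.abs.const_mul ε) (Eventually.of_forall fun P => ?_)
    rw [← sub_mul, norm_mul]
    exact mul_le_mul_of_nonneg_right (hε 0 h0 P).1 (abs_nonneg _)

lemma IsWeakSolution.weakForm_eq_zero (hρ : IsWeakSolution W K T r ρ)
    (hr : Integrable r) (hT : 0 ≤ T) (hW : IsGraphonBound A W)
    (hw : IsC1TestFunction T w w_t w_θ) :
    weakForm T (solutionField W K T ρ) r ρ w w_t w_θ = 0 := by
  obtain ⟨M, hM⟩ := hρ.exists_isDensityBound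
  have hZ := hρ.isMeanField_solutionField hM hT hW
  obtain ⟨τ, hτ, R, hsupport⟩ := hw.support
  set c := M * (1 + (|R + 1| + 2 * (|K| * (M * (2 * A))))) * T + ∫ P, |r P|
  have hc : 0 ≤ c := by
    have := hM.nonneg
    have := hZ.nonneg
    have : 0 ≤ ∫ P, |r P| := integral_nonneg fun P => abs_nonneg _
    positivity
  refine abs_nonpos_iff.1 (le_of_forall_pos_le_add fun ε hε => ?_)
  obtain ⟨w', hw', hR', hclose⟩ :=
    hw.exists_isTestFunction hτ hsupport (ε := ε / (c + 1)) (by positivity)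
  have h := hρ.abs_weakForm_sub_le hM hr hT hZ hw'.isC1TestFunction hw hR'
    (fun t P hP => hsupport t P (Or.inr (by linarith))) hclose
  rw [hρ.weakForm_eq_zero_of_isTestFunction hT hW hw', zero_sub, abs_neg] at h
  rw [zero_add]
  refine h.trans ?_
  rw [div_mul_eq_mul_div, div_le_iff₀ (by positivity)]
  nlinarith

end WeakForm

lemma eqOn_Icc_of_forall_integral_mul_eq {G : ℝ → ℝ} {a b c : ℝ} (hab : a < b)
    (hG : ContinuousOn G (Icc a b))
    (h : ∀ χ : ℝ → ℝ, Continuous χ → HasCompactSupport χ → tsupport χ ⊆ Ioo a b →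
      ∫ t in a..b, χ t * G t = (∫ t in a..b, χ t) * c) :
    EqOn G (fun _ => c) (Icc a b) := by
  refine Measure.eqOn_Icc_of_ae_eq volume hab.ne ?_ hG continuousOn_const
  rw [← restrict_Ioo_eq_restrict_Icc]
  refine (ae_restrict_iff' measurableSet_Ioo).2 ?_
  have hsub : ContinuousOn (fun t => G t - c) (Icc a b) := hG.sub continuousOn_const
  have hae := isOpen_Ioo.ae_eq_zero_of_integral_contDiff_smul_eq_zero (μ := volume)
    ((hsub.integrableOn_Icc.mono_set Ioo_subset_Icc_self).locallyIntegrableOn)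
    fun χ hχ hχ_compact hχ_subset => ?_
  · filter_upwards [hae] with t ht htmem using sub_eq_zero.1 (ht htmem)
  have hzero : ∀ t ∉ Ioc a b, χ t • (G t - c) = 0 := fun t ht => by
    rw [image_eq_zero_of_notMem_tsupport fun hmem => ht (Ioo_subset_Ioc_self (hχ_subset hmem)),
      zero_smul]
  rw [← setIntegral_eq_integral_of_forall_compl_eq_zero hzero,
    ← intervalIntegral.integral_of_le hab.le]
  have hχG : IntervalIntegrable (fun t => χ t * G t) volume a b :=
    (hχ.continuous.continuousOn.mul hG).intervalIntegrable_of_Icc hab.le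
  simp only [smul_eq_mul, mul_sub]
  rw [intervalIntegral.integral_sub hχG ((hχ.continuous.mul_const c).intervalIntegrable a b),
    h χ hχ.continuous hχ_compact hχ_subset, intervalIntegral.integral_mul_const, sub_self]

lemma exists_lt_forall_eq_zero_of_tsupport_subset_Ioo {χ : ℝ → ℝ} {a b : ℝ} (hab : a < b)
    (hχ : HasCompactSupport χ) (h : tsupport χ ⊆ Ioo a b) : ∃ τ < b, ∀ t, τ ≤ t → χ t = 0 := by
  rcases (tsupport χ).eq_empty_or_nonempty with hempty | hne
  · exact ⟨a, hab, fun t _ => image_eq_zero_of_notMem_tsupport (by simp [hempty])⟩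
  · obtain ⟨σ, hσ, hmax⟩ := hχ.isCompact.exists_isGreatest hne
    obtain ⟨τ, hστ, hτb⟩ := exists_between (h hσ).2
    exact ⟨τ, hτb, fun t ht => image_eq_zero_of_notMem_tsupport fun hmem =>
      (hστ.trans_le ht).not_ge (hmax hmem)⟩

section Duality

variable {f f_θ : PhaseSpace → ℝ} {R : ℝ}

lemma isC1TestFunction_mul_comp_flowMap (hZ : IsMeanField B Z) (hf : Continuous f)
    (hf_θ : Continuous f_θ)
    (hderiv : ∀ (θ : ℝ) y, HasDerivAt (fun θ : ℝ => f ((θ : Circ), y)) (f_θ ((θ : Circ), y)) θ)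
    (hR : ∀ P : PhaseSpace, R ≤ |P.2.1| → f P = 0) {χ ψ : ℝ → ℝ} (hχ : Continuous χ)
    (hψ : ∀ t, HasDerivAt ψ (χ t) t) {τ : ℝ} (hτ : τ < T) (hψτ : ∀ t, τ ≤ t → ψ t = 0) (s : ℝ) :
    IsC1TestFunction T (fun t P => ψ t * f (flowMap Z t s P))
      (fun t P => χ t * f (flowMap Z t s P) -
        fieldSpeed (Z t P.2.2) P * (ψ t * (f_θ (flowMap Z t s P) * flowJac Z t s P)))
      (fun t P => ψ t * (f_θ (flowMap Z t s P) * flowJac Z t s P)) := by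
  have hψc : Continuous ψ := continuous_iff_continuousAt.2 fun t => (hψ t).continuousAt
  have hpair : Continuous fun q : ℝ × PhaseSpace => ((q.1, s), q.2) := by fun_prop
  have hflow : Continuous fun q : ℝ × PhaseSpace => flowMap Z q.1 s q.2 :=
    (continuous_flowMap_uncurry hZ).comp hpair
  have hjac : Continuous fun q : ℝ × PhaseSpace => flowJac Z q.1 s q.2 :=
    (continuous_flowJac_uncurry hZ).comp hpair
  have hangle : Continuous fun q : ℝ × PhaseSpace =>
      ψ q.1 * (f_θ (flowMap Z q.1 s q.2) * flowJac Z q.1 s q.2) := by fun_prop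
  refine ⟨by fun_prop, ?_, hangle, ?_, fun t θ y => ?_, τ, hτ, R, ?_⟩
  · exact ((hχ.comp continuous_fst).mul (hf.comp hflow)).sub
      ((continuous_fieldSpeed hZ).mul hangle)
  · rintro t ⟨θ, y⟩
    rw [← coe_circRep θ]
    have hcomp := (hψ t).mul
      ((hderiv _ y).comp t (hasDerivAt_phaseFlow_initial hZ t s (circRep θ) y))
    simp only [flowMap_coe hZ, flowJac_coe hZ, fieldSpeed_coe]
    exact hcomp.congr_deriv (by simp only [Function.comp_apply]; ring)
  · simp only [flowMap_coe hZ, flowJac_coe hZ]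
    exact ((hderiv _ y).comp θ (hasDerivAt_phaseFlow hZ t s θ y)).const_mul (ψ t)
  · rintro t P (ht | hP)
    · rw [hψτ t ht, zero_mul]
    · rw [hR (flowMap Z t s P) hP, mul_zero]

lemma transportDeriv_mul_comp_flowMap (Z : ℝ → unitInterval → ℝ × ℝ) (f f_θ : PhaseSpace → ℝ)
    (χ ψ : ℝ → ℝ) (s : ℝ) :
    transportDeriv Z (fun t P => χ t * f (flowMap Z t s P) -
        fieldSpeed (Z t P.2.2) P * (ψ t * (f_θ (flowMap Z t s P) * flowJac Z t s P)))
      (fun t P => ψ t * (f_θ (flowMap Z t s P) * flowJac Z t s P))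
      = fun t P => χ t * f (flowMap Z t s P) := by
  funext t P
  rw [transportDeriv, sub_add_cancel]

variable {r : PhaseSpace → ℝ} {ρ : ℝ → PhaseSpace → ℝ}

lemma IsWeakSolution.integral_comp_flowMap_mul_eq (hρ : IsWeakSolution W K T r ρ)
    (hr : Integrable r) (hT : 0 < T) (hW : IsGraphonBound A W)
    (hZ : IsMeanField B (solutionField W K T ρ)) (hf : Continuous f) (hf_θ : Continuous f_θ)
    (hderiv : ∀ (θ : ℝ) y, HasDerivAt (fun θ : ℝ => f ((θ : Circ), y)) (f_θ ((θ : Circ), y)) θ)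
    (hR : ∀ P : PhaseSpace, R ≤ |P.2.1| → f P = 0) (s : ℝ) {t : ℝ} (ht : t ∈ Icc 0 T) :
    ∫ P, f (flowMap (solutionField W K T ρ) t s P) * ρ t P
      = ∫ P, f (flowMap (solutionField W K T ρ) 0 s P) * r P := by
  set Y := solutionField W K T ρ with hY
  obtain ⟨M, hM⟩ := hρ.exists_isDensityBound
  have hcont : Continuous fun q : ℝ × PhaseSpace => f (flowMap Y q.1 s q.2) :=
    hf.comp ((continuous_flowMap_uncurry hZ).comp
      (by fun_prop : Continuous fun q : ℝ × PhaseSpace => ((q.1, s), q.2)))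
  refine eqOn_Icc_of_forall_integral_mul_eq hT
    (hρ.continuousOn_integral_mul_of_eq_zero (R := R) hM hcont
      fun t P hP => hR (flowMap Y t s P) hP) (fun χ hχ hχ_compact hχ_subset => ?_) ht
  obtain ⟨τ, hτ, hχτ⟩ := exists_lt_forall_eq_zero_of_tsupport_subset_Ioo hT hχ_compact hχ_subset
  set ψ : ℝ → ℝ := fun t => ∫ u in T..t, χ u
  have hψ0 : ψ 0 = -∫ t in (0 : ℝ)..T, χ t := intervalIntegral.integral_symm 0 T
  have hψ_deriv : ∀ t, HasDerivAt ψ (χ t) t := fun t =>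
    (hχ.integral_hasStrictDerivAt T t).hasDerivAt
  have hψτ : ∀ t, τ ≤ t → ψ t = 0 := fun t ht =>
    intervalIntegral.integral_zero_ae (Eventually.of_forall fun u hu =>
      hχτ u ((le_min hτ.le ht).trans hu.1.le))
  have hzero := hρ.weakForm_eq_zero hr hT.le hW
    (isC1TestFunction_mul_comp_flowMap hZ hf hf_θ hderiv hR hχ hψ_deriv hτ hψτ s)
  rw [weakForm, ← hY, transportDeriv_mul_comp_flowMap] at hzero
  simp only [mul_assoc, integral_const_mul] at hzero
  rw [eq_neg_of_add_eq_zero_left hzero, hψ0, neg_mul, neg_neg]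

lemma IsWeakSolution.integral_mul_eq_flowDensity (hρ : IsWeakSolution W K T r ρ)
    (hr : Measurable r) (hr0 : ∀ P, 0 ≤ r P) [IsProbabilityMeasure (densityMeasure r)]
    (hT : 0 < T) (hW : IsGraphonBound A W) (hZ : IsMeanField B (solutionField W K T ρ))
    {w : ℝ → PhaseSpace → ℝ} (hw : IsTestFunction T w) {t : ℝ} (ht : t ∈ Icc 0 T) :
    ∫ P, w 0 P * ρ t P = ∫ P, w 0 P * flowDensity (solutionField W K T ρ) r t P := by
  have hw := hw.isC1TestFunction
  obtain ⟨τ, -, R, hsupport⟩ := hw.support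
  have hcont : Continuous (w 0) := hw.continuous.comp (Continuous.prodMk_right 0)
  set Y := solutionField W K T ρ
  have hflow := hρ.integral_comp_flowMap_mul_eq
    (integrable_of_isFiniteMeasure_densityMeasure hr hr0) hT hW hZ hcont
    (hw.continuous_angle.comp (Continuous.prodMk_right 0)) (hw.hasDerivAt_angle 0)
    (fun P hP => hsupport 0 P (Or.inr hP)) t ht
  calc ∫ P, w 0 P * ρ t P = ∫ P, w 0 (flowMap Y 0 t P) * r P := by
        simpa only [flowMap_self] using hflow
    _ = ∫ P, w 0 (flowMap Y 0 t P) ∂densityMeasure r := by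
        simp only [integral_densityMeasure hr hr0, mul_comm]
    _ = ∫ P, w 0 P ∂((densityMeasure r).map (flowMap Y 0 t)) :=
        (integral_map (continuous_flowMap hZ 0 t).aemeasurable hcont.aestronglyMeasurable).symm
    _ = ∫ P, w 0 P * flowDensity Y r t P := by
        simp only [← integral_flowDensity_mul hr hr0 hZ, mul_comm]

end Duality

lemma ae_eq_zero_of_forall_integral_mul_eq_zero {X : Type*} [MetricSpace X] [LocallyCompactSpace X]
    [SigmaCompactSpace X] [MeasurableSpace X] [BorelSpace X] {μ : Measure X} {h : X → ℝ}
    (hh : Integrable h μ)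
    (hzero : ∀ f : X → ℝ, Continuous f → HasCompactSupport f → ∫ x, f x * h x ∂μ = 0) :
    h =ᵐ[μ] 0 := by
  refine ae_eq_zero_of_forall_setIntegral_isCompact_eq_zero hh fun s hs => ?_
  obtain ⟨δ, hδ, hδ_compact⟩ := hs.exists_isCompact_cthickening
  have hu_pos (n : ℕ) : 0 < δ / (n + 1) := by positivity
  have hu_le (n : ℕ) : δ / (n + 1) ≤ δ := div_le_self hδ.le (by simp)
  have hu_lim : Tendsto (fun n : ℕ => δ / ((n : ℝ) + 1)) atTop (𝓝 0) :=
    tendsto_const_nhds.div_atTop (tendsto_atTop_add_const_right _ _ tendsto_natCast_atTop_atTop)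
  let f (n : ℕ) (x : X) : ℝ := thickenedIndicator (hu_pos n) s x
  have hf (n : ℕ) : Continuous (f n) :=
    NNReal.continuous_coe.comp (thickenedIndicator (hu_pos n) s).continuous
  have hf_compact (n : ℕ) : HasCompactSupport (f n) :=
    .intro hδ_compact fun x hx => by
      rw [NNReal.coe_eq_zero]
      exact thickenedIndicator_zero (hu_pos n) s fun hmem =>
        hx (Metric.thickening_subset_cthickening_of_le (hu_le n) s hmem)
  have hlim : Tendsto (fun n => ∫ x, f n x * h x ∂μ) atTop (𝓝 (∫ x, s.indicator h x ∂μ)) := by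
    refine tendsto_integral_of_dominated_convergence (fun x => |h x|)
      (fun n => (hf n).aestronglyMeasurable.mul hh.aestronglyMeasurable) hh.abs
      (fun n => Eventually.of_forall fun x => ?_) (Eventually.of_forall fun x => ?_)
    · rw [norm_mul, NNReal.norm_eq]
      exact mul_le_of_le_one_left (abs_nonneg _) (thickenedIndicator_le_one (hu_pos n) s x)
    · have hx := (tendsto_pi_nhds.1
        (thickenedIndicator_tendsto_indicator_closure hu_pos hu_lim s)) x
      rw [hs.isClosed.closure_eq] at hx
      convert ((NNReal.tendsto_coe.2 hx).mul_const (h x)) using 2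
      by_cases hxs : x ∈ s <;> simp [hxs]
  rw [← integral_indicator hs.measurableSet]
  exact tendsto_nhds_unique hlim (by simp only [hzero _ (hf _) (hf_compact _), tendsto_const_nhds])

lemma ae_eq_zero_of_forall_isTestFunction (hT : 0 < T) {h : PhaseSpace → ℝ} (hh : Integrable h)
    (hzero : ∀ w, IsTestFunction T w → ∫ P, w 0 P * h P = 0) : h =ᵐ[volume] 0 := by
  refine ae_eq_zero_of_forall_integral_mul_eq_zero hh fun f hf hf_compact => ?_
  obtain ⟨C, hC⟩ := hf_compact.exists_bound_of_continuous hf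
  obtain ⟨R, hR⟩ : ∃ R, ∀ P : PhaseSpace, R ≤ |P.2.1| → f P = 0 := by
    obtain ⟨R, hR⟩ := (hf_compact.isCompact.image
      (continuous_fst.comp continuous_snd)).isBounded.exists_norm_le
    exact ⟨R + 1, fun P hP => image_eq_zero_of_notMem_tsupport fun hmem =>
      (lt_add_one R).not_ge (hP.trans (hR _ ⟨P, hmem, rfl⟩))⟩
  set I := ∫ P, |h P|
  have hI : 0 ≤ I := integral_nonneg fun P => abs_nonneg _
  refine abs_nonpos_iff.1 (le_of_forall_pos_le_add fun ε hε => ?_)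
  obtain ⟨w, hw, hclose⟩ := exists_isTestFunction_abs_sub_le hT hf hR
    (ε := ε / (I + 1)) (by positivity)
  have hfh : Integrable fun P => f P * h P :=
    hh.bdd_mul hf.aestronglyMeasurable (Eventually.of_forall hC)
  calc |∫ P, f P * h P| = |∫ P, (w 0 P * h P - f P * h P)| := by
        rw [integral_sub (hw.isC1TestFunction.integrable_initial_mul hT.le hh) hfh, hzero w hw,
          zero_sub, abs_neg]
    _ ≤ ∫ P, ε / (I + 1) * |h P| := by
        rw [← norm_eq_abs]
        refine norm_integral_le_of_norm_le (hh.abs.const_mul _) (Eventually.of_forall fun P => ?_)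
        rw [← sub_mul, norm_mul]
        exact mul_le_mul_of_nonneg_right (hclose P) (abs_nonneg _)
    _ = ε * (I / (I + 1)) := by rw [integral_const_mul, div_mul_eq_mul_div, mul_div_assoc]
    _ ≤ 0 + ε := by
        rw [zero_add]
        exact mul_le_of_le_one_right hε.le (div_le_one_of_le₀ (by linarith) (by linarith))

section WeakSolution

variable {r : PhaseSpace → ℝ} {ρ ρ' : ℝ → PhaseSpace → ℝ}

lemma IsWeakSolution.ae_eq_flowDensity_solutionField (hρ : IsWeakSolution W K T r ρ)
    (hr : Measurable r) (hr0 : ∀ P, 0 ≤ r P) [IsProbabilityMeasure (densityMeasure r)]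
    (hT : 0 < T) (hW : IsGraphonBound A W) (hZ : IsMeanField B (solutionField W K T ρ)) {t : ℝ}
    (ht : t ∈ Icc 0 T) : ρ t =ᵐ[volume] flowDensity (solutionField W K T ρ) r t := by
  have hρ_int := hρ.integrable t ht
  have hflow_int := integrable_flowDensity hr hr0 hZ t
  refine (sub_ae_eq_zero _ _).1
    (ae_eq_zero_of_forall_isTestFunction hT (hρ_int.sub hflow_int) fun w hw => ?_)
  have hw_mul {h : PhaseSpace → ℝ} (hh : Integrable h) :=
    hw.isC1TestFunction.integrable_initial_mul hT.le hh
  simp only [Pi.sub_apply, mul_sub]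
  rw [integral_sub (hw_mul hρ_int) (hw_mul hflow_int),
    hρ.integral_mul_eq_flowDensity hr hr0 hT hW hZ hw ht, sub_self]

lemma densityField_congr_ae (W : unitInterval → unitInterval → ℝ) (K : ℝ) {σ σ' : PhaseSpace → ℝ}
    (h : σ =ᵐ[volume] σ') : densityField W K σ = densityField W K σ' := by
  funext x
  unfold densityField
  congr 2 <;> refine integral_congr_ae ?_ <;> filter_upwards [h] with P hP <;> rw [hP]

lemma IsWeakSolution.isSelfConsistent_solutionField (hρ : IsWeakSolution W K T r ρ)
    (hr : Measurable r) (hr0 : ∀ P, 0 ≤ r P) [IsProbabilityMeasure (densityMeasure r)]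
    (hT : 0 < T) (hW : IsGraphonBound A W) (hZ : IsMeanField B (solutionField W K T ρ)) :
    IsSelfConsistent W K T (densityMeasure r) (solutionField W K T ρ) := by
  intro t ht x
  rw [solutionField_of_mem_Icc W K ρ ht, densityField_congr_ae W K
    (hρ.ae_eq_flowDensity_solutionField hr hr0 hT hW hZ ht), densityField_flowDensity hr hr0 hZ]

lemma IsWeakSolution.ae_eq (hρ : IsWeakSolution W K T r ρ) (hρ' : IsWeakSolution W K T r ρ')
    (hr : Measurable r) (hr0 : ∀ P, 0 ≤ r P) [IsProbabilityMeasure (densityMeasure r)]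
    (hT : 0 < T) (hW : IsGraphonBound A W) {t : ℝ} (ht : t ∈ Icc 0 T) :
    ρ t =ᵐ[volume] ρ' t := by
  obtain ⟨M, hM⟩ := hρ.exists_isDensityBound
  obtain ⟨M', hM'⟩ := hρ'.exists_isDensityBound
  have hY := hρ.isMeanField_solutionField hM hT.le hW
  have hY' := hρ'.isMeanField_solutionField hM' hT.le hW
  obtain ⟨Z, hZ, hself⟩ := exists_isSelfConsistent hW (densityMeasure r) K hT.le
  have hfield : solutionField W K T ρ = solutionField W K T ρ' := by
    funext t x
    have ht := stoppedTime_mem_Icc hT.le t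
    have hfix := stoppedTime_of_mem_Icc ht
    have heq := (hself.eq hW hZ hY
      (hρ.isSelfConsistent_solutionField hr hr0 hT hW hY) _ ht).symm.trans
      (hself.eq hW hZ hY' (hρ'.isSelfConsistent_solutionField hr hr0 hT hW hY') _ ht)
    simpa only [solutionField, hfix] using congrFun heq x
  refine (hρ.ae_eq_flowDensity_solutionField hr hr0 hT hW hY ht).trans ?_
  rw [hfield]
  exact (hρ'.ae_eq_flowDensity_solutionField hr hr0 hT hW hY' ht).symm

end WeakSolution

/-! ### Convergence of the empirical measures -/

section Empirical

variable {n : ℕ}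

instance isProbabilityMeasure_empiricalMeasure [NeZero n] (P : Fin n → PhaseSpace) :
    IsProbabilityMeasure (empiricalMeasure P) := by
  refine ⟨?_⟩
  simp only [empiricalMeasure, Measure.smul_apply, Measure.finsetSum_apply, measure_univ,
    Finset.sum_const, Finset.card_univ, Fintype.card_fin, nsmul_eq_mul, mul_one, smul_eq_mul]
  exact ENNReal.inv_mul_cancel (Nat.cast_ne_zero.2 (NeZero.ne n)) (ENNReal.natCast_ne_top n)

lemma integral_empiricalMeasure (P : Fin n → PhaseSpace) (f : PhaseSpace → ℝ) :
    ∫ Q, f Q ∂(empiricalMeasure P) = (n : ℝ)⁻¹ * ∑ i, f (P i) := by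
  rw [empiricalMeasure, integral_smul_measure, integral_finsetSum_measure
    fun i _ => integrable_dirac (by simp)]
  simp

lemma map_empiricalMeasure {Φ : PhaseSpace → PhaseSpace} (hΦ : Measurable Φ)
    (P : Fin n → PhaseSpace) :
    (empiricalMeasure P).map Φ = empiricalMeasure fun i => Φ (P i) := by
  rw [empiricalMeasure, Measure.map_smul, Measure.map_finset_sum' hΦ.aemeasurable]
  simp only [Measure.map_dirac' hΦ, empiricalMeasure]

lemma isMeanField_meanField_empiricalMeasure [NeZero n] (hW : IsGraphonBound A W) (K : ℝ)
    {φ : Fin n → ℝ → ℝ} (hφ : ∀ i, Continuous (φ i)) (ω : Fin n → ℝ) (ξ : Fin n → unitInterval) :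
    IsMeanField (fieldBound K A) fun t =>
      meanField W K (empiricalMeasure fun i => ((φ i t : ℝ), ω i, ξ i)) where
  continuous x := by
    simp only [meanField, integral_empiricalMeasure, circCos_coe, circSin_coe]
    fun_prop
  norm_le t x := norm_meanField_le hW K _ x
  lipschitz t x y := norm_meanField_site_sub_le hW K _ x y

lemma phaseSpeed_meanField_empiricalMeasure (W : unitInterval → unitInterval → ℝ) (K : ℝ)
    (φ ω : Fin n → ℝ) (ξ : Fin n → unitInterval) (i : Fin n) :
    phaseSpeed (meanField W K (empiricalMeasure fun j => ((φ j : ℝ), ω j, ξ j)) (ξ i)) (ω i) (φ i)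
      = ω i + K * (n : ℝ)⁻¹ * ∑ j, graphWeight W ξ i j * circSin ((φ j : Circ) - φ i) := by
  simp only [phaseSpeed, meanField, integral_empiricalMeasure, circSin_sub, circCos_coe,
    circSin_coe, graphWeight, mul_sub, Finset.sum_sub_distrib, ← mul_assoc, ← Finset.sum_mul]
  ring

lemma eq_phaseFlow_of_isIntegralCurveOn (hZ : IsMeanField B Z) {y : ℝ × unitInterval} {γ : ℝ → ℝ}
    (hγ : IsIntegralCurveOn γ (fun t θ => phaseSpeed (Z t y.2) y.1 θ) (Icc 0 T)) {t : ℝ}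
    (ht : t ∈ Icc 0 T) : γ t = phaseFlow Z 0 t (γ 0) y := by
  have h := norm_sub_le_of_isIntegralCurveOn (m := 0) (c := 2 * B + 1)
    (fun t _ => (hZ.isFlowField y).norm_sub_le t) hγ
    ((isIntegralCurve_phaseFlow hZ 0 (γ 0) y).isIntegralCurveOn _) le_rfl (by simp) (by linarith)
    t ht
  rw [phaseFlow_self, sub_self, norm_zero, zero_div, add_zero, zero_mul] at h
  exact sub_eq_zero.1 (norm_le_zero_iff.1 h)

variable {ω : Fin n → ℝ} {ξ : Fin n → unitInterval} {θ : Fin n → ℝ → Circ}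

lemma IsKuramotoSolution.exists_isSelfConsistent [NeZero n] (hW : IsGraphonBound A W) (hT : 0 ≤ T)
    (h : IsKuramotoSolution K T (graphWeight W ξ) ω θ) :
    ∃ Z, IsMeanField (fieldBound K A) Z ∧
      IsSelfConsistent W K T (empiricalMeasure fun i => (θ i 0, ω i, ξ i)) Z ∧
      ∀ t ∈ Icc 0 T, (empiricalMeasure fun i => (θ i 0, ω i, ξ i)).map (flowMap Z 0 t)
        = empiricalMeasure fun i => (θ i t, ω i, ξ i) := by
  obtain ⟨φ, hφθ, hφ⟩ := h
  have hφ_stopped i : Continuous fun t => φ i (stoppedTime T t) :=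
    ContinuousOn.comp_continuous (fun t ht => (hφ i t ht).continuousWithinAt)
      (continuous_stoppedTime T) (stoppedTime_mem_Icc hT)
  set Z : ℝ → unitInterval → ℝ × ℝ := fun t =>
    meanField W K (empiricalMeasure fun i => ((φ i (stoppedTime T t) : ℝ), ω i, ξ i)) with hZ_def
  have hZ : IsMeanField (fieldBound K A) Z :=
    isMeanField_meanField_empiricalMeasure hW K hφ_stopped ω ξ
  have hZ_eq : ∀ t ∈ Icc 0 T,
      Z t = meanField W K (empiricalMeasure fun i => ((φ i t : ℝ), ω i, ξ i)) := fun t ht => by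
    simp only [hZ_def, stoppedTime_of_mem_Icc ht]
  have hcurve i : IsIntegralCurveOn (φ i) (fun t ϑ => phaseSpeed (Z t (ξ i)) (ω i) ϑ) (Icc 0 T) :=
    fun t ht => (hφ i t ht).congr_deriv (by
      simp only [hZ_eq t ht, phaseSpeed_meanField_empiricalMeasure, ← hφθ _ t ht])
  have hmap : ∀ t ∈ Icc 0 T, (empiricalMeasure fun i => (θ i 0, ω i, ξ i)).map (flowMap Z 0 t)
      = empiricalMeasure fun i => (θ i t, ω i, ξ i) := fun t ht => by
    have hflow i := eq_phaseFlow_of_isIntegralCurveOn hZ (y := (ω i, ξ i)) (hcurve i) ht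
    rw [map_empiricalMeasure (continuous_flowMap hZ 0 t).measurable]
    simp only [← hφθ _ 0 ⟨le_rfl, hT⟩, ← hφθ _ t ht, flowMap_coe hZ, ← hflow]
  refine ⟨Z, hZ, fun t ht x => ?_, hmap⟩
  rw [hmap t ht, hZ_eq t ht]
  simp only [hφθ _ t ht]

end Empirical

lemma tendstoUniformlyOn_dBL_empiricalMeasure (hW : IsGraphonBound A W) (hT : 0 ≤ T)
    {μ : Measure PhaseSpace} [IsProbabilityMeasure μ] (hZ : IsMeanField B Z)
    (hself : IsSelfConsistent W K T μ Z) {ω : (n : ℕ) → Fin n → ℝ}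
    {ξ : (n : ℕ) → Fin n → unitInterval} {θ : (n : ℕ) → Fin n → ℝ → Circ}
    (hθ : ∀ n, IsKuramotoSolution K T (graphWeight W (ξ n)) (ω n) (θ n))
    (hlim : Tendsto (fun n => dBL (empiricalMeasure fun i => (θ n i 0, ω n i, ξ n i)) μ) atTop
      (𝓝 0)) :
    TendstoUniformlyOn
      (fun n t => dBL (empiricalMeasure fun i => (θ n i t, ω n i, ξ n i)) (μ.map (flowMap Z 0 t)))
      (fun _ => 0) atTop (Icc 0 T) := by
  rw [Metric.tendstoUniformlyOn_iff]
  intro ε hε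
  have hbound := hlim.const_mul (stabilityConst (fieldBound K A) T)
  rw [mul_zero] at hbound
  filter_upwards [hbound.eventually_lt_const hε, eventually_ne_atTop 0] with n hn hn0 t ht
  have : NeZero n := ⟨hn0⟩
  obtain ⟨Zn, hZn, hselfn, hmap⟩ := (hθ n).exists_isSelfConsistent hW hT
  rw [dist_comm, dist_zero_right, Real.norm_eq_abs, abs_of_nonneg (dBL_nonneg _ _), ← hmap t ht]
  exact (hselfn.dBL_map_le hW hZn hZ hself ht).trans_lt hn

lemma isProbabilityMeasure_initial {g : ℝ → ℝ} (hg : IsFrequencyDensity g) {p : PhaseSpace → ℝ}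
    (hp : IsInitialConditionalDensity p) :
    IsProbabilityMeasure (densityMeasure fun P => p P * g P.2.1) := by
  have hpg : Continuous fun P : PhaseSpace => p P * g P.2.1 :=
    hp.continuous.mul (hg.continuous.comp (by fun_prop))
  have hfiber (y : ℝ × unitInterval) : ∫⁻ θ : Circ, ENNReal.ofReal (p (θ, y) * g y.1)
      = ENNReal.ofReal (g y.1) := by
    have hpg_y : Continuous fun θ : Circ => p (θ, y) * g y.1 :=
      hpg.comp (f := fun θ : Circ => ((θ, y) : PhaseSpace)) (by fun_prop)
    rw [← ofReal_integral_eq_lintegral_ofReal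
      (hpg_y.integrable_of_hasCompactSupport (HasCompactSupport.of_compactSpace _))
      (Eventually.of_forall fun θ => mul_nonneg (hp.nonneg _) (hg.nonneg _)),
      integral_mul_const, hp.integral_eq_one, one_mul]
  have hg_meas : Measurable fun y : ℝ × unitInterval => ENNReal.ofReal (g y.1) :=
    (hg.continuous.comp continuous_fst).measurable.ennreal_ofReal
  refine ⟨?_⟩
  rw [densityMeasure, withDensity_apply _ MeasurableSet.univ, Measure.restrict_univ,
    Measure.volume_eq_prod, lintegral_prod_symm _ hpg.measurable.ennreal_ofReal.aemeasurable]
  simp only [hfiber]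
  rw [Measure.volume_eq_prod, lintegral_prod _ hg_meas.aemeasurable]
  simp only [lintegral_const, measure_univ, mul_one]
  rw [← ofReal_integral_eq_lintegral_ofReal hg.integrable (Eventually.of_forall hg.nonneg),
    hg.integral_eq_one, ENNReal.ofReal_one]

end

end KuramotoGraph

open KuramotoGraph in
theorem theorem2p1_general
    (W : unitInterval → unitInterval → ℝ) (hW : IsLipschitzGraphon W) (K : ℝ)
    (r : PhaseSpace → ℝ) (hr : Measurable r) (hr0 : ∀ P, 0 ≤ r P)
    [IsProbabilityMeasure (densityMeasure r)] (T : ℝ) (hT : 0 < T) :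
    ∃ ρ : ℝ → PhaseSpace → ℝ,
      IsWeakSolution W K T r ρ ∧
      (∀ ρ' : ℝ → PhaseSpace → ℝ, IsWeakSolution W K T r ρ' →
        ∀ t ∈ Icc 0 T, ρ' t =ᵐ[volume] ρ t) ∧
      (∀ t ∈ Icc 0 T, (∀ᵐ P, 0 ≤ ρ t P) ∧ IsProbabilityMeasure (densityMeasure (ρ t))) ∧
      ∀ (ω : (n : ℕ) → Fin n → ℝ) (ξ : (n : ℕ) → Fin n → unitInterval)
        (θ : (n : ℕ) → Fin n → ℝ → Circ),
        (∀ n, IsKuramotoSolution K T (graphWeight W (ξ n)) (ω n) (θ n)) →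
        Tendsto (fun n => dBL (empiricalMeasure fun i => (θ n i 0, ω n i, ξ n i))
          (densityMeasure (ρ 0))) atTop (𝓝 0) →
        TendstoUniformlyOn
          (fun n t => dBL (empiricalMeasure fun i => (θ n i t, ω n i, ξ n i))
            (densityMeasure (ρ t)))
          (fun _ => 0) atTop (Icc 0 T) := by
  obtain ⟨A, hA⟩ := hW.exists_isGraphonBound
  obtain ⟨Z, hZ, hself⟩ := exists_isSelfConsistent hA (densityMeasure r) K hT.le
  have hweak : IsWeakSolution W K T r (flowDensity Z r) :=
    isWeakSolution_flowDensity hr hr0 hZ hA hT.le hself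
  refine ⟨flowDensity Z r, hweak,
    fun ρ' hρ' t ht => hρ'.ae_eq hweak hr hr0 hT hA ht,
    fun t _ => ⟨Eventually.of_forall (flowDensity_nonneg Z hr0 t),
      isProbabilityMeasure_flowDensity hr hr0 hZ t⟩, fun ω ξ θ hθ hlim => ?_⟩
  rw [flowDensity_zero] at hlim
  simp only [densityMeasure_flowDensity hZ hr hr0]
  exact tendstoUniformlyOn_dBL_empiricalMeasure hA hT.le hZ hself hθ hlim

open KuramotoGraph in
theorem theorem2p1
    (W : unitInterval → unitInterval → ℝ) (hW : IsLipschitzGraphon W) (K : ℝ)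
    (g : ℝ → ℝ) (hg : IsFrequencyDensity g)
    (p : PhaseSpace → ℝ) (hp : IsInitialConditionalDensity p)
    (T : ℝ) (hT : 0 < T) :
    ∃ ρ : ℝ → PhaseSpace → ℝ,
      IsWeakSolution W K T (fun P => p P * g P.2.1) ρ ∧
      (∀ ρ' : ℝ → PhaseSpace → ℝ, IsWeakSolution W K T (fun P => p P * g P.2.1) ρ' →
        ∀ t ∈ Icc 0 T, ρ' t =ᵐ[volume] ρ t) ∧
      (∀ t ∈ Icc 0 T, (∀ᵐ P, 0 ≤ ρ t P) ∧ IsProbabilityMeasure (densityMeasure (ρ t))) ∧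
      ∀ (ω : ℕ → ℝ) (ξ : (n : ℕ) → Fin n → unitInterval) (θ : (n : ℕ) → Fin n → ℝ → Circ),
        (∀ n, IsKuramotoSolution K T (graphWeight W (ξ n)) (fun i => ω i) (θ n)) →
        Tendsto (fun n => dBL (empiricalMeasure fun i => (θ n i 0, ω i, ξ n i))
          (densityMeasure (ρ 0))) atTop (𝓝 0) →
        TendstoUniformlyOn
          (fun n t => dBL (empiricalMeasure fun i => (θ n i t, ω i, ξ n i))
            (densityMeasure (ρ t)))
          (fun _ => 0) atTop (Icc 0 T) := by
  have := isProbabilityMeasure_initial hg hp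
  obtain ⟨ρ, hweak, huniq, hprob, hconv⟩ := theorem2p1_general W hW K (fun P => p P * g P.2.1)
    (hp.continuous.mul (hg.continuous.comp (by fun_prop))).measurable
    (fun P => mul_nonneg (hp.nonneg P) (hg.nonneg _)) T hT
  exact ⟨ρ, hweak, huniq, hprob, fun ω => hconv fun _ i => ω i⟩
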